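/- **Setting.** A constructor vocabulary $\mathcal C$ is a finite set of constructors with arities, at least one of them nullary. A hyper-term is a finite or infinite ordered tree of constructors in which each node labelled with an $r$-ary constructor has exactly $r$ children. A data-system $\mathcal D$ over $\mathcal C$ is a finite list of bundles of type-identifiers (unary predicates), each bundle being inductive or coinductive. A type $\mathbf D$ of an inductive bundle has finitely many construction rules $\forall\vec y\;\mathbf Q_1(y_1)\wedge\dots\wedge\mathbf Q_r(y_r)\to\mathbf D(\mathbf c(\vec y))$; a type $\mathbf D$ of a coinductive bundle has one deconstruction rule $\forall x\;\mathbf D(x)\to\bigvee\exists\vec y\,(x=\mathbf c(\vec y)\wedge\mathbf Q_1(y_1)\wedge\dots\wedge\mathbf Q_r(y_r))$, a finite disjunction. Here each $\mathbf Q_\ell$ is a type of the same or of an earlier bundle. The intrinsic theory $\mathbf T=\mathbf{IT}(\mathcal D)$ is the classical first-order theory with equality whose axioms are: separation (constructors are injective with pairwise disjoint codomains), the construction and deconstruction rules, and the schemas of induction (for each inductive bundle) and coinduction (for each coinductive bundle) for vectors of arbitrary formulas. Formulas may also contain program-functions (free function symbols, not governed by axioms). $\mathbf{PRA}^*$ is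 the classical theory of natural numbers with number variables, function variables of each arity, quantifiers over both, and free functional variables (from numeric functions to numeric functions). Its terms are built from these and from $0$, successor and identifiers for all primitive recursive functions and functionals. Equality of functions is extensional. Its axioms are the defining equations of the primitive recursive functions and functionals, separation for $\mathbb N$, induction for all formulas, and Explicit Definition $\exists g\,\forall\vec x\;g(\vec x)=\mathbf t$. **Interpretation.** Finite sequences of numbers (addresses) are coded by numbers, $*$ is concatenation, and each constructor $\mathbf c$ has a distinct code $\mathbf c^\sharp$. A unary function $f$ represents a hyper-term $t$ if $f(a)=\mathbf c^\sharp$ whenever $\mathbf c$ is the constructor of $t$ at the address $a$; nothing is required of $f$ at numbers that are not addresses of $t$. $\mathit{Htm}[f]$ is the formula stating that $f$ represents a hyper-term. $\hat{\mathbf c}$ is the primitive recursive functional with $\hat{\mathbf c}(f_0,\dots,f_{r-1})\langle\rangle=\mathbf c^\sharp$ and $\hat{\mathbf c}(f_0,\dots,f_{r-1})(\langle i\rangle*a)=f_i(a)$ for $i<r$. The translation $^\natural$ maps an object variable to a unary function variable, $\mathbf c(\vec{\mathbf t})$ to $\hat{\mathbf c}(\vec{\mathbf t}^\natural)$, and a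 program-function $\mathbf f$ to a functional variable $\mathbf f^\natural$. It maps $\mathbf t=\mathbf q$ to the formula stating that $\mathbf t^\natural$ and $\mathbf q^\natural$ represent the same hyper-term, i.e. agree at all addresses. It maps $\mathbf D(\mathbf t)$ to $\mathbf D^\natural[\mathbf t^\natural]$, where $\mathbf D^\natural[f]$ is the following arithmetical formula, defined by recursion on the bundles. If $\mathbf D$ is inductive: there is a finite derivation of the typing of $f$ by $\mathbf D$, i.e. a finite decoration of addresses with types of the bundle of $\mathbf D$, with $\mathbf D$ at the root, in which every decorated address is justified by a rule whose constructor is the one of $f$ there and whose types from earlier bundles hold, in the sense of $^\natural$, of the corresponding sub-terms of $f$. If $\mathbf D$ is coinductive: for every $h$ there is such a decoration, bounded by a primitive recursive function of $h$, in which every decorated address of length less than $h$ is justified. The translation commutes with the connectives, and quantifiers are relativized to $\mathit{Htm}$. For a program-function $\mathbf f$, let $\mathit{Rep}[\mathbf f^\natural]$ state that $\mathbf f^\natural$ represents a function over hyper-terms: if $x_j,y_j$ represent the same hyper-term for each $j$, then $\mathbf f^\natural(\vec x)$ and $\mathbf f^\natural(\vec y)$ represent the same hyper-term. **Theorem.**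 Every intrinsic theory $\mathbf T=\mathbf{IT}(\mathcal D)$ is interpretable in $\mathbf{PRA}^*$ through $^\natural$. That is: 1. $\mathbf{PRA}^*$ proves $\exists f\,\mathit{Htm}[f]$ and, for each constructor $\mathbf c$, $\mathit{Htm}[\vec f]\to\mathit{Htm}[\hat{\mathbf c}(\vec f)]$. 2. If a closed formula $\varphi$ without program-functions is provable in $\mathbf T$, then $\varphi^\natural$ is provable in $\mathbf{PRA}^*$. 3. More generally, if $\varphi$, with free variables among $\vec x$ and program-functions among $\vec{\mathbf f}$, is provable in $\mathbf T$ (in the language with program-functions $\vec{\mathbf f}$), then $\mathbf{PRA}^*$ proves $\mathit{Htm}[\vec x^\natural]\to\mathit{Rep}[\vec{\mathbf f}^\natural]\to\varphi^\natural$. In particular, without program-functions, it proves $\mathit{Htm}[\vec x^\natural]\to\varphi^\natural$. -/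

import Mathlib

namespace IntrinsicTheory

/-! ## Data-systems -/

/-- A constructor vocabulary: finitely many constructors with arities, at least one of them
nullary (such a constructor is posited throughout). -/
structure ConVoc where
  num : ℕ
  arity : Fin num → ℕ
  nullary : ∃ o, arity o = 0

/-- The type-identifiers that may occur in the premises (or in the constructor-statements) of a
rule for bundle `b`: those of the bundle itself and those of the earlier bundles. -/
inductive ArgType {k : ℕ} (size : Fin k → ℕ) (b : Fin k) : Type
  | own (i : Fin (size b)) : ArgType size b
  | lower (b' : Fin k) (h : b' < b) (i : Fin (size b')) : ArgType size b

/-- The data `c, Q₁, …, Q_r` of a rule for bundle `b`. For a type `D` of an inductive bundle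
it is the construction rule `∀ y, Q₁(y₁) ∧ ⋯ ∧ Q_r(y_r) → D(c(y))`; for a coinductive bundle it
is the constructor-statement `∃ y, x = c(y) ∧ Q₁(y₁) ∧ ⋯ ∧ Q_r(y_r)`, a disjunct of the
deconstruction rule of `D`. -/
structure Rule (C : ConVoc) {k : ℕ} (size : Fin k → ℕ) (b : Fin k) : Type where
  con : Fin C.num
  arg : Fin (C.arity con) → ArgType size b

/-- The designation of a bundle. -/
inductive BundleKind : Type
  | ind : BundleKind
  | coind : BundleKind

/-- A data-system over `C`: a list of bundles of type-identifiers, bundle `b` having the types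
`(b, i)`, `i < size b`, each bundle being inductive or coinductive, with the rules of each type. -/
structure DataSystem (C : ConVoc) : Type where
  bundles : ℕ
  size : Fin bundles → ℕ
  kind : Fin bundles → BundleKind
  rules : (b : Fin bundles) → Fin (size b) → List (Rule C size b)

/-! ## The first-order language of a data-system, with program-functions

The program-functions are given by the list `P` of their arities. Variables are de Bruijn
indices: `Tm C P n` are the terms with free variables among `x₀, …, x_{n-1}`. -/

/-- Program-terms. -/
inductive Tm (C : ConVoc) (P : List ℕ) (n : ℕ) : Type
  | var (i : Fin n) : Tm C P n
  | con (c : Fin C.num) (ts : Fin (C.arity c) → Tm C P n) : Tm C P n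
  | prog (f : Fin P.length) (ts : Fin (P.get f) → Tm C P n) : Tm C P n

/-- First-order formulas; `all` and `ex` bind the variable with index `0`. -/
inductive Fm {C : ConVoc} (D : DataSystem C) (P : List ℕ) : ℕ → Type
  | bot {n : ℕ} : Fm D P n
  | eq {n : ℕ} (t u : Tm C P n) : Fm D P n
  | ty {n : ℕ} (b : Fin D.bundles) (i : Fin (D.size b)) (t : Tm C P n) : Fm D P n
  | imp {n : ℕ} (φ ψ : Fm D P n) : Fm D P n
  | and {n : ℕ} (φ ψ : Fm D P n) : Fm D P n
  | or {n : ℕ} (φ ψ : Fm D P n) : Fm D P n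
  | all {n : ℕ} (φ : Fm D P (n + 1)) : Fm D P n
  | ex {n : ℕ} (φ : Fm D P (n + 1)) : Fm D P n

def Tm.subst {C : ConVoc} {P : List ℕ} {n m : ℕ} (σ : Fin n → Tm C P m) : Tm C P n → Tm C P m
  | .var i => σ i
  | .con c ts => .con c (fun k => (ts k).subst σ)
  | .prog f ts => .prog f (fun k => (ts k).subst σ)

/-- Weakening by a new variable with index `0`. -/
def Tm.up {C : ConVoc} {P : List ℕ} {n : ℕ} (t : Tm C P n) : Tm C P (n + 1) :=
  t.subst (fun i => .var i.succ)

/-- The substitution `σ` under a binder. -/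
def liftSubst {C : ConVoc} {P : List ℕ} {n m : ℕ} (σ : Fin n → Tm C P m) :
    Fin (n + 1) → Tm C P (m + 1) :=
  Fin.cases (.var 0) (fun i => (σ i).up)

namespace Fm

variable {C : ConVoc} {D : DataSystem C} {P : List ℕ}

/-- Capture-avoiding simultaneous substitution. -/
def subst {n m : ℕ} (σ : Fin n → Tm C P m) : Fm D P n → Fm D P m
  | .bot => .bot
  | .eq t u => .eq (t.subst σ) (u.subst σ)
  | .ty b i t => .ty b i (t.subst σ)
  | .imp φ ψ => .imp (φ.subst σ) (ψ.subst σ)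
  | .and φ ψ => .and (φ.subst σ) (ψ.subst σ)
  | .or φ ψ => .or (φ.subst σ) (ψ.subst σ)
  | .all φ => .all (φ.subst (liftSubst σ))
  | .ex φ => .ex (φ.subst (liftSubst σ))

/-- Weakening by a new variable with index `0`. -/
def up {n : ℕ} (φ : Fm D P n) : Fm D P (n + 1) :=
  φ.subst (fun i => .var i.succ)

/-- `φ[t]`: the term `t` for the variable with index `0`. -/
def inst {n : ℕ} (φ : Fm D P (n + 1)) (t : Tm C P n) : Fm D P n :=
  φ.subst (Fin.cases t (fun i => .var i))

/-- Finite conjunction; the empty one is `⊥ → ⊥`. -/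
def conj {n : ℕ} (l : List (Fm D P n)) : Fm D P n :=
  l.foldr .and (.imp .bot .bot)

/-- Finite disjunction; the empty one is `⊥`. -/
def disj {n : ℕ} (l : List (Fm D P n)) : Fm D P n :=
  l.foldr .or .bot

/-- `r` universal quantifiers, binding the variables with indices `0, …, r - 1`. -/
def alls {n : ℕ} : (r : ℕ) → Fm D P (n + r) → Fm D P n
  | 0, φ => φ
  | r + 1, φ => alls r (.all φ)

/-- `r` existential quantifiers, binding the variables with indices `0, …, r - 1`. -/
def exs {n : ℕ} : (r : ℕ) → Fm D P (n + r) → Fm D P n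
  | 0, φ => φ
  | r + 1, φ => exs r (.ex φ)

end Fm

/-- The variables `y₀, …, y_{r-1}` bound by `Fm.alls r` and `Fm.exs r`. -/
def bvars (C : ConVoc) (P : List ℕ) (n r : ℕ) (k : Fin r) : Tm C P (n + r) :=
  .var (Fin.castLE (Nat.le_add_left r n) k)

/-! ## Intrinsic theories -/

section Theory

variable {C : ConVoc} (D : DataSystem C) {P : List ℕ}

/-- The formula `Q(t)` with the types `D_i` of the bundle `b` replaced by the formulas `φ_i[x]`
(`x` is the variable with index `0`; the parameters of `φ_i` are renamed by `ρ`). -/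
def argForm {b : Fin D.bundles} {n m : ℕ} (φ : Fin (D.size b) → Fm D P (n + 1))
    (ρ : Fin n → Fin m) (Q : ArgType D.size b) (t : Tm C P m) : Fm D P m :=
  match Q with
  | .own i => (φ i).subst (Fin.cases t (fun j => .var (ρ j)))
  | .lower b' _ i => .ty b' i t

/-- `Constr[φ]`: the conjunction of the construction rules
`∀ y, Q₁(y₁) ∧ ⋯ ∧ Q_r(y_r) → D_i(c(y))` of the bundle `b`, with `D_i(t)` replaced by
`φ_i[t]`. -/
def constrForm {n : ℕ} (b : Fin D.bundles) (φ : Fin (D.size b) → Fm D P (n + 1)) : Fm D P n :=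
  Fm.conj (List.ofFn fun i : Fin (D.size b) => Fm.conj ((D.rules b i).map fun R =>
    Fm.alls (C.arity R.con) (.imp
      (Fm.conj (List.ofFn fun k : Fin (C.arity R.con) =>
        argForm D φ (fun j => j.addNat (C.arity R.con)) (R.arg k)
          (bvars C P n (C.arity R.con) k)))
      (argForm D φ (fun j => j.addNat (C.arity R.con)) (.own i)
        (.con R.con (bvars C P n (C.arity R.con)))))))

/-- `Deconstr[φ]`: the conjunction of the deconstruction rules
`∀ x, D_i(x) → ⋁ (∃ y, x = c(y) ∧ Q₁(y₁) ∧ ⋯ ∧ Q_r(y_r))` of the bundle `b`, with `D_i(t)`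
replaced by `φ_i[t]`. -/
def deconstrForm {n : ℕ} (b : Fin D.bundles) (φ : Fin (D.size b) → Fm D P (n + 1)) : Fm D P n :=
  Fm.conj (List.ofFn fun i : Fin (D.size b) => .all (.imp (φ i)
    (Fm.disj ((D.rules b i).map fun R =>
      Fm.exs (C.arity R.con) (.and
        (.eq (.var ((0 : Fin (n + 1)).addNat (C.arity R.con)))
          (.con R.con (bvars C P (n + 1) (C.arity R.con))))
        (Fm.conj (List.ofFn fun k : Fin (C.arity R.con) =>
          argForm D φ (fun j => j.succ.addNat (C.arity R.con)) (R.arg k)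
            (bvars C P (n + 1) (C.arity R.con) k))))))))

/-- The formulas `D_i(x)` for the types `D_i` of the bundle `b`. -/
def bundleForms (b : Fin D.bundles) (n : ℕ) (i : Fin (D.size b)) : Fm D P (n + 1) :=
  .ty b i (.var 0)

/-- The axioms of the intrinsic theory of `D` (open instances of separation, and the schemas with
parameters among the `n` free variables). -/
inductive ITAxiom {n : ℕ} : Fm D P n → Prop
  | sep_inj (c : Fin C.num) (s t : Fin (C.arity c) → Tm C P n) (k : Fin (C.arity c)) :
      ITAxiom (.imp (.eq (.con c s) (.con c t)) (.eq (s k) (t k)))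
  | sep_ne (c d : Fin C.num) (h : c ≠ d) (s : Fin (C.arity c) → Tm C P n)
      (t : Fin (C.arity d) → Tm C P n) :
      ITAxiom (.imp (.eq (.con c s) (.con d t)) .bot)
  | construction (b : Fin D.bundles) (h : D.kind b = .ind) :
      ITAxiom (constrForm D b (bundleForms D b n))
  | deconstruction (b : Fin D.bundles) (h : D.kind b = .coind) :
      ITAxiom (deconstrForm D b (bundleForms D b n))
  | induction (b : Fin D.bundles) (h : D.kind b = .ind)
      (φ : Fin (D.size b) → Fm D P (n + 1)) :
      ITAxiom (.imp (constrForm D b φ)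
        (Fm.conj (List.ofFn fun i => .all (.imp (.ty b i (.var 0)) (φ i)))))
  | coinduction (b : Fin D.bundles) (h : D.kind b = .coind)
      (φ : Fin (D.size b) → Fm D P (n + 1)) :
      ITAxiom (.imp (deconstrForm D b φ)
        (Fm.conj (List.ofFn fun i => .all (.imp (φ i) (.ty b i (.var 0))))))

/-- Derivability in the intrinsic theory of `D`: natural deduction for classical first-order logic
with equality, from the axioms of the theory. -/
inductive ITDer : {n : ℕ} → List (Fm D P n) → Fm D P n → Prop
  | ax {n : ℕ} {Γ : List (Fm D P n)} {φ : Fm D P n} (h : ITAxiom D φ) : ITDer Γ φ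
  | hyp {n : ℕ} {Γ : List (Fm D P n)} {φ : Fm D P n} (h : φ ∈ Γ) : ITDer Γ φ
  | raa {n : ℕ} {Γ : List (Fm D P n)} {φ : Fm D P n} (h : ITDer (.imp φ .bot :: Γ) .bot) :
      ITDer Γ φ
  | impI {n : ℕ} {Γ : List (Fm D P n)} {φ ψ : Fm D P n} (h : ITDer (φ :: Γ) ψ) :
      ITDer Γ (.imp φ ψ)
  | impE {n : ℕ} {Γ : List (Fm D P n)} {φ ψ : Fm D P n} (h₁ : ITDer Γ (.imp φ ψ))
      (h₂ : ITDer Γ φ) : ITDer Γ ψ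
  | andI {n : ℕ} {Γ : List (Fm D P n)} {φ ψ : Fm D P n} (h₁ : ITDer Γ φ) (h₂ : ITDer Γ ψ) :
      ITDer Γ (.and φ ψ)
  | andE₁ {n : ℕ} {Γ : List (Fm D P n)} {φ ψ : Fm D P n} (h : ITDer Γ (.and φ ψ)) : ITDer Γ φ
  | andE₂ {n : ℕ} {Γ : List (Fm D P n)} {φ ψ : Fm D P n} (h : ITDer Γ (.and φ ψ)) : ITDer Γ ψ
  | orI₁ {n : ℕ} {Γ : List (Fm D P n)} {φ ψ : Fm D P n} (h : ITDer Γ φ) : ITDer Γ (.or φ ψ)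
  | orI₂ {n : ℕ} {Γ : List (Fm D P n)} {φ ψ : Fm D P n} (h : ITDer Γ ψ) : ITDer Γ (.or φ ψ)
  | orE {n : ℕ} {Γ : List (Fm D P n)} {φ ψ χ : Fm D P n} (h : ITDer Γ (.or φ ψ))
      (h₁ : ITDer (φ :: Γ) χ) (h₂ : ITDer (ψ :: Γ) χ) : ITDer Γ χ
  | allI {n : ℕ} {Γ : List (Fm D P n)} {φ : Fm D P (n + 1)} (h : ITDer (Γ.map Fm.up) φ) :
      ITDer Γ (.all φ)
  | allE {n : ℕ} {Γ : List (Fm D P n)} {φ : Fm D P (n + 1)} (h : ITDer Γ (.all φ))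
      (t : Tm C P n) : ITDer Γ (φ.inst t)
  | exI {n : ℕ} {Γ : List (Fm D P n)} {φ : Fm D P (n + 1)} (t : Tm C P n)
      (h : ITDer Γ (φ.inst t)) : ITDer Γ (.ex φ)
  | exE {n : ℕ} {Γ : List (Fm D P n)} {φ : Fm D P (n + 1)} {χ : Fm D P n}
      (h : ITDer Γ (.ex φ)) (h₁ : ITDer (φ :: Γ.map Fm.up) χ.up) : ITDer Γ χ
  | eqRefl {n : ℕ} {Γ : List (Fm D P n)} (t : Tm C P n) : ITDer Γ (.eq t t)
  | eqSubst {n : ℕ} {Γ : List (Fm D P n)} {t u : Tm C P n} (φ : Fm D P (n + 1))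
      (h : ITDer Γ (.eq t u)) (h₁ : ITDer Γ (φ.inst t)) : ITDer Γ (φ.inst u)

/-- `φ` is provable in the intrinsic theory of `D`. -/
def ITProvable {n : ℕ} (φ : Fm D P n) : Prop := ITDer D [] φ

end Theory

/-! ## Primitive recursive functionals -/

/-- Identifiers for the primitive recursive functionals with `r` function arguments
`f₀, …, f_{r-1}` (`f_j` of arity `s j`) and with `k` number arguments. For `r = 0` these are the
identifiers of the primitive recursive functions. -/
inductive PR {r : ℕ} (s : Fin r → ℕ) : ℕ → Type
  | zero : PR s 0
  | succ : PR s 1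
  | proj {k : ℕ} (i : Fin k) : PR s k
  | fn (j : Fin r) : PR s (s j)
  | comp {m k : ℕ} (g : PR s m) (h : Fin m → PR s k) : PR s k
  | prec {k : ℕ} (g : PR s k) (h : PR s (k + 2)) : PR s (k + 1)

namespace PR

variable {r : ℕ} {s : Fin r → ℕ}

/-- The constant function `n`. -/
def const {k : ℕ} : ℕ → PR s k
  | 0 => comp zero (fun j => j.elim0)
  | n + 1 => comp succ ![const n]

/-- `x - 1` (truncated). -/
def pred : PR s 1 := prec zero (proj 0)

/-- `x + y`. -/
def add : PR s 2 := prec (proj 0) (comp succ ![proj 1])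

/-- `y - x` (truncated) at `(x, y)`. -/
def rsub : PR s 2 := prec (proj 0) (comp pred ![proj 1])

/-- `x - y` (truncated). -/
def sub : PR s 2 := comp rsub ![proj 1, proj 0]

/-- `u` if `z = 0`, and `v` otherwise, at `(z, u, v)`. -/
def cond : PR s 3 := prec (proj 0) (proj 3)

/-- `0 + 1 + ⋯ + n`. -/
def tri : PR s 1 := prec zero (comp add ![proj 1, comp succ ![proj 0]])

/-- The largest `w` with `tri w ≤ n`. -/
def root : PR s 1 :=
  prec zero (comp cond ![comp sub ![comp tri ![comp succ ![proj 1]], comp succ ![proj 0]],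
    comp succ ![proj 1], proj 1])

/-- Cantor pairing `tri (x + y) + y`. -/
def pair : PR s 2 := comp add ![comp tri ![add], proj 1]

/-- The second component of a pair. -/
def rgt : PR s 1 := comp sub ![proj 0, comp tri ![root]]

/-- The first component of a pair. -/
def lft : PR s 1 := comp sub ![root, rgt]

/-! Every number codes exactly one finite sequence of numbers: `0` codes the empty sequence, and
`pair i a + 1` codes `⟨i⟩ * a`. -/

/-- `⟨i⟩ * a`. -/
def cons : PR s 2 := comp succ ![pair]

/-- The first entry of a sequence (`0` for the empty one). -/
def hd : PR s 1 := comp lft ![pred]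

/-- The sequence without its first entry. -/
def tl : PR s 1 := comp rgt ![pred]

/-- The sequence `a` without its first `n` entries, at `(n, a)`. -/
def drop : PR s 2 := prec (proj 0) (comp tl ![proj 1])

/-- The entry number `n` of the sequence `a`, at `(a, n)` (`0` if there is none). -/
def look : PR s 2 := comp hd ![comp drop ![proj 1, proj 0]]

/-- The number of `n < x` such that `a` has an entry number `n`, at `(x, a)`. -/
def lenAux : PR s 2 :=
  prec (const 0) (comp cond ![comp drop ![proj 0, proj 2], proj 1, comp succ ![proj 1]])

/-- The length of a sequence. -/
def len : PR s 1 := comp lenAux ![proj 0, proj 0]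

/-- The last `m` entries of `a`, followed by `b`, at `(m, a, b)`. -/
def appendAux : PR s 3 :=
  prec (proj 1)
    (comp cons ![comp look ![proj 2, comp sub ![comp len ![proj 2], comp succ ![proj 0]]], proj 1])

/-- Concatenation `a * b`. -/
def append : PR s 2 := comp appendAux ![comp len ![proj 0], proj 0, proj 1]

/-- The sequence with `n` entries, all equal to `c`. Its code is the largest code of a sequence with
at most `n` entries, all at most `c`. -/
def rep (c : ℕ) : PR s 1 := prec zero (comp cons ![const c, proj 1])

/-- The entry of the list `l` at the position given by `x` (`0` if there is none). -/
def select {k : ℕ} (x : PR s k) : List (PR s k) → PR s k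
  | [] => const 0
  | g :: l => comp cond ![x, g, select (comp pred ![x]) l]

/-- The functional `ĉ` of an `r`-ary constructor with code `c`:
`ĉ(f₀, …, f_{r-1})(⟨⟩) = c` and `ĉ(f₀, …, f_{r-1})(⟨i⟩ * a) = f_i(a)`. -/
def graft (r c : ℕ) : PR (fun _ : Fin r => 1) 1 :=
  prec (const c)
    (select (comp lft ![proj 0]) (List.ofFn fun j : Fin r => comp (fn j) ![comp rgt ![proj 0]]))

end PR

/-! ## The theory PRA*

The sorts are numbers and functions of each arity. Variables are de Bruijn indices, with
separate indices for the number variables and for the function variables of each arity `k`.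
Functional variables are never bound; they are named by numbers, for each type. -/

/-- Function terms, by arity: function variables, functional variables applied to function terms
(`fnl s k i` is the functional variable number `i` from functions of arities `s` to functions of
arity `k`), and primitive recursive functionals applied to function terms. -/
inductive FT : ℕ → Type
  | var (k i : ℕ) : FT k
  | fnl {r : ℕ} (s : Fin r → ℕ) (k i : ℕ) (args : (j : Fin r) → FT (s j)) : FT k
  | prf {r : ℕ} {s : Fin r → ℕ} {k : ℕ} (c : PR s k) (args : (j : Fin r) → FT (s j)) : FT k

/-- Number terms. -/
inductive NT : Type
  | var (i : ℕ) : NT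
  | zero : NT
  | succ (t : NT) : NT
  | app {k : ℕ} (f : FT k) (v : Fin k → NT) : NT

/-- Formulas, with quantifiers over numbers (`allN`, `exN`) and over `k`-ary functions (`allF k`,
`exF k`), which bind the variable of their sort with index `0`. -/
inductive PF : Type
  | bot : PF
  | eq (t u : NT) : PF
  | imp (φ ψ : PF) : PF
  | and (φ ψ : PF) : PF
  | or (φ ψ : PF) : PF
  | allN (φ : PF) : PF
  | exN (φ : PF) : PF
  | allF (k : ℕ) (φ : PF) : PF
  | exF (k : ℕ) (φ : PF) : PF

def FT.subst (τ : (k : ℕ) → ℕ → FT k) : {k : ℕ} → FT k → FT k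
  | _, .var k i => τ k i
  | _, .fnl s k i args => .fnl s k i (fun j => (args j).subst τ)
  | _, .prf c args => .prf c (fun j => (args j).subst τ)

/-- Weakening by a new `k`-ary function variable with index `0`. -/
def FT.up (k : ℕ) {m : ℕ} (f : FT m) : FT m :=
  f.subst (fun l i => .var l (if l = k then i + 1 else i))

def NT.subst (σ : ℕ → NT) (τ : (k : ℕ) → ℕ → FT k) : NT → NT
  | .var i => σ i
  | .zero => .zero
  | .succ t => .succ (t.subst σ τ)
  | .app f v => .app (f.subst τ) (fun j => (v j).subst σ τ)

/-- Weakening by a new number variable with index `0`. -/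
def NT.up (t : NT) : NT := t.subst (fun i => .var (i + 1)) FT.var

/-- Weakening by a new `k`-ary function variable with index `0`. -/
def NT.upF (k : ℕ) (t : NT) : NT :=
  t.subst NT.var (fun l i => .var l (if l = k then i + 1 else i))

/-- The number substitution `σ` under a number quantifier. -/
def liftN (σ : ℕ → NT) : ℕ → NT
  | 0 => .var 0
  | i + 1 => (σ i).up

/-- The function substitution `τ` under a quantifier over `k`-ary functions. -/
def liftF (k : ℕ) (τ : (l : ℕ) → ℕ → FT l) (l : ℕ) (i : ℕ) : FT l :=
  if l = k then
    match i with
    | 0 => .var l 0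
    | i + 1 => (τ l i).up k
  else (τ l i).up k

namespace PF

/-- Capture-avoiding simultaneous substitution. -/
def subst (σ : ℕ → NT) (τ : (k : ℕ) → ℕ → FT k) : PF → PF
  | .bot => .bot
  | .eq t u => .eq (t.subst σ τ) (u.subst σ τ)
  | .imp φ ψ => .imp (φ.subst σ τ) (ψ.subst σ τ)
  | .and φ ψ => .and (φ.subst σ τ) (ψ.subst σ τ)
  | .or φ ψ => .or (φ.subst σ τ) (ψ.subst σ τ)
  | .allN φ => .allN (φ.subst (liftN σ) τ)
  | .exN φ => .exN (φ.subst (liftN σ) τ)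
  | .allF k φ => .allF k (φ.subst (fun i => (σ i).upF k) (liftF k τ))
  | .exF k φ => .exF k (φ.subst (fun i => (σ i).upF k) (liftF k τ))

/-- Weakening by a new number variable with index `0`. -/
def upN (φ : PF) : PF := φ.subst (fun i => .var (i + 1)) FT.var

/-- Weakening by a new `k`-ary function variable with index `0`. -/
def upF (k : ℕ) (φ : PF) : PF :=
  φ.subst NT.var (fun l i => .var l (if l = k then i + 1 else i))

/-- The number term `t` for the number variable with index `0`. -/
def instN (φ : PF) (t : NT) : PF :=
  φ.subst (fun i => match i with | 0 => t | i + 1 => .var i) FT.var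

/-- The function term `f` for the `k`-ary function variable with index `0`. -/
def instF {k : ℕ} (φ : PF) (f : FT k) : PF :=
  φ.subst NT.var (fun l i =>
    if h : l = k then
      match i with
      | 0 => h ▸ f
      | i + 1 => .var l i
    else .var l i)

/-- Finite conjunction; the empty one is `⊥ → ⊥`. -/
def conj (l : List PF) : PF := l.foldr .and (.imp .bot .bot)

/-- Finite disjunction; the empty one is `⊥`. -/
def disj (l : List PF) : PF := l.foldr .or .bot

/-- `φ₁ → (φ₂ → ⋯ → (φ_l → ψ))`; for the empty list this is `ψ`. -/
def imps (l : List PF) (ψ : PF) : PF := l.foldr .imp ψ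

/-- Quantification over the number variables with indices `0, …, k - 1`. -/
def allNs : ℕ → PF → PF
  | 0, φ => φ
  | k + 1, φ => allNs k (.allN φ)

/-- Quantification over the unary function variables with indices `0, …, k - 1`. -/
def allFs : ℕ → PF → PF
  | 0, φ => φ
  | k + 1, φ => allFs k (.allF 1 φ)

/-- Equality of two functions, which is extensional: `∀ x, f(x) = g(x)`. -/
def funEq {k : ℕ} (f g : FT k) : PF :=
  allNs k (.eq (.app f (fun j => .var j)) (.app g (fun j => .var j)))

end PF

/-- The axioms of PRA* (open instances): separation and induction (for all formulas of the
language), the defining equations of the primitive recursive functionals, the equality axiom of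
functional variables, and the principle of explicit definition. -/
inductive PRAxiom : PF → Prop
  | succ_inj (t u : NT) : PRAxiom (.imp (.eq (.succ t) (.succ u)) (.eq t u))
  | succ_ne_zero (t : NT) : PRAxiom (.imp (.eq (.succ t) .zero) .bot)
  | induction (φ : PF) :
      PRAxiom (.imp (φ.instN .zero) (.imp
        (.allN (.imp φ
          (φ.subst (fun i => match i with | 0 => .succ (.var 0) | i + 1 => .var (i + 1)) FT.var)))
        (.allN φ)))
  | pr_zero {r : ℕ} {s : Fin r → ℕ} (f : (j : Fin r) → FT (s j)) (v : Fin 0 → NT) :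
      PRAxiom (.eq (.app (.prf .zero f) v) .zero)
  | pr_succ {r : ℕ} {s : Fin r → ℕ} (f : (j : Fin r) → FT (s j)) (v : Fin 1 → NT) :
      PRAxiom (.eq (.app (.prf .succ f) v) (.succ (v 0)))
  | pr_proj {r : ℕ} {s : Fin r → ℕ} (f : (j : Fin r) → FT (s j)) {k : ℕ} (i : Fin k)
      (v : Fin k → NT) : PRAxiom (.eq (.app (.prf (.proj i) f) v) (v i))
  | pr_fn {r : ℕ} {s : Fin r → ℕ} (f : (j : Fin r) → FT (s j)) (j : Fin r)
      (v : Fin (s j) → NT) : PRAxiom (.eq (.app (.prf (.fn j) f) v) (.app (f j) v))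
  | pr_comp {r : ℕ} {s : Fin r → ℕ} (f : (j : Fin r) → FT (s j)) {m k : ℕ} (g : PR s m)
      (h : Fin m → PR s k) (v : Fin k → NT) :
      PRAxiom (.eq (.app (.prf (.comp g h) f) v)
        (.app (.prf g f) (fun i => .app (.prf (h i) f) v)))
  | pr_prec_zero {r : ℕ} {s : Fin r → ℕ} (f : (j : Fin r) → FT (s j)) {k : ℕ} (g : PR s k)
      (h : PR s (k + 2)) (v : Fin k → NT) :
      PRAxiom (.eq (.app (.prf (.prec g h) f) (Matrix.vecCons .zero v)) (.app (.prf g f) v))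
  | pr_prec_succ {r : ℕ} {s : Fin r → ℕ} (f : (j : Fin r) → FT (s j)) {k : ℕ} (g : PR s k)
      (h : PR s (k + 2)) (t : NT) (v : Fin k → NT) :
      PRAxiom (.eq (.app (.prf (.prec g h) f) (Matrix.vecCons (.succ t) v))
        (.app (.prf h f) (Matrix.vecCons t
          (Matrix.vecCons (.app (.prf (.prec g h) f) (Matrix.vecCons t v)) v))))
  | fnl_eq {r : ℕ} (s : Fin r → ℕ) (k i : ℕ) (f g : (j : Fin r) → FT (s j)) (v : Fin k → NT) :
      PRAxiom (.imp (PF.conj (List.ofFn fun j => PF.funEq (f j) (g j)))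
        (.eq (.app (.fnl s k i f) v) (.app (.fnl s k i g) v)))
  | explicit (k : ℕ) (t : NT) :
      PRAxiom (.exF k (PF.allNs k (.eq (.app (.var k 0) (fun j => .var j)) (t.upF k))))

/-- Derivability in PRA*: natural deduction for classical logic, with quantifiers over numbers and
over functions, from the axioms of PRA*. -/
inductive PRADer : List PF → PF → Prop
  | ax {Γ : List PF} {φ : PF} (h : PRAxiom φ) : PRADer Γ φ
  | hyp {Γ : List PF} {φ : PF} (h : φ ∈ Γ) : PRADer Γ φ
  | raa {Γ : List PF} {φ : PF} (h : PRADer (.imp φ .bot :: Γ) .bot) : PRADer Γ φ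
  | impI {Γ : List PF} {φ ψ : PF} (h : PRADer (φ :: Γ) ψ) : PRADer Γ (.imp φ ψ)
  | impE {Γ : List PF} {φ ψ : PF} (h₁ : PRADer Γ (.imp φ ψ)) (h₂ : PRADer Γ φ) : PRADer Γ ψ
  | andI {Γ : List PF} {φ ψ : PF} (h₁ : PRADer Γ φ) (h₂ : PRADer Γ ψ) : PRADer Γ (.and φ ψ)
  | andE₁ {Γ : List PF} {φ ψ : PF} (h : PRADer Γ (.and φ ψ)) : PRADer Γ φ
  | andE₂ {Γ : List PF} {φ ψ : PF} (h : PRADer Γ (.and φ ψ)) : PRADer Γ ψ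
  | orI₁ {Γ : List PF} {φ ψ : PF} (h : PRADer Γ φ) : PRADer Γ (.or φ ψ)
  | orI₂ {Γ : List PF} {φ ψ : PF} (h : PRADer Γ ψ) : PRADer Γ (.or φ ψ)
  | orE {Γ : List PF} {φ ψ χ : PF} (h : PRADer Γ (.or φ ψ)) (h₁ : PRADer (φ :: Γ) χ)
      (h₂ : PRADer (ψ :: Γ) χ) : PRADer Γ χ
  | allNI {Γ : List PF} {φ : PF} (h : PRADer (Γ.map PF.upN) φ) : PRADer Γ (.allN φ)
  | allNE {Γ : List PF} {φ : PF} (h : PRADer Γ (.allN φ)) (t : NT) : PRADer Γ (φ.instN t)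
  | exNI {Γ : List PF} {φ : PF} (t : NT) (h : PRADer Γ (φ.instN t)) : PRADer Γ (.exN φ)
  | exNE {Γ : List PF} {φ χ : PF} (h : PRADer Γ (.exN φ))
      (h₁ : PRADer (φ :: Γ.map PF.upN) χ.upN) : PRADer Γ χ
  | allFI {Γ : List PF} {k : ℕ} {φ : PF} (h : PRADer (Γ.map (PF.upF k)) φ) :
      PRADer Γ (.allF k φ)
  | allFE {Γ : List PF} {k : ℕ} {φ : PF} (h : PRADer Γ (.allF k φ)) (f : FT k) :
      PRADer Γ (φ.instF f)
  | exFI {Γ : List PF} {k : ℕ} {φ : PF} (f : FT k) (h : PRADer Γ (φ.instF f)) :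
      PRADer Γ (.exF k φ)
  | exFE {Γ : List PF} {k : ℕ} {φ χ : PF} (h : PRADer Γ (.exF k φ))
      (h₁ : PRADer (φ :: Γ.map (PF.upF k)) (χ.upF k)) : PRADer Γ χ
  | eqRefl {Γ : List PF} (t : NT) : PRADer Γ (.eq t t)
  | eqSubst {Γ : List PF} {t u : NT} (φ : PF) (h : PRADer Γ (.eq t u))
      (h₁ : PRADer Γ (φ.instN t)) : PRADer Γ (φ.instN u)

/-- `φ` is provable in PRA*. -/
def PRAProvable (φ : PF) : Prop := PRADer [] φ

/-! ## Representation of hyper-terms -/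

namespace NT

/-- Application of a primitive recursive function. -/
def pr {k : ℕ} (c : PR (Fin.elim0 : Fin 0 → ℕ) k) (v : Fin k → NT) : NT :=
  .app (.prf c (fun j => j.elim0)) v

/-- Numerals. -/
def num : ℕ → NT
  | 0 => .zero
  | n + 1 => .succ (num n)

/-- `⟨t⟩ * a`. -/
def consT (t a : NT) : NT := pr PR.cons ![t, a]

/-- `a * b`. -/
def appendT (a b : NT) : NT := pr PR.append ![a, b]

/-- `a * ⟨k⟩`. -/
def childT (a : NT) (k : ℕ) : NT := appendT a (consT (num k) .zero)

/-- The entry number `e` of the sequence `d`. -/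
def lookT (d e : NT) : NT := pr PR.look ![d, e]

/-- The length of the sequence `a`. -/
def lenT (a : NT) : NT := pr PR.len ![a]

end NT

/-- `t < u`, as an equation between primitive recursive terms. -/
def PF.lt (t u : NT) : PF := .eq (NT.pr PR.sub ![.succ t, u]) .zero

/-- The value `x(a)` of a unary function. -/
def FT.at (x : FT 1) (a : NT) : NT := .app x ![a]

section Representation

variable (C : ConVoc)

/-- The maximal arity of a constructor. -/
def ConVoc.maxArity (C : ConVoc) : ℕ := Finset.univ.sup C.arity

/-- `a` is an address of the hyper-term represented by `x`: whenever `a = b * ⟨i⟩ * e`, the value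
`x(b)` is the code of a constructor of arity greater than `i`. (The code of the constructor `c` is
its number.) -/
def addrForm (x : FT 1) (a : NT) : PF :=
  .allN (.allN (.allN (.imp
    (.eq a.up.up.up (NT.appendT (.var 2) (NT.consT (.var 1) (.var 0))))
    (PF.disj (List.ofFn fun c : Fin C.num => PF.disj (List.ofFn fun k : Fin (C.arity c) =>
      .and (.eq (x.at (.var 2)) (NT.num c)) (.eq (.var 1) (NT.num k))))))))

/-- `Htm[x]`: the function `x` represents a hyper-term, that is, its value at every address is the
code of a constructor. Nothing is said of its other values. -/
def htm (x : FT 1) : PF :=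
  .allN (.imp (addrForm C x (.var 0))
    (PF.disj (List.ofFn fun c : Fin C.num => .eq (x.at (.var 0)) (NT.num c))))

/-- Equality of the hyper-terms represented by `x` and `y`: the two functions agree on all
addresses. -/
def sameForm (x y : FT 1) : PF :=
  .allN (.imp (addrForm C x (.var 0)) (.eq (x.at (.var 0)) (y.at (.var 0))))

/-- The term `ĉ(f₀, …, f_{r-1})` for a constructor `c`. -/
def conT (c : Fin C.num) (f : Fin (C.arity c) → FT 1) : FT 1 :=
  .prf (PR.graft (C.arity c) c) f

/-- The functional variable of the program-function number `i`, of arity `r`, applied to `f`. -/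
def progT (r i : ℕ) (f : Fin r → FT 1) : FT 1 :=
  .fnl (fun _ => 1) 1 i f

/-- The functional variable of the program-function number `i`, of arity `r`, represents a function
over hyper-terms: it maps representations of hyper-terms to representations of hyper-terms, and
its value represents a hyper-term that depends only on the hyper-terms represented by its
arguments. -/
def progForm (r i : ℕ) : PF :=
  PF.allFs (r + r) (.imp
    (PF.conj (List.ofFn fun j : Fin r =>
      .and (htm C (.var 1 j)) (.and (htm C (.var 1 (r + j)))
        (sameForm C (.var 1 j) (.var 1 (r + j))))))
    (.and (htm C (progT r i fun j => .var 1 j))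
      (sameForm C (progT r i fun j => .var 1 j) (progT r i fun j => .var 1 (r + j)))))

end Representation

/-! ## Representation of types -/

section Types

variable {C : ConVoc} (D : DataSystem C)

/-- A finite sequence `d` of numbers decorates addresses with types of the bundle `b`: the address
`e` has the type number `i` if the entry number `e` of `d` is `i + 1`. The formula says that the
decoration `d`, placed at the address `a` of `x`, is correct at `e`: if `e` has the type `i` then,
for some rule `c, Q` of `i`, the constructor of `x` at `a * e` is `c`, and for each `k` the address
`e * ⟨k⟩` is decorated with `Q_k` if `Q_k` belongs to the bundle, and otherwise the sub-term of `x`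
at the address `a * e * ⟨k⟩` has the type `Q_k`, as expressed by `low`. -/
def localForm (b : Fin D.bundles)
    (low : (b' : Fin D.bundles) → b' < b → Fin (D.size b') → NT → PF)
    (x : FT 1) (a d e : NT) : PF :=
  PF.conj (List.ofFn fun i : Fin (D.size b) =>
    .imp (.eq (NT.lookT d e) (NT.num (i + 1)))
      (PF.disj ((D.rules b i).map fun R =>
        .and (.eq (x.at (NT.appendT a e)) (NT.num R.con))
          (PF.conj (List.ofFn fun k : Fin (C.arity R.con) =>
            match R.arg k with
            | .own j => .eq (NT.lookT d (NT.childT e k)) (NT.num (j + 1))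
            | .lower b' h j => low b' h j (NT.appendT a (NT.childT e k)))))))

/-- The arithmetical formula stating that the sub-hyper-term of `x` at the address `a` has the type
number `i` of the bundle `b`.

For an inductive type: there is a finite type derivation, i.e. a finite decoration `d` that
gives the type `i` to the root and is correct everywhere.

For a coinductive type: for each `h` there is a finite decoration `d` that gives the type `i` to the
root and is correct at all addresses of length less than `h`. Here `d` is bounded by a primitive
recursive function of `h`: it is enough to decorate the addresses of length at most `h` with
entries at most `C.maxArity`, i.e. addresses with codes less than `rep C.maxArity h + 1`, by numbers
that are at most `D.size b`. -/
def typeForm (b : Fin D.bundles) (i : Fin (D.size b)) (x : FT 1) (a : NT) : PF :=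
  match D.kind b with
  | .ind =>
      .exN (.and (.eq (NT.lookT (.var 0) .zero) (NT.num (i + 1)))
        (.allN (.imp (PF.lt (.var 0) (.var 1))
          (localForm D b (fun b' _ j a' => typeForm b' j x a') x a.up.up (.var 1) (.var 0)))))
  | .coind =>
      .allN (.exN (.and
        (PF.lt (.var 0)
          (.succ (NT.pr (PR.rep (D.size b)) ![.succ (NT.pr (PR.rep C.maxArity) ![.var 1])])))
        (.and (.eq (NT.lookT (.var 0) .zero) (NT.num (i + 1)))
          (.allN (.imp (PF.lt (.var 0) (.var 1)) (.imp (PF.lt (NT.lenT (.var 0)) (.var 2))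
            (localForm D b (fun b' _ j a' => typeForm b' j x a') x a.up.up.up
              (.var 1) (.var 0))))))))
termination_by b

end Types

/-! ## The interpretation -/

section Interpretation

variable {C : ConVoc} {D : DataSystem C} {P : List ℕ}

/-- `t^♮`: an object variable becomes a unary function variable, a constructor `c` the functional
`ĉ`, and a program-function a functional variable. -/
def Tm.interp {n : ℕ} : Tm C P n → FT 1
  | .var i => .var 1 i
  | .con c ts => conT C c (fun k => (ts k).interp)
  | .prog f ts => progT (P.get f) f (fun k => (ts k).interp)

/-- `φ^♮`. -/
def Fm.interp {n : ℕ} : Fm D P n → PF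
  | .bot => .bot
  | .eq t u => sameForm C t.interp u.interp
  | .ty b i t => typeForm D b i t.interp .zero
  | .imp φ ψ => .imp φ.interp ψ.interp
  | .and φ ψ => .and φ.interp ψ.interp
  | .or φ ψ => .or φ.interp ψ.interp
  | .all φ => .allF 1 (.imp (htm C (.var 1 0)) φ.interp)
  | .ex φ => .exF 1 (.and (htm C (.var 1 0)) φ.interp)

end Interpretation

/-- The list `Htm[x₀], …, Htm[x_{n-1}]`, for the first `n` unary function variables. -/
def htms (C : ConVoc) (n : ℕ) : List PF :=
  List.ofFn fun i : Fin n => htm C (.var 1 i)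

/-- For each program-function, the formula stating that its functional variable represents a function
over hyper-terms. -/
def progForms (C : ConVoc) (P : List ℕ) : List PF :=
  List.ofFn fun f : Fin P.length => progForm C (P.get f) f

end IntrinsicTheory

namespace IntrinsicTheory

/-! ## Substitution in PRA* -/

/-! No derivations in PRA* are written out. By completeness (`provable_of_sat`, a Henkin
construction) it is enough to verify every formula in question in each term model `M` of PRA*.
Inside `M` one argues as in ordinary mathematics, with one proviso: `M` may be nonstandard, so
induction is available only for predicates definable with parameters, and functions are obtained
only from defining terms. The classes `DefN`, `DefF` and `Def` keep track of definability, and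
instance search then justifies the uses of `induct` and `exists_fun`.

Elementary arithmetic, pairing and finite sequences are developed in `M` by internal induction. A
hyper-term is a unary function of `M`, looked at only on its addresses; `Same` interprets equality.
Separation holds modulo `Same` because the functional of a constructor shows the code of the
constructor at the root and its arguments below.

For types, `typedAt_iff` removes the coding: decorations matter only at addresses, and the bounds on
them cost nothing. The rules and schemas then become four facts about trees. Construction: finite
decorations of the immediate sub-terms combine into one of the whole term (`exists_combined`).
Induction: a decoration `d` gives types only to places with code less than `d`, and codes increase
from an address to its children, so the claim is proved by induction from the large codes back to
the root (`typed_induction`). Deconstruction: if each of the finitely many rules failed at some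
depth, a decoration correct beyond all these depths would contradict the failure of the rule it uses
at the root (`typed_deconstruction`). Coinduction: by internal induction on the depth, every
hyper-term satisfying the given predicate has a decoration correct to that depth, again by combining
(`typed_coinduction`).

Finally `Sem` is the Tarskian semantics over the hyper-terms of `M`, with `Same` for equality; it is
the truth of the translation (`sat_interp`). Terms denote hyper-terms and respect `Same`, which for
program-functions is exactly the assumption `Rep`. Hence classical logic with equality and all
axioms are sound (`sem_of_der`). -/

theorem FT.subst_subst (τ τ' : (k : ℕ) → ℕ → FT k) {k : ℕ} (f : FT k) :
    (f.subst τ).subst τ' = f.subst (fun l i => (τ l i).subst τ') := by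
  induction f with
  | var k i => rfl
  | fnl s k i args ih => simp only [FT.subst, ih]
  | prf c args ih => simp only [FT.subst, ih]

theorem FT.subst_var {k : ℕ} (f : FT k) : f.subst FT.var = f := by
  induction f with
  | var k i => rfl
  | fnl s k i args ih => simp only [FT.subst, ih]
  | prf c args ih => simp only [FT.subst, ih]

theorem NT.subst_subst (σ σ' : ℕ → NT) (τ τ' : (k : ℕ) → ℕ → FT k) (t : NT) :
    (t.subst σ τ).subst σ' τ' =
      t.subst (fun i => (σ i).subst σ' τ') (fun l i => (τ l i).subst τ') := by
  induction t with
  | var i => rfl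
  | zero => rfl
  | succ t ih => simp only [NT.subst, ih]
  | app f v ih => simp only [NT.subst, ih, FT.subst_subst]

theorem NT.subst_var (t : NT) : t.subst NT.var FT.var = t := by
  induction t with
  | var i => rfl
  | zero => rfl
  | succ t ih => simp only [NT.subst, ih]
  | app f v ih => simp only [NT.subst, ih, FT.subst_var]

theorem liftN_subst (σ σ' : ℕ → NT) (τ' : (k : ℕ) → ℕ → FT k) :
    (fun i => (liftN σ i).subst (liftN σ') τ') = liftN (fun i => (σ i).subst σ' τ') := by
  funext i
  cases i with
  | zero => rfl
  | succ i => simp only [liftN, NT.up, NT.subst_subst, NT.subst, FT.subst_var, FT.subst]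

theorem liftF_subst (k : ℕ) (τ τ' : (k : ℕ) → ℕ → FT k) :
    (fun l i => (liftF k τ l i).subst (liftF k τ')) =
      liftF k (fun l i => (τ l i).subst τ') := by
  have key : ∀ l (f : FT l), (f.up k).subst (liftF k τ') = (f.subst τ').up k := by
    intro l f
    simp only [FT.up, FT.subst_subst, FT.subst]
    congr 1
    funext l i
    by_cases h : l = k
    · simp only [h, liftF, if_true, FT.up]
    · simp only [h, liftF, if_false, FT.up]
  funext l i
  by_cases h : l = k
  · cases i with
    | zero => simp only [liftF, h, if_true, FT.subst]
    | succ i =>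
      have e : liftF k τ l (i + 1) = (τ l i).up k := by simp only [liftF, h, if_true]
      rw [e, key]
      simp only [liftF, h, if_true]
  · have e : liftF k τ l i = (τ l i).up k := by simp only [liftF, h, if_false]
    rw [e, key]
    simp only [liftF, h, if_false]

theorem upF_subst (k : ℕ) (σ : ℕ → NT) (τ : (k : ℕ) → ℕ → FT k) (t : NT) :
    (t.upF k).subst (fun i => (σ i).upF k) (liftF k τ) = (t.subst σ τ).upF k := by
  simp only [NT.upF, NT.subst_subst, NT.subst, FT.subst]
  congr 1
  funext l i
  by_cases h : l = k
  · simp only [h, liftF, if_true, FT.up]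
  · simp only [h, liftF, if_false, FT.up]

theorem PF.subst_subst (φ : PF) : ∀ (σ σ' : ℕ → NT) (τ τ' : (k : ℕ) → ℕ → FT k),
    (φ.subst σ τ).subst σ' τ' =
      φ.subst (fun i => (σ i).subst σ' τ') (fun l i => (τ l i).subst τ') := by
  have hN : ∀ (τ : (k : ℕ) → ℕ → FT k), (fun l i => (τ l i).subst FT.var) = τ := by
    intro τ; funext l i; exact FT.subst_var _
  induction φ with
  | bot => intros; rfl
  | eq t u => intros; simp only [PF.subst, NT.subst_subst]
  | imp φ ψ ih ih' => intros; simp only [PF.subst, ih, ih']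
  | and φ ψ ih ih' => intros; simp only [PF.subst, ih, ih']
  | or φ ψ ih ih' => intros; simp only [PF.subst, ih, ih']
  | allN φ ih => intros; simp only [PF.subst, ih, liftN_subst]
  | exN φ ih => intros; simp only [PF.subst, ih, liftN_subst]
  | allF k φ ih => intros; simp only [PF.subst, ih, liftF_subst, upF_subst]
  | exF k φ ih => intros; simp only [PF.subst, ih, liftF_subst, upF_subst]

theorem liftN_var : liftN NT.var = NT.var := by
  funext i; cases i <;> rfl

theorem liftF_var (k : ℕ) : liftF k FT.var = FT.var := by
  funext l i
  by_cases h : l = k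
  · cases i <;> simp [liftF, h, FT.up, FT.subst]
  · simp [liftF, h, FT.up, FT.subst]

theorem PF.subst_var (φ : PF) : φ.subst NT.var FT.var = φ := by
  induction φ with
  | bot => rfl
  | eq t u => simp only [PF.subst, NT.subst_var]
  | imp φ ψ ih ih' => simp only [PF.subst, ih, ih']
  | and φ ψ ih ih' => simp only [PF.subst, ih, ih']
  | or φ ψ ih ih' => simp only [PF.subst, ih, ih']
  | allN φ ih => simp only [PF.subst, liftN_var, ih]
  | exN φ ih => simp only [PF.subst, liftN_var, ih]
  | allF k φ ih => simp only [PF.subst, liftF_var, NT.upF, NT.subst]; rw [ih]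
  | exF k φ ih => simp only [PF.subst, liftF_var, NT.upF, NT.subst]; rw [ih]

/-- The substitution of `t` for the number variable with index `0`. -/
def consN (t : NT) (σ : ℕ → NT) : ℕ → NT
  | 0 => t
  | i + 1 => σ i

/-- The substitution of `f` for the `k`-ary function variable with index `0`. -/
def consF {k : ℕ} (f : FT k) (τ : (k : ℕ) → ℕ → FT k) (l : ℕ) (i : ℕ) : FT l :=
  if h : l = k then
    match i with
    | 0 => h ▸ f
    | i + 1 => τ l i
  else τ l i

theorem PF.instN_eq (φ : PF) (t : NT) : φ.instN t = φ.subst (consN t NT.var) FT.var := by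
  unfold PF.instN
  congr 1

theorem PF.instF_eq {k : ℕ} (φ : PF) (f : FT k) :
    φ.instF f = φ.subst NT.var (consF f FT.var) := by
  unfold PF.instF
  congr 1

/-- Together with `PF.subst_instN` this commutes a substitution with an instantiation: both sides
become one simultaneous substitution. The pair, and its analogue for functions, carries the
quantifier rules through `PRADer.subst`. -/
theorem PF.instN_subst (φ : PF) (t : NT) (σ : ℕ → NT) (τ : (k : ℕ) → ℕ → FT k) :
    (φ.instN t).subst σ τ = φ.subst (consN (t.subst σ τ) σ) τ := by
  rw [PF.instN_eq, PF.subst_subst]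
  congr 1
  funext i
  cases i <;> rfl

theorem PF.instF_subst {k : ℕ} (φ : PF) (f : FT k) (σ : ℕ → NT) (τ : (k : ℕ) → ℕ → FT k) :
    (φ.instF f).subst σ τ = φ.subst σ (consF (f.subst τ) τ) := by
  rw [PF.instF_eq, PF.subst_subst]
  congr 1
  funext l i
  by_cases h : l = k
  · subst h
    cases i <;> simp [consF, FT.subst]
  · simp [consF, h, FT.subst]

theorem PF.subst_instN (φ : PF) (t : NT) (σ : ℕ → NT) (τ : (k : ℕ) → ℕ → FT k) :
    (φ.subst (liftN σ) τ).instN t = φ.subst (consN t σ) τ := by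
  rw [PF.instN_eq, PF.subst_subst]
  congr 1
  · funext i
    cases i with
    | zero => rfl
    | succ i =>
      simp only [liftN, NT.up, NT.subst_subst, NT.subst, FT.subst, consN]
      exact NT.subst_var _
  · funext l i; exact FT.subst_var _

theorem FT.up_consF {k : ℕ} (f : FT k) (τ : (k : ℕ) → ℕ → FT k) {l : ℕ} (g : FT l) :
    (g.up k).subst (consF f τ) = g.subst τ := by
  rw [FT.up, FT.subst_subst]
  congr 1
  funext l i
  by_cases h : l = k
  · subst h; simp [FT.subst, consF]
  · simp [FT.subst, consF, h]

theorem NT.upF_consF {k : ℕ} (f : FT k) (σ : ℕ → NT) (τ : (k : ℕ) → ℕ → FT k) (t : NT) :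
    (t.upF k).subst σ (consF f τ) = t.subst σ τ := by
  rw [NT.upF, NT.subst_subst]
  congr 1
  funext l i
  exact FT.up_consF f τ (.var l i)

theorem PF.subst_instF {k : ℕ} (φ : PF) (f : FT k) (σ : ℕ → NT) (τ : (k : ℕ) → ℕ → FT k) :
    (φ.subst (fun i => (σ i).upF k) (liftF k τ)).instF f = φ.subst σ (consF f τ) := by
  rw [PF.instF_eq, PF.subst_subst]
  congr 1
  · funext i
    rw [NT.upF_consF, NT.subst_var]
  · funext l i
    by_cases h : l = k
    · subst h
      cases i with
      | zero => simp [liftF, consF, FT.subst]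
      | succ i =>
        simp only [liftF, if_true, FT.up_consF, FT.subst_var]
        simp [consF]
    · simp only [liftF, h, if_false, FT.up_consF, FT.subst_var]
      simp [consF, h]

theorem PF.upN_subst_liftN (φ : PF) (σ : ℕ → NT) (τ : (k : ℕ) → ℕ → FT k) :
    φ.upN.subst (liftN σ) τ = (φ.subst σ τ).upN := by
  simp only [PF.upN, PF.subst_subst, NT.subst, FT.subst]
  congr 1
  funext l i
  exact (FT.subst_var _).symm

theorem PF.upF_subst_liftF (k : ℕ) (φ : PF) (σ : ℕ → NT) (τ : (k : ℕ) → ℕ → FT k) :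
    (φ.upF k).subst (fun i => (σ i).upF k) (liftF k τ) = (φ.subst σ τ).upF k := by
  simp only [PF.upF, PF.subst_subst, NT.subst, FT.subst]
  congr 1
  funext l i
  by_cases h : l = k
  · simp only [h, liftF, if_true, FT.up]
  · simp only [h, liftF, if_false, FT.up]

/-- The substitution `σ` under `k` number quantifiers. -/
def liftNs (σ : ℕ → NT) : ℕ → ℕ → NT
  | 0 => σ
  | k + 1 => liftN (liftNs σ k)

theorem liftNs_lt (σ : ℕ → NT) : ∀ k i, i < k → liftNs σ k i = .var i
  | k + 1, 0, _ => rfl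
  | k + 1, i + 1, h => by
    simp only [liftNs, liftN, liftNs_lt σ k i (by omega), NT.up, NT.subst]

theorem PF.allNs_subst (τ : (k : ℕ) → ℕ → FT k) : ∀ (k : ℕ) (σ : ℕ → NT) (φ : PF),
    (PF.allNs k φ).subst σ τ = PF.allNs k (φ.subst (liftNs σ k) τ)
  | 0, _, _ => rfl
  | k + 1, σ, φ => by
    simp only [PF.allNs]
    rw [PF.allNs_subst τ k σ]
    rfl

theorem PF.conj_subst (l : List PF) (σ : ℕ → NT) (τ : (k : ℕ) → ℕ → FT k) :
    (PF.conj l).subst σ τ = PF.conj (l.map (PF.subst σ τ)) := by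
  induction l with
  | nil => rfl
  | cons φ l ih =>
    simp only [PF.conj, List.foldr, List.map, PF.subst]
    exact congrArg _ ih

theorem PF.funEq_subst {k : ℕ} (f g : FT k) (σ : ℕ → NT) (τ : (k : ℕ) → ℕ → FT k) :
    (PF.funEq f g).subst σ τ = PF.funEq (f.subst τ) (g.subst τ) := by
  simp only [PF.funEq, PF.allNs_subst, PF.subst, NT.subst]
  congr 3 <;> funext j <;> exact liftNs_lt _ _ _ j.2

theorem vecCons_subst {k : ℕ} (t : NT) (v : Fin k → NT) (σ : ℕ → NT)
    (τ : (k : ℕ) → ℕ → FT k) :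
    (fun j => (Matrix.vecCons t v j).subst σ τ) =
      Matrix.vecCons (t.subst σ τ) (fun j => (v j).subst σ τ) := by
  funext j
  refine Fin.cases rfl (fun j => rfl) j

theorem liftNs_upF (m k : ℕ) (σ : ℕ → NT) :
    liftNs (fun i => (σ i).upF m) k = fun i => (liftNs σ k i).upF m := by
  induction k with
  | zero => rfl
  | succ k ih =>
    funext i
    cases i with
    | zero => rfl
    | succ i =>
      rw [liftNs, ih]
      simp only [liftNs, liftN, NT.up, NT.upF, NT.subst_subst, NT.subst, FT.subst]

/-- The axioms are schemas of open instances, so a substitution leads to another instance of the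
same schema. Where variables are bound, the data of the new instance are substituted under the
binders: one number variable in induction, `k` of them in explicit definition. -/
theorem PRAxiom.subst {φ : PF} (h : PRAxiom φ) (σ : ℕ → NT) (τ : (k : ℕ) → ℕ → FT k) :
    PRAxiom (φ.subst σ τ) := by
  cases h with
  | succ_inj t u => exact .succ_inj _ _
  | succ_ne_zero t => exact .succ_ne_zero _
  | induction φ =>
    have := PRAxiom.induction (φ.subst (liftN σ) τ)
    convert this using 1
    simp only [PF.subst]
    congr 1
    · rw [PF.instN_subst, PF.subst_instN]; rfl
    · congr 3
      rw [PF.subst_subst, PF.subst_subst]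
      congr 1
      · funext i
        cases i with
        | zero => rfl
        | succ i => simp [NT.subst, liftN, NT.up, NT.subst_subst, FT.subst]
      · funext l i; simp [FT.subst, FT.subst_var]
  | pr_zero f v =>
    exact PRAxiom.pr_zero (fun j => (f j).subst τ) (fun j => (v j).subst σ τ)
  | pr_succ f v =>
    exact PRAxiom.pr_succ (fun j => (f j).subst τ) (fun j => (v j).subst σ τ)
  | pr_proj f i v =>
    exact PRAxiom.pr_proj (fun j => (f j).subst τ) i (fun j => (v j).subst σ τ)
  | pr_fn f j v =>
    exact PRAxiom.pr_fn (fun j => (f j).subst τ) j (fun j => (v j).subst σ τ)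
  | pr_comp f g h v =>
    exact PRAxiom.pr_comp (fun j => (f j).subst τ) g h (fun j => (v j).subst σ τ)
  | pr_prec_zero f g h v =>
    convert PRAxiom.pr_prec_zero (fun j => (f j).subst τ) g h (fun j => (v j).subst σ τ) using 1
    simp only [PF.subst, NT.subst, FT.subst, vecCons_subst]
  | pr_prec_succ f g h t v =>
    convert PRAxiom.pr_prec_succ (fun j => (f j).subst τ) g h (t.subst σ τ)
      (fun j => (v j).subst σ τ) using 1
    simp only [PF.subst, NT.subst, FT.subst, vecCons_subst]
  | fnl_eq s k i f g v =>
    convert PRAxiom.fnl_eq s k i (fun j => (f j).subst τ) (fun j => (g j).subst τ)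
      (fun j => (v j).subst σ τ) using 1
    simp only [PF.subst, NT.subst, FT.subst, PF.conj_subst, List.map_ofFn, Function.comp_def,
      PF.funEq_subst]
  | explicit k t =>
    convert PRAxiom.explicit k (t.subst (liftNs σ k) τ) using 1
    simp only [PF.subst, PF.allNs_subst, NT.subst, FT.subst, liftNs_upF, upF_subst]
    congr 4
    · simp [liftF]
    · funext j; rw [liftNs_lt _ _ _ j.2]; rfl

/-! ### Weakening and substitution for derivations of PRA*. -/

namespace PRADer

theorem weaken {Γ : List PF} {φ : PF} (h : PRADer Γ φ) :
    ∀ {Δ : List PF}, Γ ⊆ Δ → PRADer Δ φ := by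
  induction h with
  | ax h => intro Δ s; exact .ax h
  | hyp h => intro Δ s; exact .hyp (s h)
  | raa h ih => intro Δ s; exact .raa (ih (List.cons_subset_cons _ s))
  | impI h ih => intro Δ s; exact .impI (ih (List.cons_subset_cons _ s))
  | impE h₁ h₂ ih₁ ih₂ => intro Δ s; exact .impE (ih₁ s) (ih₂ s)
  | andI h₁ h₂ ih₁ ih₂ => intro Δ s; exact .andI (ih₁ s) (ih₂ s)
  | andE₁ h ih => intro Δ s; exact .andE₁ (ih s)
  | andE₂ h ih => intro Δ s; exact .andE₂ (ih s)
  | orI₁ h ih => intro Δ s; exact .orI₁ (ih s)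
  | orI₂ h ih => intro Δ s; exact .orI₂ (ih s)
  | orE h h₁ h₂ ih ih₁ ih₂ =>
    intro Δ s
    exact .orE (ih s) (ih₁ (List.cons_subset_cons _ s)) (ih₂ (List.cons_subset_cons _ s))
  | allNI h ih => intro Δ s; exact .allNI (ih (List.map_subset _ s))
  | allNE h t ih => intro Δ s; exact .allNE (ih s) t
  | exNI t h ih => intro Δ s; exact .exNI t (ih s)
  | exNE h h₁ ih ih₁ =>
    intro Δ s; exact .exNE (ih s) (ih₁ (List.cons_subset_cons _ (List.map_subset _ s)))
  | allFI h ih => intro Δ s; exact .allFI (ih (List.map_subset _ s))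
  | allFE h t ih => intro Δ s; exact .allFE (ih s) t
  | exFI t h ih => intro Δ s; exact .exFI t (ih s)
  | exFE h h₁ ih ih₁ =>
    intro Δ s; exact .exFE (ih s) (ih₁ (List.cons_subset_cons _ (List.map_subset _ s)))
  | eqRefl t => intro Δ s; exact .eqRefl t
  | eqSubst φ h h₁ ih ih₁ => intro Δ s; exact .eqSubst φ (ih s) (ih₁ s)

theorem map_upN_subst (Γ : List PF) (σ : ℕ → NT) (τ : (k : ℕ) → ℕ → FT k) :
    (Γ.map PF.upN).map (PF.subst (liftN σ) τ) = (Γ.map (PF.subst σ τ)).map PF.upN := by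
  simp only [List.map_map, Function.comp_def, PF.upN_subst_liftN]

theorem map_upF_subst (k : ℕ) (Γ : List PF) (σ : ℕ → NT) (τ : (k : ℕ) → ℕ → FT k) :
    (Γ.map (PF.upF k)).map (PF.subst (fun i => (σ i).upF k) (liftF k τ)) =
      (Γ.map (PF.subst σ τ)).map (PF.upF k) := by
  simp only [List.map_map, Function.comp_def, PF.upF_subst_liftF]

/-- Needed to rename a fresh variable into a bound one when witnesses are eliminated. -/
theorem subst {Γ : List PF} {φ : PF} (h : PRADer Γ φ) :
    ∀ (σ : ℕ → NT) (τ : (k : ℕ) → ℕ → FT k),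
      PRADer (Γ.map (PF.subst σ τ)) (φ.subst σ τ) := by
  induction h with
  | ax h => intro σ τ; exact .ax (h.subst σ τ)
  | hyp h => intro σ τ; exact .hyp (List.mem_map_of_mem h)
  | raa h ih => intro σ τ; exact .raa (ih σ τ)
  | impI h ih => intro σ τ; exact .impI (ih σ τ)
  | impE h₁ h₂ ih₁ ih₂ => intro σ τ; exact .impE (ih₁ σ τ) (ih₂ σ τ)
  | andI h₁ h₂ ih₁ ih₂ => intro σ τ; exact .andI (ih₁ σ τ) (ih₂ σ τ)
  | andE₁ h ih => intro σ τ; exact .andE₁ (ih σ τ)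
  | andE₂ h ih => intro σ τ; exact .andE₂ (ih σ τ)
  | orI₁ h ih => intro σ τ; exact .orI₁ (ih σ τ)
  | orI₂ h ih => intro σ τ; exact .orI₂ (ih σ τ)
  | orE h h₁ h₂ ih ih₁ ih₂ => intro σ τ; exact .orE (ih σ τ) (ih₁ σ τ) (ih₂ σ τ)
  | allNI h ih =>
    intro σ τ
    exact .allNI (map_upN_subst _ σ τ ▸ ih (liftN σ) τ)
  | @allNE Γ φ h t ih =>
    intro σ τ
    rw [PF.instN_subst, ← PF.subst_instN]
    exact .allNE (ih σ τ) _
  | exNI t h ih =>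
    intro σ τ
    refine .exNI (t.subst σ τ) ?_
    rw [PF.subst_instN, ← PF.instN_subst]
    exact ih σ τ
  | exNE h h₁ ih ih₁ =>
    intro σ τ
    refine .exNE (ih σ τ) ?_
    have := ih₁ (liftN σ) τ
    rwa [List.map_cons, map_upN_subst, PF.upN_subst_liftN] at this
  | allFI h ih =>
    intro σ τ
    exact .allFI (map_upF_subst _ _ σ τ ▸ ih _ (liftF _ τ))
  | allFE h t ih =>
    intro σ τ
    rw [PF.instF_subst, ← PF.subst_instF]
    exact .allFE (ih σ τ) _
  | exFI t h ih =>
    intro σ τ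
    refine .exFI (t.subst τ) ?_
    rw [PF.subst_instF, ← PF.instF_subst]
    exact ih σ τ
  | @exFE Γ k φ χ h h₁ ih ih₁ =>
    intro σ τ
    refine .exFE (ih σ τ) ?_
    have := ih₁ (fun i => (σ i).upF k) (liftF k τ)
    rwa [List.map_cons, map_upF_subst, PF.upF_subst_liftF] at this
  | eqRefl t => intro σ τ; exact .eqRefl _
  | eqSubst φ h h₁ ih ih₁ =>
    intro σ τ
    have := ih₁ σ τ
    rw [PF.instN_subst, ← PF.subst_instN] at this ⊢
    exact .eqSubst _ (ih σ τ) this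

end PRADer

/-! ## Finite support -/

/-- Finiteness of the set of free variables, expressed by the effect of substitutions: no separate
notion of free variable is required, and freshness can be used directly in comparing substituted
formulas. -/
theorem FT.support {k : ℕ} (f : FT k) : ∃ m : ℕ, ∀ (τ τ' : (k : ℕ) → ℕ → FT k),
    (∀ l, ∀ i < m, τ l i = τ' l i) → f.subst τ = f.subst τ' := by
  induction f with
  | var k i => exact ⟨i + 1, fun τ τ' h => h k i (by omega)⟩
  | fnl s k i args ih =>
    choose m hm using ih
    refine ⟨Finset.univ.sup m, fun τ τ' h => ?_⟩
    simp only [FT.subst]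
    congr 1
    funext j
    exact hm j τ τ' fun l i hi => h l i (lt_of_lt_of_le hi (Finset.le_sup (Finset.mem_univ j)))
  | prf c args ih =>
    choose m hm using ih
    refine ⟨Finset.univ.sup m, fun τ τ' h => ?_⟩
    simp only [FT.subst]
    congr 1
    funext j
    exact hm j τ τ' fun l i hi => h l i (lt_of_lt_of_le hi (Finset.le_sup (Finset.mem_univ j)))

theorem NT.support (t : NT) : ∃ m : ℕ, ∀ (σ σ' : ℕ → NT) (τ τ' : (k : ℕ) → ℕ → FT k),
    (∀ i < m, σ i = σ' i) → (∀ l, ∀ i < m, τ l i = τ' l i) → t.subst σ τ = t.subst σ' τ' := by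
  induction t with
  | var i => exact ⟨i + 1, fun σ σ' τ τ' h _ => h i (by omega)⟩
  | zero => exact ⟨0, fun _ _ _ _ _ _ => rfl⟩
  | succ t ih =>
    obtain ⟨m, hm⟩ := ih
    exact ⟨m, fun σ σ' τ τ' h h' => congrArg _ (hm σ σ' τ τ' h h')⟩
  | app f v ih =>
    choose m hm using ih
    obtain ⟨m', hm'⟩ := f.support
    refine ⟨max m' (Finset.univ.sup m), fun σ σ' τ τ' h h' => ?_⟩
    simp only [NT.subst]
    congr 1
    · exact hm' τ τ' fun l i hi => h' l i (lt_of_lt_of_le hi (le_max_left _ _))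
    · funext j
      have hj : m j ≤ max m' (Finset.univ.sup m) :=
        le_trans (Finset.le_sup (Finset.mem_univ j)) (le_max_right _ _)
      exact hm j σ σ' τ τ' (fun i hi => h i (lt_of_lt_of_le hi hj))
        fun l i hi => h' l i (lt_of_lt_of_le hi hj)

/-- `m` bounds the indices of the free variables of `φ`. -/
def PF.Bounded (m : ℕ) (φ : PF) : Prop :=
  ∀ (σ σ' : ℕ → NT) (τ τ' : (k : ℕ) → ℕ → FT k), (∀ i < m, σ i = σ' i) →
    (∀ l, ∀ i < m, τ l i = τ' l i) → φ.subst σ τ = φ.subst σ' τ'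

theorem PF.Bounded.mono {m m' : ℕ} {φ : PF} (h : φ.Bounded m) (hm : m ≤ m') : φ.Bounded m' :=
  fun σ σ' τ τ' h₁ h₂ => h σ σ' τ τ' (fun i hi => h₁ i (by omega)) fun l i hi => h₂ l i (by omega)

/-- Lifting moves the value at `i` to `i + 1`, so agreement is not lost below `m`; the bound of a
body therefore also serves for the quantified formula. -/
theorem liftN_congr {m : ℕ} {σ σ' : ℕ → NT} (h : ∀ i < m, σ i = σ' i) :
    ∀ i < m, liftN σ i = liftN σ' i
  | 0, _ => rfl
  | i + 1, hi => congrArg NT.up (h i (by omega))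

theorem liftF_congr {m : ℕ} (k : ℕ) {τ τ' : (k : ℕ) → ℕ → FT k}
    (h : ∀ l, ∀ i < m, τ l i = τ' l i) (l : ℕ) : ∀ i < m, liftF k τ l i = liftF k τ' l i
  | 0, hi => by
    by_cases e : l = k
    · simp [liftF, e]
    · simp [liftF, e, h l 0 hi]
  | i + 1, hi => by
    by_cases e : l = k
    · simp [liftF, e, h l i (by omega)]
    · simp [liftF, e, h l (i + 1) hi]

theorem PF.exists_bounded (φ : PF) : ∃ m, φ.Bounded m := by
  induction φ with
  | bot => exact ⟨0, fun _ _ _ _ _ _ => rfl⟩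
  | eq t u =>
    obtain ⟨m, hm⟩ := t.support
    obtain ⟨m', hm'⟩ := u.support
    refine ⟨max m m', fun σ σ' τ τ' h h' => ?_⟩
    simp only [PF.subst]
    congr 1
    · exact hm _ _ _ _ (fun i hi => h i (by omega)) fun l i hi => h' l i (by omega)
    · exact hm' _ _ _ _ (fun i hi => h i (by omega)) fun l i hi => h' l i (by omega)
  | imp φ ψ ih ih' =>
    obtain ⟨m, hm⟩ := ih
    obtain ⟨m', hm'⟩ := ih'
    exact ⟨max m m', fun σ σ' τ τ' h h' => congrArg₂ PF.imp
      (hm.mono (le_max_left _ _) _ _ _ _ h h') (hm'.mono (le_max_right _ _) _ _ _ _ h h')⟩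
  | and φ ψ ih ih' =>
    obtain ⟨m, hm⟩ := ih
    obtain ⟨m', hm'⟩ := ih'
    exact ⟨max m m', fun σ σ' τ τ' h h' => congrArg₂ PF.and
      (hm.mono (le_max_left _ _) _ _ _ _ h h') (hm'.mono (le_max_right _ _) _ _ _ _ h h')⟩
  | or φ ψ ih ih' =>
    obtain ⟨m, hm⟩ := ih
    obtain ⟨m', hm'⟩ := ih'
    exact ⟨max m m', fun σ σ' τ τ' h h' => congrArg₂ PF.or
      (hm.mono (le_max_left _ _) _ _ _ _ h h') (hm'.mono (le_max_right _ _) _ _ _ _ h h')⟩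
  | allN φ ih =>
    obtain ⟨m, hm⟩ := ih
    exact ⟨m, fun σ σ' τ τ' h h' => congrArg PF.allN (hm _ _ _ _ (liftN_congr h) h')⟩
  | exN φ ih =>
    obtain ⟨m, hm⟩ := ih
    exact ⟨m, fun σ σ' τ τ' h h' => congrArg PF.exN (hm _ _ _ _ (liftN_congr h) h')⟩
  | allF k φ ih =>
    obtain ⟨m, hm⟩ := ih
    exact ⟨m, fun σ σ' τ τ' h h' => congrArg (PF.allF k)
      (hm _ _ _ _ (fun i hi => congrArg (NT.upF k) (h i hi)) (liftF_congr k h'))⟩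
  | exF k φ ih =>
    obtain ⟨m, hm⟩ := ih
    exact ⟨m, fun σ σ' τ τ' h h' => congrArg (PF.exF k)
      (hm _ _ _ _ (fun i hi => congrArg (NT.upF k) (h i hi)) (liftF_congr k h'))⟩

theorem PF.exists_bounded_list (Γ : List PF) : ∃ m, ∀ φ ∈ Γ, φ.Bounded m := by
  induction Γ with
  | nil => exact ⟨0, by simp⟩
  | cons φ Γ ih =>
    obtain ⟨m, hm⟩ := ih
    obtain ⟨m', hm'⟩ := φ.exists_bounded
    refine ⟨max m m', fun ψ hψ => ?_⟩
    rcases List.mem_cons.1 hψ with rfl | h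
    · exact hm'.mono (le_max_right _ _)
    · exact (hm ψ h).mono (le_max_left _ _)

end IntrinsicTheory

namespace IntrinsicTheory

/-! ## The language of PRA* is countable -/

/-- A code of a finite sequence of numbers. -/
def codeFin {n : ℕ} (v : Fin n → ℕ) : ℕ := Encodable.encode (List.ofFn v)

theorem codeFin_inj {n : ℕ} {v w : Fin n → ℕ} : codeFin v = codeFin w ↔ v = w := by
  simp [codeFin, Encodable.encode_inj, List.ofFn_inj]

def PR.code {r : ℕ} {s : Fin r → ℕ} : {k : ℕ} → PR s k → ℕ
  | _, .zero => codeFin ![0]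
  | _, .succ => codeFin ![1]
  | _, .proj (k := k) i => codeFin ![2, k, i]
  | _, .fn j => codeFin ![3, j]
  | _, .comp (m := m) (k := k) g h => codeFin ![4, m, k, g.code, codeFin fun j => (h j).code]
  | _, .prec (k := k) g h => codeFin ![5, k, g.code, h.code]

theorem codeFin_inj' {n m : ℕ} {v : Fin n → ℕ} {w : Fin m → ℕ} (h : codeFin v = codeFin w) :
    List.ofFn v = List.ofFn w := by
  simpa [codeFin, Encodable.encode_inj] using h

/-- The arities of the components are themselves part of what the code has to determine. Hence the
comparison is between terms of a priori different arities, with heterogeneous equality in the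
conclusion. -/
theorem PR.code_inj {r : ℕ} {s : Fin r → ℕ} {k : ℕ} (c : PR s k) :
    ∀ {k' : ℕ} (c' : PR s k'), c.code = c'.code → k = k' ∧ HEq c c' := by
  induction c with
  | zero =>
    intro k' c' h; cases c' <;> (have e := codeFin_inj' h; clear h; simp at e)
    exact ⟨rfl, HEq.rfl⟩
  | succ =>
    intro k' c' h; cases c' <;> (have e := codeFin_inj' h; clear h; simp at e)
    exact ⟨rfl, HEq.rfl⟩
  | proj i =>
    intro k' c' h
    cases c' <;> (have e := codeFin_inj' h; clear h; simp at e)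
    obtain ⟨rfl, e⟩ := e
    obtain rfl := Fin.ext e
    exact ⟨rfl, HEq.rfl⟩
  | fn j =>
    intro k' c' h
    cases c' <;> (have e := codeFin_inj' h; clear h; simp at e)
    obtain rfl := Fin.ext e
    exact ⟨rfl, HEq.rfl⟩
  | comp g h ihg ihh =>
    intro k' c' h
    cases c' <;> (have e := codeFin_inj' h; clear h; simp at e)
    obtain ⟨rfl, rfl, eg, eh⟩ := e
    obtain rfl := eq_of_heq (ihg _ eg).2
    obtain rfl := funext fun j => eq_of_heq (ihh j _ (congrFun (codeFin_inj.1 eh) j)).2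
    exact ⟨rfl, HEq.rfl⟩
  | prec g h ihg ihh =>
    intro k' c' h
    cases c' <;> (have e := codeFin_inj' h; clear h; simp at e)
    obtain ⟨rfl, eg, eh⟩ := e
    obtain rfl := eq_of_heq (ihg _ eg).2
    obtain rfl := eq_of_heq (ihh _ eh).2
    exact ⟨rfl, HEq.rfl⟩

def FT.code : {k : ℕ} → FT k → ℕ
  | _, .var k i => codeFin ![0, k, i]
  | _, .fnl (r := r) s k i args => codeFin ![1, r, codeFin s, k, i, codeFin fun j => (args j).code]
  | _, .prf (r := r) (s := s) (k := k) c args =>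
    codeFin ![2, r, codeFin s, k, c.code, codeFin fun j => (args j).code, 0]

theorem FT.code_inj {k : ℕ} (f : FT k) :
    ∀ {k' : ℕ} (f' : FT k'), f.code = f'.code → k = k' ∧ HEq f f' := by
  induction f with
  | var k i =>
    intro k' c' h
    cases c' <;> (have e := codeFin_inj' h; clear h; simp at e)
    obtain ⟨rfl, rfl⟩ := e
    exact ⟨rfl, HEq.rfl⟩
  | fnl s k i args ih =>
    intro k' c' h
    cases c' <;> (have e := codeFin_inj' h; clear h; simp at e)
    obtain ⟨rfl, hs, rfl, rfl, e⟩ := e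
    obtain rfl := codeFin_inj.1 hs
    obtain rfl := funext fun j => eq_of_heq (ih j _ (congrFun (codeFin_inj.1 e) j)).2
    exact ⟨rfl, HEq.rfl⟩
  | prf c args ih =>
    intro k' c' h
    cases c' <;> (have e := codeFin_inj' h; clear h; simp at e)
    obtain ⟨rfl, hs, rfl, hc, e⟩ := e
    obtain rfl := codeFin_inj.1 hs
    obtain rfl := eq_of_heq (c.code_inj _ hc).2
    obtain rfl := funext fun j => eq_of_heq (ih j _ (congrFun (codeFin_inj.1 e) j)).2
    exact ⟨rfl, HEq.rfl⟩

def NT.code : NT → ℕ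
  | .var i => codeFin ![0, i]
  | .zero => codeFin ![1]
  | .succ t => codeFin ![2, t.code, 0]
  | .app (k := k) f v => codeFin ![3, k, f.code, codeFin fun j => (v j).code]

theorem NT.code_inj (t : NT) : ∀ t' : NT, t.code = t'.code → t = t' := by
  induction t with
  | var i =>
    intro t' h
    cases t' <;> (have e := codeFin_inj' h; clear h; simp at e)
    rw [e]
  | zero =>
    intro t' h
    cases t' <;> (have e := codeFin_inj' h; clear h; simp at e)
    rfl
  | succ t ih =>
    intro t' h
    cases t' <;> (have e := codeFin_inj' h; clear h; simp at e)
    rw [ih _ e]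
  | app f v ih =>
    intro t' h
    cases t' <;> (have e := codeFin_inj' h; clear h; simp at e)
    obtain ⟨rfl, hf, e⟩ := e
    obtain rfl := eq_of_heq (f.code_inj _ hf).2
    congr 1
    exact funext fun j => ih j _ (congrFun (codeFin_inj.1 e) j)

def PF.code : PF → ℕ
  | .bot => codeFin ![0]
  | .eq t u => codeFin ![1, t.code, u.code]
  | .imp φ ψ => codeFin ![2, φ.code, ψ.code]
  | .and φ ψ => codeFin ![3, φ.code, ψ.code]
  | .or φ ψ => codeFin ![4, φ.code, ψ.code]
  | .allN φ => codeFin ![5, φ.code]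
  | .exN φ => codeFin ![6, φ.code]
  | .allF k φ => codeFin ![7, k, φ.code]
  | .exF k φ => codeFin ![8, k, φ.code]

theorem PF.code_inj (φ : PF) : ∀ φ' : PF, φ.code = φ'.code → φ = φ' := by
  induction φ with
  | eq t u =>
    intro φ' h
    cases φ' <;> (have e := codeFin_inj' h; clear h; simp at e)
    rw [t.code_inj _ e.1, u.code_inj _ e.2]
  | _ =>
    intro φ' h
    cases φ' <;> (have e := codeFin_inj' h; clear h; simp at e) <;> grind

instance : Nonempty PF := ⟨.bot⟩

instance : Countable PF := ⟨⟨PF.code, fun φ φ' h => φ.code_inj φ' h⟩⟩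

/-! ## Henkin extensions -/

namespace PRADer

theorem cut {Γ : List PF} {φ ψ : PF} (h : PRADer Γ φ) (h' : PRADer (φ :: Γ) ψ) : PRADer Γ ψ :=
  .impE (.impI h') h

theorem exf {Γ : List PF} {φ : PF} (h : PRADer Γ .bot) : PRADer Γ φ :=
  .raa (h.weaken (List.subset_cons_self _ _))

/-- A witness `x_m` with `m` fresh may be used to eliminate a number quantifier. -/
theorem exN_elim {Γ : List PF} {φ : PF} {m : ℕ} (hΓ : ∀ ψ ∈ Γ, ψ.Bounded m) (hφ : φ.Bounded m)
    (h : PRADer (φ.instN (.var m) :: Γ) .bot) : PRADer (.exN φ :: Γ) .bot := by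
  -- The renaming sends the fresh variable `m` to the variable about to be bound and shifts all
  -- others. Since `m` bounds `φ` and `Γ`, it turns the instance back into `φ` and every member of
  -- `Γ` into its weakening.
  have := h.subst (fun i => if i = m then .var 0 else .var (i + 1)) FT.var
  refine .exNE (.hyp List.mem_cons_self) (this.weaken ?_)
  rw [List.map_cons, PF.instN_subst]
  refine List.cons_subset.2 ⟨?_, ?_⟩
  · convert List.mem_cons_self using 1
    conv_rhs => rw [← φ.subst_var]
    refine hφ _ _ _ _ ?_ fun _ _ _ => rfl
    intro i hi
    cases i with
    | zero => simp [consN, NT.subst]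
    | succ i => simp [consN, show i ≠ m by omega]
  · intro ψ hψ
    obtain ⟨χ, hχ, rfl⟩ := List.mem_map.1 hψ
    refine List.mem_cons_of_mem _ (List.mem_map.2 ⟨χ, List.mem_cons_of_mem _ hχ, ?_⟩)
    refine (hΓ χ hχ _ _ _ _ (fun i hi => ?_) fun _ _ _ => rfl)
    simp [show i ≠ m by omega]

theorem exF_elim {Γ : List PF} {k : ℕ} {φ : PF} {m : ℕ} (hΓ : ∀ ψ ∈ Γ, ψ.Bounded m)
    (hφ : φ.Bounded m) (h : PRADer (φ.instF (.var k m) :: Γ) .bot) :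
    PRADer (.exF k φ :: Γ) .bot := by
  have := h.subst NT.var
    (fun l i => .var l (if l = k then (if i = m then 0 else i + 1) else i))
  refine .exFE (.hyp List.mem_cons_self) (this.weaken ?_)
  rw [List.map_cons, PF.instF_subst]
  refine List.cons_subset.2 ⟨?_, ?_⟩
  · convert List.mem_cons_self using 1
    conv_rhs => rw [← φ.subst_var]
    refine hφ _ _ _ _ (fun _ _ => rfl) ?_
    intro l i hi
    by_cases e : l = k
    · subst e
      cases i with
      | zero => simp [consF, FT.subst]
      | succ i => simp [consF, show i ≠ m by omega]
    · simp [consF, e]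
  · intro ψ hψ
    obtain ⟨χ, hχ, rfl⟩ := List.mem_map.1 hψ
    refine List.mem_cons_of_mem _ (List.mem_map.2 ⟨χ, List.mem_cons_of_mem _ hχ, ?_⟩)
    refine (hΓ χ hχ _ _ _ _ (fun _ _ => rfl) fun l i hi => ?_)
    simp [show i ≠ m by omega]

end PRADer

/-- `Γ` contains `φ`, with a witness if `φ` is existential. -/
structure Witnessed (Γ : List PF) (φ : PF) : Prop where
  mem : φ ∈ Γ
  exN : ∀ χ, φ = .exN χ → ∃ t, χ.instN t ∈ Γ
  exF : ∀ k χ, φ = .exF k χ → ∃ f : FT k, χ.instF f ∈ Γ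

/-- Variables play the role of Henkin constants: since `Γ` is finite, some index lies beyond the
bounds of `Γ`, of `φ` and of its body, and the instance of an existential `φ` at that variable can
be added consistently. A formula of any other shape is simply added. -/
theorem exists_witnessed {Γ : List PF} {φ : PF} (h : ¬ PRADer (φ :: Γ) .bot) :
    ∃ Δ, Γ ⊆ Δ ∧ ¬ PRADer Δ .bot ∧ Witnessed Δ φ := by
  obtain ⟨m, hm⟩ := PF.exists_bounded_list Γ
  obtain ⟨m', hm'⟩ := φ.exists_bounded
  by_cases h₁ : ∃ χ, φ = .exN χ
  · obtain ⟨χ, rfl⟩ := h₁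
    obtain ⟨l, hl⟩ := χ.exists_bounded
    refine ⟨χ.instN (.var (max l (max m m'))) :: .exN χ :: Γ, by grind, fun h' => h ?_,
      by simp, fun χ' e => ⟨_, by cases e; exact List.mem_cons_self⟩, by simp⟩
    refine (PRADer.exN_elim (m := max l (max m m')) ?_ (hl.mono (by omega)) h').weaken (by grind)
    intro ψ hψ
    rcases List.mem_cons.1 hψ with rfl | hψ
    · exact hm'.mono (by omega)
    · exact (hm ψ hψ).mono (by omega)
  by_cases h₂ : ∃ k χ, φ = .exF k χ
  · obtain ⟨k, χ, rfl⟩ := h₂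
    obtain ⟨l, hl⟩ := χ.exists_bounded
    refine ⟨χ.instF (.var k (max l (max m m'))) :: .exF k χ :: Γ, by grind, fun h' => h ?_,
      by simp, by simp, fun k' χ' e => ?_⟩
    · refine (PRADer.exF_elim (m := max l (max m m')) ?_ (hl.mono (by omega)) h').weaken (by grind)
      intro ψ hψ
      rcases List.mem_cons.1 hψ with rfl | hψ
      · exact hm'.mono (by omega)
      · exact (hm ψ hψ).mono (by omega)
    · cases e; exact ⟨_, List.mem_cons_self⟩
  · exact ⟨φ :: Γ, by grind, h, List.mem_cons_self, fun χ e => (h₁ ⟨χ, e⟩).elim,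
      fun k χ e => (h₂ ⟨k, χ, e⟩).elim⟩

/-- A complete theory with witnesses. -/
structure Henkin (T : Set PF) : Prop where
  der : ∀ {Γ : List PF} {φ : PF}, (∀ ψ ∈ Γ, ψ ∈ T) → PRADer Γ φ → φ ∈ T
  cons : PF.bot ∉ T
  complete : ∀ φ, φ ∈ T ∨ .imp φ .bot ∈ T
  exN : ∀ χ, .exN χ ∈ T → ∃ t, χ.instN t ∈ T
  exF : ∀ k χ, .exF k χ ∈ T → ∃ f : FT k, χ.instF f ∈ T

/-- Lindenbaum's construction along an enumeration of all formulas. Stage `n + 1` contains the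
`n`-th formula with a witness, unless that formula is refutable from stage `n`. The stages remain
finite lists, so fresh variables never run out; `T` is the set of consequences of the stages. -/
theorem exists_henkin {Γ : List PF} (hΓ : ¬ PRADer Γ .bot) : ∃ T, Henkin T ∧ ∀ φ ∈ Γ, φ ∈ T := by
  obtain ⟨en, hen⟩ := exists_surjective_nat PF
  have step : ∀ (Δ : {Δ : List PF // ¬ PRADer Δ .bot}) (φ : PF),
      ∃ Δ' : {Δ : List PF // ¬ PRADer Δ .bot}, Δ.1 ⊆ Δ'.1 ∧
        (PRADer (φ :: Δ.1) .bot ∨ Witnessed Δ'.1 φ) := by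
    rintro ⟨Δ, hΔ⟩ φ
    by_cases h : PRADer (φ :: Δ) .bot
    · exact ⟨⟨Δ, hΔ⟩, by simp, .inl h⟩
    · obtain ⟨Δ', h₁, h₂, h₃⟩ := exists_witnessed h
      exact ⟨⟨Δ', h₂⟩, h₁, .inr h₃⟩
  choose next hsub hnext using step
  let S : ℕ → {Δ : List PF // ¬ PRADer Δ .bot} :=
    fun n => Nat.rec ⟨Γ, hΓ⟩ (fun n Δ => next Δ (en n)) n
  have hS : ∀ n, S (n + 1) = next (S n) (en n) := fun n => rfl
  have mono : ∀ m n, m ≤ n → (S m).1 ⊆ (S n).1 := by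
    intro m n h
    induction h with
    | refl => simp
    | step h ih => exact fun x hx => hsub _ _ (ih hx)
  have decide : ∀ φ, (∃ n, PRADer (φ :: (S n).1) .bot) ∨ ∃ n, Witnessed (S n).1 φ := by
    intro φ
    obtain ⟨n, rfl⟩ := hen φ
    rcases hnext (S n) (en n) with h | h
    · exact .inl ⟨n, h⟩
    · exact .inr ⟨n + 1, h⟩
  let T : Set PF := {φ | ∃ n, PRADer (S n).1 φ}
  have hder : ∀ {Γ : List PF} {φ : PF}, (∀ ψ ∈ Γ, ψ ∈ T) → PRADer Γ φ → φ ∈ T := by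
    intro Γ
    induction Γ with
    | nil => exact fun _ h => ⟨0, h.weaken (by simp)⟩
    | cons χ Γ ih =>
      intro φ hT h
      obtain ⟨n, hn⟩ := ih (fun ψ hψ => hT ψ (List.mem_cons_of_mem _ hψ)) (.impI h)
      obtain ⟨m, hm⟩ := hT χ List.mem_cons_self
      exact ⟨max n m, .impE (hn.weaken (mono _ _ (le_max_left _ _)))
        (hm.weaken (mono _ _ (le_max_right _ _)))⟩
  -- A consequence of one stage that is refuted at another would make a common later stage
  -- inconsistent, by a cut. So every element of `T` was accepted when its turn came, and received
  -- its witness.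
  have hwit : ∀ φ ∈ T, ∃ n, Witnessed (S n).1 φ := by
    rintro φ ⟨n, hn⟩
    rcases decide φ with ⟨m, hm⟩ | h
    · refine ((S (max n m)).2 (.cut (hn.weaken (mono _ _ (le_max_left _ _))) (hm.weaken ?_))).elim
      exact List.cons_subset_cons _ (mono _ _ (le_max_right _ _))
    · exact h
  refine ⟨T, ⟨hder, fun ⟨n, hn⟩ => (S n).2 hn, fun φ => ?_, fun χ hχ => ?_, fun k χ hχ => ?_⟩,
    fun φ hφ => ⟨0, .hyp hφ⟩⟩
  · rcases decide φ with ⟨n, hn⟩ | ⟨n, hn⟩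
    · exact .inr ⟨n, .impI hn⟩
    · exact .inl ⟨n, .hyp hn.mem⟩
  · obtain ⟨n, hn⟩ := hwit _ hχ
    obtain ⟨t, ht⟩ := hn.exN χ rfl
    exact ⟨t, n, .hyp ht⟩
  · obtain ⟨n, hn⟩ := hwit _ hχ
    obtain ⟨t, ht⟩ := hn.exF k χ rfl
    exact ⟨t, n, .hyp ht⟩

/-- Lets the eigenvariable of a universal introduction act as the counterexample in
`allN_of_not_exN`. -/
theorem PF.instN_up (φ : PF) :
    (φ.subst (liftN fun i => .var (i + 1)) FT.var).instN (.var 0) = φ := by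
  rw [PF.subst_instN]
  conv_rhs => rw [← φ.subst_var]
  congr 1
  funext i
  cases i <;> rfl

theorem PF.instF_up {k : ℕ} (φ : PF) :
    (φ.subst (fun i => (NT.var i).upF k) (liftF k fun l i =>
      .var l (if l = k then i + 1 else i))).instF (.var k 0) = φ := by
  rw [PF.subst_instF]
  conv_rhs => rw [← φ.subst_var]
  congr 1
  funext l i
  by_cases h : l = k
  · subst h; cases i <;> simp [consF]
  · simp [consF, h]

namespace PRADer

/-- Classically, a universal statement without counterexamples holds. -/
theorem allN_of_not_exN {φ : PF} : PRADer [.imp (.exN (.imp φ .bot)) .bot] (.allN φ) := by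
  refine .allNI (.raa (.impE (.hyp (List.mem_cons_of_mem _ List.mem_cons_self)) ?_))
  refine .exNI (.var 0) ?_
  have := PF.instN_up (.imp φ .bot)
  exact .hyp (List.mem_cons.2 (.inl this))

theorem allF_of_not_exF {k : ℕ} {φ : PF} :
    PRADer [.imp (.exF k (.imp φ .bot)) .bot] (.allF k φ) := by
  refine .allFI (.raa (.impE (.hyp (List.mem_cons_of_mem _ List.mem_cons_self)) ?_))
  refine .exFI (.var k 0) ?_
  have := PF.instF_up (k := k) (.imp φ .bot)
  exact .hyp (List.mem_cons.2 (.inl this))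

end PRADer

namespace Henkin

variable {T : Set PF} (hT : Henkin T)
include hT

theorem der₁ {φ ψ : PF} (h : PRADer [φ] ψ) (hφ : φ ∈ T) : ψ ∈ T :=
  hT.der (by simpa using hφ) h

theorem mp {φ ψ : PF} (h : .imp φ ψ ∈ T) (hφ : φ ∈ T) : ψ ∈ T :=
  hT.der (Γ := [.imp φ ψ, φ]) (by simp [h, hφ])
    (.impE (φ := φ) (.hyp (by simp)) (.hyp (by simp)))

theorem not_mem {φ : PF} : .imp φ .bot ∈ T ↔ φ ∉ T :=
  ⟨fun h h' => hT.cons (hT.mp h h'), fun h => (hT.complete φ).resolve_left h⟩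

theorem imp_mem {φ ψ : PF} : .imp φ ψ ∈ T ↔ (φ ∈ T → ψ ∈ T) := by
  refine ⟨hT.mp, fun h => ?_⟩
  by_cases h' : φ ∈ T
  · exact hT.der₁ (.impI (.hyp (by simp))) (h h')
  · exact hT.der₁ (.impI (.exf (.impE (φ := φ) (.hyp (by simp)) (.hyp (by simp)))))
      (hT.not_mem.2 h')

theorem and_mem {φ ψ : PF} : .and φ ψ ∈ T ↔ φ ∈ T ∧ ψ ∈ T :=
  ⟨fun h => ⟨hT.der₁ (.andE₁ (.hyp (List.mem_singleton_self _))) h,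
      hT.der₁ (.andE₂ (.hyp (List.mem_singleton_self _))) h⟩,
    fun h => hT.der (Γ := [φ, ψ]) (by simp [h]) (.andI (.hyp (by simp)) (.hyp (by simp)))⟩

theorem or_mem {φ ψ : PF} : .or φ ψ ∈ T ↔ φ ∈ T ∨ ψ ∈ T := by
  refine ⟨fun h => ?_, ?_⟩
  · by_contra! h'
    refine hT.cons (hT.der (Γ := [.or φ ψ, .imp φ .bot, .imp ψ .bot]) ?_ ?_)
    · simp [h, hT.not_mem, h']
    · exact .orE (φ := φ) (ψ := ψ) (.hyp (by simp))
        (.impE (φ := φ) (.hyp (by simp)) (.hyp (by simp)))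
        (.impE (φ := ψ) (.hyp (by simp)) (.hyp (by simp)))
  · rintro (h | h)
    · exact hT.der₁ (.orI₁ (.hyp (by simp))) h
    · exact hT.der₁ (.orI₂ (.hyp (by simp))) h

theorem exN_mem {φ : PF} : .exN φ ∈ T ↔ ∃ t, φ.instN t ∈ T :=
  ⟨hT.exN φ, fun ⟨t, h⟩ => hT.der₁ (.exNI t (.hyp (by simp))) h⟩

theorem exF_mem {k : ℕ} {φ : PF} : .exF k φ ∈ T ↔ ∃ f : FT k, φ.instF f ∈ T :=
  ⟨hT.exF k φ, fun ⟨t, h⟩ => hT.der₁ (.exFI t (.hyp (by simp))) h⟩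

/-- Only existential formulas carry witnesses. A universal formula outside `T` is refuted by the
witness of the existential formula that asserts a counterexample. -/
theorem allN_mem {φ : PF} : .allN φ ∈ T ↔ ∀ t, φ.instN t ∈ T := by
  refine ⟨fun h t => hT.der₁ (.allNE (.hyp (by simp)) t) h, fun h => ?_⟩
  refine hT.der₁ .allN_of_not_exN (hT.not_mem.2 fun h' => ?_)
  obtain ⟨t, ht⟩ := hT.exN _ h'
  exact hT.not_mem.1 ht (h t)

theorem allF_mem {k : ℕ} {φ : PF} : .allF k φ ∈ T ↔ ∀ f : FT k, φ.instF f ∈ T := by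
  refine ⟨fun h t => hT.der₁ (.allFE (.hyp (by simp)) t) h, fun h => ?_⟩
  refine hT.der₁ .allF_of_not_exF (hT.not_mem.2 fun h' => ?_)
  obtain ⟨t, ht⟩ := hT.exF _ _ h'
  exact hT.not_mem.1 ht (h t)

end Henkin

end IntrinsicTheory

namespace IntrinsicTheory

/-! ## Models of PRA* -/

/-- A structure for the language of PRA*. -/
structure Struct where
  N : Type
  F : ℕ → Type
  zero : N
  succ : N → N
  app : {k : ℕ} → F k → (Fin k → N) → N
  fnl : {r : ℕ} → (s : Fin r → ℕ) → (k i : ℕ) → ((j : Fin r) → F (s j)) → F k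
  prf : {r : ℕ} → {s : Fin r → ℕ} → {k : ℕ} → PR s k → ((j : Fin r) → F (s j)) → F k

namespace Struct

variable (M : Struct)

def evF (τ : (k : ℕ) → ℕ → M.F k) : {k : ℕ} → FT k → M.F k
  | _, .var k i => τ k i
  | _, .fnl s k i args => M.fnl s k i (fun j => evF τ (args j))
  | _, .prf c args => M.prf c (fun j => evF τ (args j))

def evN (σ : ℕ → M.N) (τ : (k : ℕ) → ℕ → M.F k) : NT → M.N
  | .var i => σ i
  | .zero => M.zero
  | .succ t => M.succ (evN σ τ t)
  | .app f v => M.app (M.evF τ f) (fun j => evN σ τ (v j))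

variable {M}

def push (x : M.N) (σ : ℕ → M.N) : ℕ → M.N
  | 0 => x
  | i + 1 => σ i

def pushF {k : ℕ} (f : M.F k) (τ : (k : ℕ) → ℕ → M.F k) (l : ℕ) (i : ℕ) : M.F l :=
  if h : l = k then
    match i with
    | 0 => h ▸ f
    | i + 1 => τ l i
  else τ l i

variable (M)

def sat (σ : ℕ → M.N) (τ : (k : ℕ) → ℕ → M.F k) : PF → Prop
  | .bot => False
  | .eq t u => M.evN σ τ t = M.evN σ τ u
  | .imp φ ψ => sat σ τ φ → sat σ τ ψ
  | .and φ ψ => sat σ τ φ ∧ sat σ τ ψ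
  | .or φ ψ => sat σ τ φ ∨ sat σ τ ψ
  | .allN φ => ∀ x, sat (push x σ) τ φ
  | .exN φ => ∃ x, sat (push x σ) τ φ
  | .allF k φ => ∀ f : M.F k, sat σ (pushF f τ) φ
  | .exF k φ => ∃ f : M.F k, sat σ (pushF f τ) φ

variable {M}

theorem evF_subst (τ : (k : ℕ) → ℕ → M.F k) (τ' : (k : ℕ) → ℕ → FT k) {k : ℕ} (f : FT k) :
    M.evF τ (f.subst τ') = M.evF (fun l i => M.evF τ (τ' l i)) f := by
  induction f with
  | var k i => rfl
  | fnl s k i args ih => simp only [FT.subst, evF, ih]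
  | prf c args ih => simp only [FT.subst, evF, ih]

theorem evN_subst (σ : ℕ → M.N) (τ : (k : ℕ) → ℕ → M.F k) (σ' : ℕ → NT)
    (τ' : (k : ℕ) → ℕ → FT k) (t : NT) :
    M.evN σ τ (t.subst σ' τ') =
      M.evN (fun i => M.evN σ τ (σ' i)) (fun l i => M.evF τ (τ' l i)) t := by
  induction t with
  | var i => rfl
  | zero => rfl
  | succ t ih => simp only [NT.subst, evN, ih]
  | app f v ih => simp only [NT.subst, evN, ih, evF_subst]

theorem pushF_up {k : ℕ} (f : M.F k) (τ : (k : ℕ) → ℕ → M.F k) :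
    (fun l i => pushF f τ l (if l = k then i + 1 else i)) = τ := by
  funext l i
  by_cases h : l = k <;> simp [pushF, h]

theorem evF_up {k : ℕ} (f : M.F k) (τ : (k : ℕ) → ℕ → M.F k) {l : ℕ} (g : FT l) :
    M.evF (pushF f τ) (g.up k) = M.evF τ g := by
  rw [FT.up, evF_subst]
  simp only [evF, pushF_up]

theorem evN_upF {k : ℕ} (f : M.F k) (σ : ℕ → M.N) (τ : (k : ℕ) → ℕ → M.F k) (t : NT) :
    M.evN σ (pushF f τ) (t.upF k) = M.evN σ τ t := by
  rw [NT.upF, evN_subst]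
  simp only [evF, evN, pushF_up]

theorem evN_up (x : M.N) (σ : ℕ → M.N) (τ : (k : ℕ) → ℕ → M.F k) (t : NT) :
    M.evN (push x σ) τ t.up = M.evN σ τ t := by
  rw [NT.up, evN_subst]
  simp only [evF, evN, push]

theorem evN_liftN (x : M.N) (σ : ℕ → M.N) (τ : (k : ℕ) → ℕ → M.F k) (σ' : ℕ → NT) :
    (fun i => M.evN (push x σ) τ (liftN σ' i)) = push x (fun i => M.evN σ τ (σ' i)) := by
  funext i
  cases i with
  | zero => rfl
  | succ i => exact evN_up x σ τ (σ' i)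

theorem evF_liftF {k : ℕ} (f : M.F k) (τ : (k : ℕ) → ℕ → M.F k) (τ' : (k : ℕ) → ℕ → FT k) :
    (fun l i => M.evF (pushF f τ) (liftF k τ' l i)) = pushF f (fun l i => M.evF τ (τ' l i)) := by
  funext l i
  by_cases h : l = k
  · subst h
    cases i with
    | zero => simp [liftF, evF, pushF]
    | succ i => simp [liftF, evF_up]; simp [pushF]
  · simp [liftF, h, evF_up]; simp [pushF, h]

theorem sat_subst (φ : PF) : ∀ (σ : ℕ → M.N) (τ : (k : ℕ) → ℕ → M.F k) (σ' : ℕ → NT)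
    (τ' : (k : ℕ) → ℕ → FT k), M.sat σ τ (φ.subst σ' τ') ↔
      M.sat (fun i => M.evN σ τ (σ' i)) (fun l i => M.evF τ (τ' l i)) φ := by
  induction φ with
  | bot => intros; rfl
  | eq t u => intros; simp only [PF.subst, sat, evN_subst]
  | imp φ ψ ih ih' => intros; simp only [PF.subst, sat, ih, ih']
  | and φ ψ ih ih' => intros; simp only [PF.subst, sat, ih, ih']
  | or φ ψ ih ih' => intros; simp only [PF.subst, sat, ih, ih']
  | allN φ ih => intros; simp only [PF.subst, sat, ih, evN_liftN]
  | exN φ ih => intros; simp only [PF.subst, sat, ih, evN_liftN]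
  | allF k φ ih => intros; simp only [PF.subst, sat, ih, evF_liftF, evN_upF]
  | exF k φ ih => intros; simp only [PF.subst, sat, ih, evF_liftF, evN_upF]

end Struct

/-- A model of PRA* all of whose elements are denoted by terms, for a fixed assignment. -/
structure Model extends Struct where
  σ₀ : ℕ → N
  τ₀ : (k : ℕ) → ℕ → F k
  named (x : N) : ∃ t, toStruct.evN σ₀ τ₀ t = x
  namedF {k : ℕ} (f : F k) : ∃ t : FT k, toStruct.evF τ₀ t = f
  holds {φ : PF} : PRAxiom φ → toStruct.sat σ₀ τ₀ φ

/-! ## The term model -/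

theorem NT.up_instN (t u : NT) : t.up.subst (consN u NT.var) FT.var = t := by
  rw [NT.up, NT.subst_subst]
  exact NT.subst_var t

namespace Henkin

variable {T : Set PF} (hT : Henkin T)
include hT

theorem eq_refl (t : NT) : .eq t t ∈ T := hT.der (Γ := []) (by simp) (.eqRefl t)

theorem eq_subst {t u : NT} (φ : PF) (h : .eq t u ∈ T) (h' : φ.instN t ∈ T) : φ.instN u ∈ T :=
  hT.der (Γ := [.eq t u, φ.instN t]) (by simp [h, h'])
    (.eqSubst (t := t) φ (.hyp (by simp)) (.hyp (by simp)))

/-- Leibniz's rule for equations, the place of replacement being marked by the variable `0`.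
Symmetry, transitivity and the congruences result from suitable choices of `l` and `r`, a side that
stays fixed being weakened. -/
theorem eq_rw {t u : NT} (l r : NT) (h : .eq t u ∈ T)
    (h' : .eq (l.subst (consN t NT.var) FT.var) (r.subst (consN t NT.var) FT.var) ∈ T) :
    .eq (l.subst (consN u NT.var) FT.var) (r.subst (consN u NT.var) FT.var) ∈ T := by
  have := hT.eq_subst (.eq l r) h
  rw [PF.instN_eq, PF.instN_eq] at this
  exact this h'

theorem eq_symm {t u : NT} (h : .eq t u ∈ T) : .eq u t ∈ T := by
  have := hT.eq_rw (.var 0) t.up h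
  simp only [NT.up_instN, NT.subst, consN] at this
  exact this (hT.eq_refl t)

theorem eq_trans {t u v : NT} (h : .eq t u ∈ T) (h' : .eq u v ∈ T) : .eq t v ∈ T := by
  have := hT.eq_rw t.up (.var 0) h'
  simp only [NT.up_instN, NT.subst, consN] at this
  exact this h

theorem eq_succ {t u : NT} (h : .eq t u ∈ T) : .eq (.succ t) (.succ u) ∈ T := by
  have := hT.eq_rw (.succ t.up) (.succ (.var 0)) h
  simp only [NT.up_instN, NT.subst, consN] at this
  exact this (hT.eq_refl _)

/-- Leibniz's rule replaces a single variable, so the arguments are exchanged one after the other;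
`m` counts those already exchanged. -/
theorem eq_app {k : ℕ} (f : FT k) (v w : Fin k → NT) (h : ∀ j, .eq (v j) (w j) ∈ T) :
    .eq (.app f v) (.app f w) ∈ T := by
  have key : ∀ m ≤ k, .eq (.app f v) (.app f fun j => if j.1 < m then w j else v j) ∈ T := by
    intro m
    induction m with
    | zero => intro _; simpa using hT.eq_refl _
    | succ m ih =>
      intro hm
      have := hT.eq_rw (NT.app f v).up
        (.app f fun j => if j.1 < m then (w j).up else if j.1 = m then .var 0 else (v j).up)
        (h ⟨m, hm⟩)
      simp only [NT.up_instN, NT.subst, FT.subst_var] at this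
      have e : ∀ t : NT, (fun j : Fin k => NT.subst (consN t NT.var) FT.var
          (if j.1 < m then (w j).up else if j.1 = m then .var 0 else (v j).up)) =
          fun j : Fin k => if j.1 < m then w j else if j.1 = m then t else v j := by
        intro t
        funext j
        split_ifs <;> first | exact NT.up_instN _ _ | rfl
      rw [e, e] at this
      convert this ?_ using 3
      · funext j
        by_cases h₁ : j.1 < m
        · simp [h₁, show j.1 < m + 1 by omega]
        · by_cases h₂ : j.1 = m
          · subst h₂; simp
          · simp [h₁, h₂, show ¬ j.1 < m + 1 by omega]
      · convert ih (by omega) using 3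
        funext j
        by_cases h₁ : j.1 < m
        · simp [h₁]
        · by_cases h₂ : j.1 = m
          · subst h₂; simp
          · simp [h₁, h₂]
  simpa using key k le_rfl

/-- Provable equality of number terms. -/
def setoid : Setoid NT where
  r t u := .eq t u ∈ T
  iseqv := ⟨hT.eq_refl, hT.eq_symm, hT.eq_trans⟩

/-- The structure of the terms, modulo provable equality. -/
noncomputable def struct : Struct where
  N := Quotient hT.setoid
  -- No quotient is taken here: equality of functions is not an atomic formula, so distinct function
  -- terms may represent the same function.
  F := FT
  zero := Quotient.mk _ .zero
  succ := Quotient.map NT.succ fun _ _ h => hT.eq_succ h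
  app f v := Quotient.mk _ (.app f fun j => (v j).out)
  fnl := FT.fnl
  prf := FT.prf

theorem evF_struct (τ : (k : ℕ) → ℕ → FT k) {k : ℕ} (f : FT k) :
    hT.struct.evF τ f = f.subst τ := by
  induction f with
  | var k i => rfl
  | fnl s k i args ih => exact congrArg (FT.fnl s k i) (funext ih)
  | prf c args ih => exact congrArg (FT.prf c) (funext ih)

theorem evN_struct (σ : ℕ → NT) (τ : (k : ℕ) → ℕ → FT k) (t : NT) :
    hT.struct.evN (fun i => Quotient.mk _ (σ i)) τ t = Quotient.mk hT.setoid (t.subst σ τ) := by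
  induction t with
  | var i => rfl
  | zero => rfl
  | succ t ih => exact congrArg hT.struct.succ ih
  | app f v ih =>
    simp only [Struct.evN, ih, hT.evF_struct]
    refine Quotient.sound (hT.eq_app _ _ _ fun j => ?_)
    exact Quotient.exact (s := hT.setoid) (Quotient.out_eq _)

theorem push_struct (t : NT) (σ : ℕ → NT) :
    Struct.push (M := hT.struct) (Quotient.mk _ t) (fun i => Quotient.mk _ (σ i)) =
      fun i => Quotient.mk _ (consN t σ i) := by
  funext i; cases i <;> rfl

/-- The truth lemma, stated for all substitutions so that the induction passes binders. Elements are
terms or classes of terms, so quantifiers over elements are quantifiers over instances, which `T`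
decides by its witnesses. -/
theorem sat_struct (φ : PF) : ∀ (σ : ℕ → NT) (τ : (k : ℕ) → ℕ → FT k),
    hT.struct.sat (fun i => Quotient.mk _ (σ i)) τ φ ↔ φ.subst σ τ ∈ T := by
  induction φ with
  | bot => intro σ τ; simpa [Struct.sat, PF.subst] using hT.cons
  | eq t u =>
    intro σ τ
    simp only [Struct.sat, hT.evN_struct, PF.subst]
    exact Quotient.eq (r := hT.setoid)
  | imp φ ψ ih ih' => intro σ τ; simp only [Struct.sat, PF.subst, hT.imp_mem, ih, ih']
  | and φ ψ ih ih' => intro σ τ; simp only [Struct.sat, PF.subst, hT.and_mem, ih, ih']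
  | or φ ψ ih ih' => intro σ τ; simp only [Struct.sat, PF.subst, hT.or_mem, ih, ih']
  | allN φ ih =>
    intro σ τ
    simp only [Struct.sat, PF.subst, hT.allN_mem, PF.subst_instN, ← ih, ← hT.push_struct]
    exact ⟨fun h t => h _, fun h x => (Quotient.exists_rep x).elim fun t e => e ▸ h t⟩
  | exN φ ih =>
    intro σ τ
    simp only [Struct.sat, PF.subst, hT.exN_mem, PF.subst_instN, ← ih, ← hT.push_struct]
    exact ⟨fun ⟨x, h⟩ => (Quotient.exists_rep x).elim fun t e => ⟨t, e ▸ h⟩, fun ⟨t, h⟩ => ⟨_, h⟩⟩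
  | allF k φ ih =>
    intro σ τ
    simp only [Struct.sat, PF.subst, hT.allF_mem, PF.subst_instF, ← ih]
    rfl
  | exF k φ ih =>
    intro σ τ
    simp only [Struct.sat, PF.subst, hT.exF_mem, PF.subst_instF, ← ih]
    rfl

/-- The term model of a complete theory with witnesses. -/
noncomputable def model : Model where
  toStruct := hT.struct
  σ₀ i := Quotient.mk _ (.var i)
  τ₀ := FT.var
  named x := by
    obtain ⟨t, rfl⟩ := Quotient.exists_rep x
    exact ⟨t, (hT.evN_struct _ _ t).trans (by rw [NT.subst_var])⟩
  namedF f := ⟨f, (hT.evF_struct _ f).trans f.subst_var⟩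
  holds h := by
    rw [hT.sat_struct, PF.subst_var]
    exact hT.der (Γ := []) (by simp) (.ax h)

end Henkin

/-- Completeness of PRA*. -/
theorem provable_of_sat {φ : PF} (h : ∀ M : Model, M.sat M.σ₀ M.τ₀ φ) : PRAProvable φ := by
  by_contra hφ
  obtain ⟨T, hT, hmem⟩ := exists_henkin (Γ := [.imp φ .bot]) fun h' => hφ (.raa h')
  have := (hT.sat_struct φ _ _).1 (h hT.model)
  erw [PF.subst_var] at this
  exact hT.not_mem.1 (hmem _ (by simp)) this

end IntrinsicTheory

namespace IntrinsicTheory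
namespace Model

/-! ## Definability in a model -/

/-- A type of values of finitely many variables, over the fixed assignment of the model. -/
class Ctx (M : Model) (α : Type) where
  envN : α → ℕ → M.N
  envF : α → (k : ℕ) → ℕ → M.F k
  upN : NT → NT
  upF : {k : ℕ} → FT k → FT k
  upN_eq : ∀ a t, M.evN (envN a) (envF a) (upN t) = M.evN M.σ₀ M.τ₀ t
  upF_eq : ∀ a {k : ℕ} (t : FT k), M.evF (envF a) (upF t) = M.evF M.τ₀ t

/-- A sort of variables. -/
class Ext (M : Model) (β : Type) where
  pushN : β → (ℕ → M.N) → ℕ → M.N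
  pushF : β → ((k : ℕ) → ℕ → M.F k) → (k : ℕ) → ℕ → M.F k
  upN : NT → NT
  upF : {k : ℕ} → FT k → FT k
  upN_eq : ∀ b σ τ t, M.evN (pushN b σ) (pushF b τ) (upN t) = M.evN σ τ t
  upF_eq : ∀ b τ {k : ℕ} (t : FT k), M.evF (pushF b τ) (upF t) = M.evF τ t

instance (M : Model) : Ctx M Unit where
  envN _ := M.σ₀
  envF _ := M.τ₀
  upN := id
  upF := id
  upN_eq _ _ := rfl
  upF_eq _ _ _ := rfl

instance (M : Model) : Ext M M.N where
  pushN := Struct.push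
  pushF _ τ := τ
  upN := NT.up
  upF := id
  upN_eq := Struct.evN_up
  upF_eq _ _ _ _ := rfl

instance (M : Model) (k : ℕ) : Ext M (M.F k) where
  pushN _ σ := σ
  pushF := Struct.pushF
  upN := NT.upF k
  upF := FT.up k
  upN_eq := Struct.evN_upF
  upF_eq b τ _ t := Struct.evF_up b τ t

/-- The last component of a nested pair is the variable with index `0` of its sort. Projections such
as `p.1.2` thus stand for de Bruijn variables, and the defining formula of a predicate is found by
instance search along its Lean expression. -/
instance (M : Model) (α β : Type) [Ctx M α] [Ext M β] : Ctx M (α × β) where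
  envN p := Ext.pushN p.2 (Ctx.envN p.1)
  envF p := Ext.pushF p.2 (Ctx.envF p.1)
  upN t := Ext.upN M β (Ctx.upN M α t)
  upF t := Ext.upF M β (Ctx.upF M α t)
  upN_eq _ t := (Ext.upN_eq _ _ _ _).trans (Ctx.upN_eq _ t)
  upF_eq _ _ t := (Ext.upF_eq _ _ _).trans (Ctx.upF_eq _ t)

/-- `f` is given by a number term with parameters. -/
class DefN (M : Model) {α : Type} [Ctx M α] (f : α → M.N) : Prop where
  out : ∃ t : NT, ∀ a, M.evN (Ctx.envN a) (Ctx.envF a) t = f a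

/-- `f` is given by a function term with parameters. -/
class DefF (M : Model) {k : ℕ} {α : Type} [Ctx M α] (f : α → M.F k) : Prop where
  out : ∃ t : FT k, ∀ a, M.evF (Ctx.envF a) t = f a

/-- `P` is given by a formula with parameters. -/
class Def (M : Model) {α : Type} [Ctx M α] (P : α → Prop) : Prop where
  out : ∃ φ : PF, ∀ a, M.sat (Ctx.envN a) (Ctx.envF a) φ ↔ P a

variable {M : Model} {α β γ δ ε : Type} [Ctx M α] [Ext M β] [Ext M γ] [Ext M δ] [Ext M ε] {k : ℕ}

/-- This is why models are required to have all elements named: every element may be used as a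
parameter. -/
instance (x : M.N) : DefN M fun _ : α => x :=
  ⟨(M.named x).imp' (Ctx.upN M α) fun t h a => (Ctx.upN_eq a t).trans h⟩
instance (f : M.F k) : DefF M fun _ : α => f :=
  ⟨(M.namedF f).imp' (Ctx.upF M α) fun t h a => (Ctx.upF_eq a t).trans h⟩

theorem DefN.up {f : α → M.N} [h : DefN M f] : DefN M fun p : α × β => f p.1 := by
  obtain ⟨t, ht⟩ := h.out
  exact ⟨Ext.upN M β t, fun a => (Ext.upN_eq _ _ _ _).trans (ht _)⟩

theorem DefF.up {f : α → M.F k} [h : DefF M f] : DefF M fun p : α × β => f p.1 := by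
  obtain ⟨t, ht⟩ := h.out
  exact ⟨Ext.upF M β t, fun a => (Ext.upF_eq _ _ _).trans (ht _)⟩

instance varN₀ : DefN M fun p : α × M.N => p.2 := ⟨.var 0, fun _ => rfl⟩
instance varN₁ : DefN M fun p : (α × M.N) × β => p.1.2 :=
  DefN.up (f := fun p : α × M.N => p.2)
instance varN₂ : DefN M fun p : ((α × M.N) × β) × γ => p.1.1.2 :=
  DefN.up (f := fun p : (α × M.N) × β => p.1.2)
instance varN₃ : DefN M fun p : (((α × M.N) × β) × γ) × δ => p.1.1.1.2 :=
  DefN.up (f := fun p : ((α × M.N) × β) × γ => p.1.1.2)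
instance varN₄ : DefN M fun p : ((((α × M.N) × β) × γ) × δ) × ε => p.1.1.1.1.2 :=
  DefN.up (f := fun p : (((α × M.N) × β) × γ) × δ => p.1.1.1.2)
instance varF₀ : DefF M fun p : α × M.F k => p.2 := ⟨.var k 0, fun _ => by
  show Struct.pushF _ _ k 0 = _
  simp [Struct.pushF]⟩
instance varF₁ : DefF M fun p : (α × M.F k) × β => p.1.2 :=
  DefF.up (f := fun p : α × M.F k => p.2)
instance varF₂ : DefF M fun p : ((α × M.F k) × β) × γ => p.1.1.2 :=
  DefF.up (f := fun p : (α × M.F k) × β => p.1.2)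

theorem DefN.app {f : α → M.F k} {v : α → Fin k → M.N} [hf : DefF M f]
    (hv : ∀ j, DefN M fun a => v a j) : DefN M fun a => M.app (f a) (v a) := by
  obtain ⟨t, ht⟩ := hf.out
  choose u hu using fun j => (hv j).out
  exact ⟨.app t u, fun a => by simp only [Struct.evN, ht, hu]⟩

instance {f : α → M.F 1} {x : α → M.N} [DefF M f] [DefN M x] :
    DefN M fun a => M.app (f a) ![x a] :=
  DefN.app fun j => by fin_cases j; assumption
instance {f : α → M.F 2} {x y : α → M.N} [DefF M f] [DefN M x] [DefN M y] :
    DefN M fun a => M.app (f a) ![x a, y a] :=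
  DefN.app fun j => by fin_cases j <;> assumption
instance {f : α → M.F 3} {x y z : α → M.N} [DefF M f] [DefN M x] [DefN M y] [DefN M z] :
    DefN M fun a => M.app (f a) ![x a, y a, z a] :=
  DefN.app fun j => by fin_cases j <;> assumption

instance {x : α → M.N} [h : DefN M x] : DefN M fun a => M.succ (x a) := by
  obtain ⟨t, ht⟩ := h.out
  exact ⟨.succ t, fun a => congrArg M.succ (ht a)⟩

instance {x y : α → M.N} [hx : DefN M x] [hy : DefN M y] : Def M fun a => x a = y a := by
  obtain ⟨t, ht⟩ := hx.out
  obtain ⟨u, hu⟩ := hy.out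
  exact ⟨.eq t u, fun a => by simp only [Struct.sat, ht, hu]⟩

instance (p : Prop) : Def M fun _ : α => p := by
  by_cases h : p
  · exact ⟨.imp .bot .bot, fun a => by simp [Struct.sat, h]⟩
  · exact ⟨.bot, fun a => by simp [Struct.sat, h]⟩

instance {P Q : α → Prop} [hP : Def M P] [hQ : Def M Q] : Def M fun a => P a → Q a := by
  obtain ⟨φ, h⟩ := hP.out
  obtain ⟨ψ, h'⟩ := hQ.out
  exact ⟨.imp φ ψ, fun a => by simp only [Struct.sat, h, h']⟩

instance {P Q : α → Prop} [hP : Def M P] [hQ : Def M Q] : Def M fun a => P a ∧ Q a := by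
  obtain ⟨φ, h⟩ := hP.out
  obtain ⟨ψ, h'⟩ := hQ.out
  exact ⟨.and φ ψ, fun a => by simp only [Struct.sat, h, h']⟩

instance {P Q : α → Prop} [hP : Def M P] [hQ : Def M Q] : Def M fun a => P a ∨ Q a := by
  obtain ⟨φ, h⟩ := hP.out
  obtain ⟨ψ, h'⟩ := hQ.out
  exact ⟨.or φ ψ, fun a => by simp only [Struct.sat, h, h']⟩

instance {P Q : α → Prop} [hP : Def M P] [hQ : Def M Q] : Def M fun a => P a ↔ Q a := by
  simp only [iff_def]; infer_instance

instance {P : α → Prop} [hP : Def M P] : Def M fun a => ¬ P a := by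
  unfold Not; infer_instance

instance {P : α → M.N → Prop} [h : Def M fun p : α × M.N => P p.1 p.2] :
    Def M fun a => ∀ x : M.N, P a x := by
  obtain ⟨φ, h⟩ := h.out
  exact ⟨.allN φ, fun a => forall_congr' fun x => h (a, x)⟩

instance {P : α → M.N → Prop} [h : Def M fun p : α × M.N => P p.1 p.2] :
    Def M fun a => ∃ x : M.N, P a x := by
  obtain ⟨φ, h⟩ := h.out
  exact ⟨.exN φ, fun a => exists_congr fun x => h (a, x)⟩

instance {P : α → M.F k → Prop} [h : Def M fun p : α × M.F k => P p.1 p.2] :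
    Def M fun a => ∀ x : M.F k, P a x := by
  obtain ⟨φ, h⟩ := h.out
  exact ⟨.allF k φ, fun a => forall_congr' fun x => h (a, x)⟩

instance {P : α → M.F k → Prop} [h : Def M fun p : α × M.F k => P p.1 p.2] :
    Def M fun a => ∃ x : M.F k, P a x := by
  obtain ⟨φ, h⟩ := h.out
  exact ⟨.exF k φ, fun a => exists_congr fun x => h (a, x)⟩

/-- The range is finite in the external sense, so the quantifier is a finite conjunction; a bound in
`M.N` could be nonstandard. -/
instance {n : ℕ} {P : α → Fin n → Prop} [h : ∀ i, Def M fun a => P a i] :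
    Def M fun a => ∀ i : Fin n, P a i := by
  induction n with
  | zero => simp only [IsEmpty.forall_iff]; infer_instance
  | succ n ih =>
    simp only [Fin.forall_fin_succ]
    have := ih (P := fun a i => P a i.succ)
    infer_instance

instance {n : ℕ} {P : α → Fin n → Prop} [h : ∀ i, Def M fun a => P a i] :
    Def M fun a => ∃ i : Fin n, P a i := by
  induction n with
  | zero => simp only [IsEmpty.exists_iff]; infer_instance
  | succ n ih =>
    simp only [Fin.exists_fin_succ]
    have := ih (P := fun a i => P a i.succ)
    infer_instance

instance {ι : Type} {l : List ι} {P : α → ι → Prop} [h : ∀ i, Def M fun a => P a i] :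
    Def M fun a => ∃ i ∈ l, P a i := by
  induction l with
  | nil => simp only [List.not_mem_nil, false_and, exists_false]; infer_instance
  | cons i l ih => simp only [List.exists_mem_cons_iff]; infer_instance

/-- For a predicate given only by a hypothesis, instance search sees no structure to descend into.
Substitution into its defining formula supplies definability at other arguments and in other
contexts. -/
theorem Def.comp₁ {P : M.N → Prop} (h : Def M fun p : Unit × M.N => P p.2) {f : α → M.N}
    (hf : DefN M f) : Def M fun a => P (f a) := by
  obtain ⟨φ, hφ⟩ := h.out
  obtain ⟨t, ht⟩ := hf.out
  refine ⟨φ.subst (consN t fun i => Ctx.upN M α (.var i)) (fun l i => Ctx.upF M α (.var l i)),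
    fun a => ?_⟩
  rw [Struct.sat_subst, ← hφ ((), f a)]
  refine iff_of_eq (congrArg₂ (fun σ τ => M.sat σ τ φ) ?_ ?_)
  · funext i
    cases i with
    | zero => exact ht a
    | succ i => exact Ctx.upN_eq a _
  · funext l i
    exact Ctx.upF_eq a _

theorem Def.comp₂ {P : M.N → M.N → Prop}
    (h : Def M fun p : (Unit × M.N) × M.N => P p.1.2 p.2) {f g : α → M.N}
    (hf : DefN M f) (hg : DefN M g) : Def M fun a => P (f a) (g a) := by
  obtain ⟨φ, hφ⟩ := h.out
  obtain ⟨t, ht⟩ := hf.out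
  obtain ⟨u, hu⟩ := hg.out
  refine ⟨φ.subst (consN u (consN t fun i => Ctx.upN M α (.var i)))
    (fun l i => Ctx.upF M α (.var l i)), fun a => ?_⟩
  rw [Struct.sat_subst, ← hφ (((), f a), g a)]
  refine iff_of_eq (congrArg₂ (fun σ τ => M.sat σ τ φ) ?_ ?_)
  · funext i
    rcases i with _ | _ | i
    · exact hu a
    · exact ht a
    · exact Ctx.upN_eq a _
  · funext l i
    exact Ctx.upF_eq a _

theorem Def.compF {P : M.F k → Prop} (h : Def M fun p : Unit × M.F k => P p.2) {f : α → M.F k}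
    (hf : DefF M f) : Def M fun a => P (f a) := by
  obtain ⟨φ, hφ⟩ := h.out
  obtain ⟨t, ht⟩ := hf.out
  refine ⟨φ.subst (fun i => Ctx.upN M α (.var i)) (consF t fun l i => Ctx.upF M α (.var l i)),
    fun a => ?_⟩
  rw [Struct.sat_subst, ← hφ ((), f a)]
  refine iff_of_eq (congrArg₂ (fun σ τ => M.sat σ τ φ) ?_ ?_)
  · funext i
    exact Ctx.upN_eq a _
  · funext l i
    show _ = Struct.pushF (f a) M.τ₀ l i
    by_cases e : l = k
    · subst e
      cases i with
      | zero => simpa [consF, Struct.pushF] using ht a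
      | succ i => simpa [consF, Struct.pushF, Struct.evF] using Ctx.upF_eq a (.var l i)
    · simpa [consF, Struct.pushF, e, Struct.evF] using Ctx.upF_eq a (.var l i)

/-! ## The axioms in a model -/

section

variable {r : ℕ} {s : Fin r → ℕ} (f : (j : Fin r) → M.F (s j))

/-- Axioms are assumed true at the fixed assignment only. Naming the arguments by terms turns
instances of the schemas into statements about arbitrary elements. -/
theorem exists_terms : ∃ t : (j : Fin r) → FT (s j), (fun j => M.evF M.τ₀ (t j)) = f := by
  choose t ht using fun j => M.namedF (f j)
  exact ⟨t, funext ht⟩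

theorem exists_numTerms {k : ℕ} (v : Fin k → M.N) :
    ∃ t : Fin k → NT, (fun j => M.evN M.σ₀ M.τ₀ (t j)) = v := by
  choose t ht using fun j => M.named (v j)
  exact ⟨t, funext ht⟩

theorem evN_vecCons {k : ℕ} (σ : ℕ → M.N) (τ : (k : ℕ) → ℕ → M.F k) (t : NT) (v : Fin k → NT) :
    (fun j => M.evN σ τ (Matrix.vecCons t v j)) =
      Matrix.vecCons (M.evN σ τ t) fun j => M.evN σ τ (v j) := by
  funext j
  refine Fin.cases rfl (fun j => rfl) j

theorem succ_inj {x y : M.N} (h : M.succ x = M.succ y) : x = y := by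
  obtain ⟨t, rfl⟩ := M.named x
  obtain ⟨u, rfl⟩ := M.named y
  exact M.holds (.succ_inj t u) h

theorem succ_ne_zero (x : M.N) : M.succ x ≠ M.zero := by
  obtain ⟨t, rfl⟩ := M.named x
  exact M.holds (.succ_ne_zero t)

/-- Induction for predicates that are definable with parameters. -/
theorem induct (P : M.N → Prop) [h : Def M fun p : Unit × M.N => P p.2] (h₀ : P M.zero)
    (h₁ : ∀ x, P x → P (M.succ x)) (x : M.N) : P x := by
  obtain ⟨φ, hφ⟩ := h.out
  have hφ' : ∀ x, M.sat (Struct.push x M.σ₀) M.τ₀ φ ↔ P x := fun x => hφ ((), x)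
  have e₀ : (fun i => M.evN M.σ₀ M.τ₀ (consN .zero NT.var i)) = Struct.push M.zero M.σ₀ := by
    funext i; cases i <;> rfl
  have := M.holds (.induction φ)
  simp only [Struct.sat, PF.instN_eq, Struct.sat_subst, e₀, Struct.evF, hφ'] at this
  refine this h₀ (fun x hx => ?_) x
  have e₁ : (fun i => M.evN (Struct.push x M.σ₀) M.τ₀
      (match i with | 0 => .succ (.var 0) | i + 1 => .var (i + 1))) =
      Struct.push (M.succ x) M.σ₀ := by
    funext i; cases i <;> rfl
  exact (congrArg (fun σ => M.sat σ M.τ₀ φ) e₁).mpr ((hφ' _).2 (h₁ x hx))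

theorem app_zero (v : Fin 0 → M.N) : M.app (M.prf .zero f) v = M.zero := by
  obtain ⟨t, rfl⟩ := exists_terms f
  obtain ⟨u, rfl⟩ := exists_numTerms v
  exact M.holds (.pr_zero t u)

theorem app_succ (v : Fin 1 → M.N) : M.app (M.prf .succ f) v = M.succ (v 0) := by
  obtain ⟨t, rfl⟩ := exists_terms f
  obtain ⟨u, rfl⟩ := exists_numTerms v
  exact M.holds (.pr_succ t u)

theorem app_proj {k : ℕ} (i : Fin k) (v : Fin k → M.N) : M.app (M.prf (.proj i) f) v = v i := by
  obtain ⟨t, rfl⟩ := exists_terms f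
  obtain ⟨u, rfl⟩ := exists_numTerms v
  exact M.holds (.pr_proj t i u)

theorem app_fn (j : Fin r) (v : Fin (s j) → M.N) :
    M.app (M.prf (.fn j) f) v = M.app (f j) v := by
  obtain ⟨t, rfl⟩ := exists_terms f
  obtain ⟨u, rfl⟩ := exists_numTerms v
  exact M.holds (.pr_fn t j u)

theorem app_comp {m k : ℕ} (g : PR s m) (h : Fin m → PR s k) (v : Fin k → M.N) :
    M.app (M.prf (.comp g h) f) v = M.app (M.prf g f) fun i => M.app (M.prf (h i) f) v := by
  obtain ⟨t, rfl⟩ := exists_terms f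
  obtain ⟨u, rfl⟩ := exists_numTerms v
  exact M.holds (.pr_comp t g h u)

theorem app_prec_zero {k : ℕ} (g : PR s k) (h : PR s (k + 2)) (v : Fin k → M.N) :
    M.app (M.prf (.prec g h) f) (Matrix.vecCons M.zero v) = M.app (M.prf g f) v := by
  obtain ⟨t, rfl⟩ := exists_terms f
  obtain ⟨u, rfl⟩ := exists_numTerms v
  have := M.holds (.pr_prec_zero t g h u)
  simpa only [Struct.sat, Struct.evN, evN_vecCons, Struct.evF] using this

theorem app_prec_succ {k : ℕ} (g : PR s k) (h : PR s (k + 2)) (x : M.N) (v : Fin k → M.N) :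
    M.app (M.prf (.prec g h) f) (Matrix.vecCons (M.succ x) v) =
      M.app (M.prf h f) (Matrix.vecCons x
        (Matrix.vecCons (M.app (M.prf (.prec g h) f) (Matrix.vecCons x v)) v)) := by
  obtain ⟨t, rfl⟩ := exists_terms f
  obtain ⟨u, rfl⟩ := exists_numTerms v
  obtain ⟨x, rfl⟩ := M.named x
  have := M.holds (.pr_prec_succ t g h x u)
  simpa only [Struct.sat, Struct.evN, evN_vecCons, Struct.evF] using this

theorem app_comp₁ {k : ℕ} (g : PR s 1) (h : PR s k) (v : Fin k → M.N) :
    M.app (M.prf (.comp g ![h]) f) v = M.app (M.prf g f) ![M.app (M.prf h f) v] := by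
  rw [app_comp]
  congr 1
  funext i; fin_cases i; rfl

theorem app_comp₂ {k : ℕ} (g : PR s 2) (h h' : PR s k) (v : Fin k → M.N) :
    M.app (M.prf (.comp g ![h, h']) f) v =
      M.app (M.prf g f) ![M.app (M.prf h f) v, M.app (M.prf h' f) v] := by
  rw [app_comp]
  congr 1
  funext i; fin_cases i <;> rfl

theorem app_comp₃ {k : ℕ} (g : PR s 3) (h h' h'' : PR s k) (v : Fin k → M.N) :
    M.app (M.prf (.comp g ![h, h', h'']) f) v =
      M.app (M.prf g f) ![M.app (M.prf h f) v, M.app (M.prf h' f) v, M.app (M.prf h'' f) v] := by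
  rw [app_comp]
  congr 1
  funext i; fin_cases i <;> rfl

end

/-- Functions given by a number term with parameters exist. -/
theorem exists_fun (g : M.N → M.N) [h : DefN M fun p : Unit × M.N => g p.2] :
    ∃ f : M.F 1, ∀ x, M.app f ![x] = g x := by
  obtain ⟨t, ht⟩ := h.out
  have := M.holds (.explicit 1 t)
  obtain ⟨f, hf⟩ := this
  refine ⟨f, fun x => ?_⟩
  have := hf x
  simp only [Struct.sat, Struct.evN, Struct.evF, Struct.evN_upF] at this
  refine Eq.trans ?_ (this.trans (ht ((), x)))
  have e : ![x] = fun j : Fin 1 => Struct.push x M.σ₀ j := by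
    funext j; obtain rfl := Subsingleton.elim j 0; rfl
  rw [e]
  simp [Struct.pushF]

end Model
end IntrinsicTheory

namespace IntrinsicTheory
namespace Model

/-! ## Arithmetic in a model -/

variable {M : Model} {α : Type} [Ctx M α] {r : ℕ} {s : Fin r → ℕ} (f : (j : Fin r) → M.F (s j))

/-- The value of a primitive recursive function. -/
def pr (M : Model) {k : ℕ} (c : PR (Fin.elim0 : Fin 0 → ℕ) k) (v : Fin k → M.N) : M.N :=
  M.app (M.prf c fun j => j.elim0) v

theorem evN_pr {k : ℕ} (σ : ℕ → M.N) (τ : (k : ℕ) → ℕ → M.F k)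
    (c : PR (Fin.elim0 : Fin 0 → ℕ) k) (v : Fin k → NT) :
    M.evN σ τ (NT.pr c v) = M.pr c fun j => M.evN σ τ (v j) := by
  simp only [NT.pr, Struct.evN, Struct.evF, pr]
  congr 2
  funext j; exact j.elim0

instance : Zero M.N := ⟨M.zero⟩
instance : One M.N := ⟨M.succ M.zero⟩
instance : Add M.N := ⟨fun x y => M.pr .add ![x, y]⟩
instance : Sub M.N := ⟨fun x y => M.pr .sub ![x, y]⟩

instance {x y : α → M.N} [DefN M x] [DefN M y] : DefN M fun a => x a + y a :=
  inferInstanceAs (DefN M fun a => M.app _ ![x a, y a])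

theorem zero_def : M.zero = 0 := rfl

theorem app_add_zero (y : M.N) : M.app (M.prf .add f) ![0, y] = y := by
  simp [← zero_def, PR.add, app_prec_zero, app_proj]

theorem app_add_succ (x y : M.N) :
    M.app (M.prf .add f) ![M.succ x, y] = M.succ (M.app (M.prf .add f) ![x, y]) := by
  simp [PR.add, app_prec_succ, app_proj, app_comp₁, app_succ]

/-- The same identifier may be applied with or without function arguments `f`, giving different
function terms; the agreement of their values is itself a fact proved by induction. It is needed
because `PR.graft` uses arithmetic in the presence of function arguments. -/
theorem app_add (x y : M.N) : M.app (M.prf .add f) ![x, y] = x + y := by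
  refine M.induct (P := fun x => M.app (M.prf .add f) ![x, y] = x + y) ?_ ?_ x
  · exact (app_add_zero f y).trans (app_add_zero _ y).symm
  · intro x ih
    rw [app_add_succ, ih]
    exact (app_add_succ _ x y).symm

theorem zero_add' (x : M.N) : 0 + x = x := app_add_zero _ x

theorem succ_add (x y : M.N) : M.succ x + y = M.succ (x + y) := app_add_succ _ x y

theorem succ_eq' (x : M.N) : M.succ x = 1 + x := by
  show _ = M.succ 0 + x
  rw [succ_add, zero_add']

theorem add_zero' (x : M.N) : x + 0 = x := by
  refine M.induct (P := fun x => x + 0 = x) (zero_add' _) (fun x ih => ?_) x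
  rw [succ_add, ih]

theorem add_succ (x y : M.N) : x + M.succ y = M.succ (x + y) := by
  refine M.induct (P := fun x => x + M.succ y = M.succ (x + y)) ?_ (fun x ih => ?_) x
  · rw [zero_def, zero_add', zero_add']
  · rw [succ_add, ih, succ_add]

/-- With the order and truncated subtraction below, this makes the numbers of `M` a canonically
ordered cancellative monoid, so that general lemmas apply to a possibly nonstandard model.
Multiplication is never needed: triangular numbers have their own recursion. -/
instance : AddCommMonoid M.N where
  zero_add := zero_add'
  add_zero := add_zero'
  add_comm x y := by
    refine M.induct (P := fun x => x + y = y + x) ?_ (fun x ih => ?_) x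
    · rw [zero_def, zero_add', add_zero']
    · rw [succ_add, ih, add_succ]
  add_assoc x y z := by
    refine M.induct (P := fun x => x + y + z = x + (y + z)) ?_ (fun x ih => ?_) x
    · rw [zero_def, zero_add', zero_add']
    · rw [succ_add, succ_add, ih, succ_add]
  nsmul := nsmulRec

theorem succ_eq (x : M.N) : M.succ x = x + 1 := by rw [succ_eq', add_comm]

theorem induction_on {P : M.N → Prop} (x : M.N) [h : Def M fun p : Unit × M.N => P p.2] (h₀ : P 0)
    (h₁ : ∀ x, P x → P (x + 1)) : P x :=
  M.induct P h₀ (fun x hx => succ_eq x ▸ h₁ x hx) x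

theorem add_one_ne_zero (x : M.N) : x + 1 ≠ 0 := succ_eq x ▸ succ_ne_zero x

theorem add_one_inj {x y : M.N} (h : x + 1 = y + 1) : x = y := by
  rw [← succ_eq, ← succ_eq] at h
  exact succ_inj h

theorem eq_zero_or_succ (x : M.N) : x = 0 ∨ ∃ y, x = y + 1 := by
  refine induction_on (P := fun x => x = 0 ∨ ∃ y, x = y + 1) x (.inl rfl) fun x _ => .inr ⟨x, rfl⟩

theorem add_right_cancel' {x y z : M.N} (h : x + z = y + z) : x = y := by
  revert h
  refine induction_on (P := fun z => x + z = y + z → x = y) z (by simp) fun z ih h => ih ?_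
  rw [← add_assoc, ← add_assoc] at h
  exact add_one_inj h

instance : IsCancelAdd M.N where
  add_right_cancel _ _ _ h := add_right_cancel' h
  add_left_cancel x y z h := add_right_cancel' (z := x) (by simpa [add_comm _ x] using h)

theorem add_eq_zero' {x y : M.N} (h : x + y = 0) : y = 0 := by
  rcases eq_zero_or_succ y with rfl | ⟨y, rfl⟩
  · rfl
  · rw [← add_assoc] at h
    exact (add_one_ne_zero _ h).elim

theorem le_total' (x y : M.N) : (∃ z, y = x + z) ∨ ∃ z, x = y + z := by
  refine induction_on (P := fun x => (∃ z, y = x + z) ∨ ∃ z, x = y + z) x (.inl ⟨y, by simp⟩) ?_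
  rintro x (⟨z, rfl⟩ | ⟨z, rfl⟩)
  · rcases eq_zero_or_succ z with rfl | ⟨z, rfl⟩
    · exact .inr ⟨1, by simp⟩
    · exact .inl ⟨z, by rw [add_assoc, add_comm 1]⟩
  · exact .inr ⟨z + 1, by rw [add_assoc]⟩

open Classical in
noncomputable instance : LinearOrder M.N where
  le x y := ∃ z, y = x + z
  le_refl x := ⟨0, by simp⟩
  le_trans := by
    rintro x _ _ ⟨u, rfl⟩ ⟨v, rfl⟩
    exact ⟨u + v, by rw [add_assoc]⟩
  le_antisymm := by
    rintro x y ⟨u, rfl⟩ ⟨v, h⟩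
    rw [add_assoc] at h
    have : u + v = 0 := add_left_cancel (a := x) (by rw [← h, add_zero])
    rw [add_comm] at this
    rw [add_eq_zero' this, add_zero]
  le_total := le_total'
  toDecidableLE := Classical.decRel _

theorem le_def {x y : M.N} : x ≤ y ↔ ∃ z, y = x + z := Iff.rfl

instance : IsOrderedCancelAddMonoid M.N where
  add_le_add_left := by
    rintro x _ ⟨z, rfl⟩ y
    exact ⟨z, by rw [add_right_comm]⟩
  le_of_add_le_add_left := by
    rintro x y z ⟨w, h⟩
    exact ⟨w, add_left_cancel (a := x) (by rw [h, add_assoc])⟩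

instance : CanonicallyOrderedAdd M.N where
  exists_add_of_le h := h
  le_add_self _ y := ⟨y, add_comm _ _⟩
  le_self_add _ y := ⟨y, rfl⟩

instance {x y : α → M.N} [DefN M x] [DefN M y] : Def M fun a => x a ≤ y a := by
  have := DefN.up (β := M.N) (f := x)
  have := DefN.up (β := M.N) (f := y)
  simp only [le_def]; infer_instance

instance {x y : α → M.N} [DefN M x] [DefN M y] : Def M fun a => x a < y a := by
  simp only [← not_le]; infer_instance

theorem lt_iff {x y : M.N} : x < y ↔ x + 1 ≤ y := by
  constructor
  · intro h
    obtain ⟨z, rfl⟩ := h.le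
    rcases eq_zero_or_succ z with rfl | ⟨z, rfl⟩
    · simp at h
    · exact ⟨z, by rw [add_assoc, add_comm 1]⟩
  · rintro ⟨z, rfl⟩
    refine lt_of_le_of_ne ⟨1 + z, by rw [add_assoc]⟩ fun h => ?_
    rw [add_assoc] at h
    have : 1 + z = 0 := add_left_cancel (a := x) (by rw [← h, add_zero])
    exact add_one_ne_zero z (by rw [add_comm, this])

theorem lt_succ_iff {x y : M.N} : x < y + 1 ↔ x ≤ y := by
  rw [lt_iff, add_le_add_iff_right]

theorem strong_induction {P : M.N → Prop} (x : M.N) [h : Def M fun p : Unit × M.N => P p.2]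
    (h₁ : ∀ x, (∀ y < x, P y) → P x) : P x := by
  have : ∀ y < x + 1, P y := by
    have : Def M fun p : (Unit × M.N) × M.N => P p.2 := h.comp₁ inferInstance
    refine induction_on (P := fun x => ∀ y < x + 1, P y) x ?_ fun x ih y hy => ?_
    · intro y hy
      refine h₁ y fun z hz => ?_
      rw [lt_succ_iff] at hy
      exact absurd (hz.trans_le hy) (by simp)
    · exact h₁ y fun z hz => ih z (hz.trans_le (lt_succ_iff.1 hy))
  exact this x (lt_succ_iff.2 le_rfl)

theorem app_pred_zero : M.app (M.prf .pred f) ![0] = 0 := by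
  simp [← zero_def, PR.pred, app_prec_zero, app_zero]

theorem app_pred_succ (x : M.N) : M.app (M.prf .pred f) ![x + 1] = x := by
  simp [← succ_eq, PR.pred, app_prec_succ, app_proj]

theorem app_sub_zero (x : M.N) : M.app (M.prf .sub f) ![x, 0] = x := by
  simp [← zero_def, PR.sub, PR.rsub, app_comp₂, app_prec_zero, app_proj]

theorem app_sub_succ (x y : M.N) : M.app (M.prf .sub f) ![x, y + 1] =
    M.app (M.prf .pred f) ![M.app (M.prf .sub f) ![x, y]] := by
  simp [← succ_eq, PR.sub, PR.rsub, app_comp₂, app_comp₁, app_prec_succ, app_proj]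

theorem app_sub_add (x y : M.N) : M.app (M.prf .sub f) ![x + y, y] = x := by
  refine induction_on (P := fun y => ∀ x, M.app (M.prf .sub f) ![x + y, y] = x) y ?_ ?_ x
  · intro x
    rw [app_sub_zero, add_zero]
  · intro y ih x
    rw [app_sub_succ, show x + (y + 1) = x + 1 + y by rw [add_right_comm, add_assoc], ih,
      app_pred_succ]

theorem app_sub_of_le (x y : M.N) : M.app (M.prf .sub f) ![x, x + y] = 0 := by
  refine induction_on (P := fun y => M.app (M.prf .sub f) ![x, x + y] = 0) y ?_ ?_
  · have := app_sub_add f 0 x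
    rw [zero_add] at this
    rw [add_zero, this]
  · intro y ih
    rw [← add_assoc, app_sub_succ, ih, app_pred_zero]

theorem app_sub (x y : M.N) : M.app (M.prf .sub f) ![x, y] = x - y := by
  rcases le_total x y with ⟨z, rfl⟩ | ⟨z, rfl⟩
  · exact (app_sub_of_le f x z).trans (app_sub_of_le _ x z).symm
  · rw [add_comm]
    exact (app_sub_add f _ _).trans (app_sub_add _ _ _).symm

instance : OrderedSub M.N where
  tsub_le_iff_right x y z := by
    rcases le_total x y with ⟨w, rfl⟩ | ⟨w, rfl⟩
    · have : x - (x + w) = 0 := app_sub_of_le _ x w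
      rw [this]
      exact ⟨fun _ => le_add_left (le_add_right le_rfl), fun _ => zero_le⟩
    · have : y + w - y = w := by rw [add_comm]; exact app_sub_add _ w y
      rw [this, add_comm, add_le_add_iff_right]

theorem app_pred (x : M.N) : M.app (M.prf .pred f) ![x] = x - 1 := by
  rcases eq_zero_or_succ x with rfl | ⟨x, rfl⟩
  · rw [app_pred_zero, zero_tsub]
  · rw [app_pred_succ, add_tsub_cancel_right]

theorem app_cond_zero (u v : M.N) : M.app (M.prf .cond f) ![0, u, v] = u := by
  simp [← zero_def, PR.cond, app_prec_zero, app_proj]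

theorem app_cond_succ (x u v : M.N) : M.app (M.prf .cond f) ![x + 1, u, v] = v := by
  simp [← succ_eq, PR.cond, app_prec_succ, app_proj]

open Classical in
theorem app_cond (x u v : M.N) :
    M.app (M.prf .cond f) ![x, u, v] = if x = 0 then u else v := by
  rcases eq_zero_or_succ x with rfl | ⟨x, rfl⟩
  · rw [app_cond_zero, if_pos rfl]
  · rw [app_cond_succ, if_neg (add_one_ne_zero x)]

/-! ### Pairing -/

def tri (x : M.N) : M.N := M.pr .tri ![x]
def root (x : M.N) : M.N := M.pr .root ![x]
def lft (x : M.N) : M.N := M.pr .lft ![x]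
def rgt (x : M.N) : M.N := M.pr .rgt ![x]
def pair (x y : M.N) : M.N := M.pr .pair ![x, y]

instance {x : α → M.N} [DefN M x] : DefN M fun a => tri (x a) :=
  inferInstanceAs (DefN M fun a => M.app _ ![x a])

theorem app_tri_zero : M.app (M.prf .tri f) ![0] = 0 := by
  simp [← zero_def, PR.tri, app_prec_zero, app_zero]

theorem app_tri_succ (x : M.N) :
    M.app (M.prf .tri f) ![x + 1] = M.app (M.prf .tri f) ![x] + (x + 1) := by
  simp [← succ_eq, PR.tri, app_prec_succ, app_comp₂, app_comp₁, app_proj, app_succ, app_add]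

theorem tri_zero : tri (0 : M.N) = 0 := app_tri_zero _
theorem tri_succ (x : M.N) : tri (x + 1) = tri x + (x + 1) := app_tri_succ _ x

theorem app_tri (x : M.N) : M.app (M.prf .tri f) ![x] = tri x := by
  refine induction_on (P := fun x => M.app (M.prf .tri f) ![x] = tri x) x ?_ fun x ih => ?_
  · rw [app_tri_zero, tri_zero]
  · rw [app_tri_succ, tri_succ, ih]

theorem tri_mono {x y : M.N} (h : x ≤ y) : tri x ≤ tri y := by
  obtain ⟨z, rfl⟩ := h
  refine induction_on (P := fun z => tri x ≤ tri (x + z)) z (by simp) fun z ih => ?_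
  rw [← add_assoc, tri_succ]
  exact ih.trans (le_add_right le_rfl)

theorem app_root_zero : M.app (M.prf .root f) ![0] = 0 := by
  simp [← zero_def, PR.root, app_prec_zero, app_zero]

open Classical in
theorem app_root_succ (x : M.N) : M.app (M.prf .root f) ![x + 1] =
    if tri (M.app (M.prf .root f) ![x] + 1) ≤ x + 1 then M.app (M.prf .root f) ![x] + 1
    else M.app (M.prf .root f) ![x] := by
  rw [← succ_eq]
  simp [PR.root, app_prec_succ, app_comp₃, app_comp₂, app_comp₁, app_proj, app_succ, app_sub,
    app_cond, app_tri]
  simp only [succ_eq, tsub_eq_zero_iff_le]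

/-- Invariant of the recursion. One increment suffices at each step, because consecutive triangular
numbers from `tri (w + 1)` to `tri (w + 2)` are at least one apart. -/
theorem app_root_spec (x : M.N) : tri (M.app (M.prf .root f) ![x]) ≤ x ∧
    x < tri (M.app (M.prf .root f) ![x] + 1) := by
  refine induction_on (P := fun x => tri (M.app (M.prf .root f) ![x]) ≤ x ∧
    x < tri (M.app (M.prf .root f) ![x] + 1)) x ?_ ?_
  · rw [app_root_zero, tri_succ, tri_zero]
    exact ⟨le_rfl, by rw [lt_iff, zero_add, zero_add]⟩
  · intro x ih
    rw [app_root_succ]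
    split_ifs with h
    · refine ⟨h, ?_⟩
      rw [tri_succ]
      rw [lt_iff] at ih ⊢
      refine add_le_add ih.2 (le_add_left le_rfl)
    · exact ⟨ih.1.trans (le_add_right le_rfl), not_le.1 h⟩

theorem root_unique {x u v : M.N} (hu : tri u ≤ x) (hu' : x < tri (u + 1)) (hv : tri v ≤ x)
    (hv' : x < tri (v + 1)) : u = v := by
  rcases lt_trichotomy u v with h | h | h
  · exact absurd (hu'.trans_le ((tri_mono (lt_iff.1 h)).trans hv)) (lt_irrefl _)
  · exact h
  · exact absurd (hv'.trans_le ((tri_mono (lt_iff.1 h)).trans hu)) (lt_irrefl _)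

theorem app_root (x : M.N) : M.app (M.prf .root f) ![x] = root x :=
  root_unique (app_root_spec f x).1 (app_root_spec f x).2 (app_root_spec _ x).1
    (app_root_spec _ x).2

theorem app_rgt (x : M.N) : M.app (M.prf .rgt f) ![x] = x - tri (root x) := by
  simp [PR.rgt, app_comp₂, app_comp₁, app_proj, app_sub, app_tri, app_root]

theorem app_lft (x : M.N) : M.app (M.prf .lft f) ![x] = root x - (x - tri (root x)) := by
  simp [PR.lft, app_comp₂, app_sub, app_root, app_rgt]

theorem app_pair (x y : M.N) : M.app (M.prf .pair f) ![x, y] = tri (x + y) + y := by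
  simp [PR.pair, app_comp₂, app_comp₁, app_proj, app_add, app_tri]

theorem pair_def (x y : M.N) : pair x y = tri (x + y) + y := app_pair _ x y
theorem lft_def (x : M.N) : lft x = root x - (x - tri (root x)) := app_lft _ x
theorem rgt_def (x : M.N) : rgt x = x - tri (root x) := app_rgt _ x

theorem root_pair (x y : M.N) : root (pair x y) = x + y := by
  refine root_unique (app_root_spec _ _).1 (app_root_spec _ _).2 ?_ ?_
  · rw [pair_def]; exact le_add_right le_rfl
  · rw [pair_def, tri_succ, add_lt_add_iff_left, lt_succ_iff]; exact le_add_left le_rfl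

theorem rgt_pair (x y : M.N) : rgt (pair x y) = y := by
  rw [rgt_def, root_pair, pair_def, add_tsub_cancel_left]

theorem lft_pair (x y : M.N) : lft (pair x y) = x := by
  rw [lft_def, ← rgt_def, rgt_pair, root_pair, add_tsub_cancel_right]

/-- Every number lies in the block from `tri w` up to `tri (w + 1)` for its root `w`, with a
remainder of at most `w`. Surjectivity of pairing is what makes every number the code of a sequence.
-/
theorem pair_eta (x : M.N) : pair (lft x) (rgt x) = x := by
  have h := app_root_spec (M := M) (s := Fin.elim0) (fun j => j.elim0) x
  rw [app_root, tri_succ, lt_iff, ← add_assoc, add_le_add_iff_right, add_comm,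
    ← tsub_le_iff_right] at h
  rw [pair_def, lft_def, ← rgt_def, tsub_add_cancel_of_le (by rw [rgt_def]; exact h.2), rgt_def,
    add_tsub_cancel_of_le h.1]

theorem le_pair_right (x y : M.N) : y ≤ pair x y := by
  rw [pair_def]; exact le_add_left le_rfl

theorem pair_mono {x y x' y' : M.N} (h : x ≤ x') (h' : y ≤ y') : pair x y ≤ pair x' y' := by
  rw [pair_def, pair_def]
  exact add_le_add (tri_mono (add_le_add h h')) h'

end Model
end IntrinsicTheory

namespace IntrinsicTheory
namespace Model

/-! ### Finite sequences -/

variable {M : Model} {α : Type} [Ctx M α]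

def hd (x : M.N) : M.N := lft (x - 1)
def tl (x : M.N) : M.N := rgt (x - 1)
def cons (x y : M.N) : M.N := M.pr .cons ![x, y]
def drop (x y : M.N) : M.N := M.pr .drop ![x, y]
def look (x y : M.N) : M.N := M.pr .look ![x, y]
def lenAux (x y : M.N) : M.N := M.pr .lenAux ![x, y]
def len (x : M.N) : M.N := M.pr .len ![x]
def appendAux (x y z : M.N) : M.N := M.pr .appendAux ![x, y, z]
def append (x y : M.N) : M.N := M.pr .append ![x, y]
def rep (c : ℕ) (x : M.N) : M.N := M.pr (.rep c) ![x]

instance {x y : α → M.N} [DefN M x] [DefN M y] : DefN M fun a => cons (x a) (y a) :=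
  inferInstanceAs (DefN M fun a => M.app _ ![x a, y a])
instance {x y : α → M.N} [DefN M x] [DefN M y] : DefN M fun a => drop (x a) (y a) :=
  inferInstanceAs (DefN M fun a => M.app _ ![x a, y a])
instance {x y : α → M.N} [DefN M x] [DefN M y] : DefN M fun a => look (x a) (y a) :=
  inferInstanceAs (DefN M fun a => M.app _ ![x a, y a])
instance {x y : α → M.N} [DefN M x] [DefN M y] : DefN M fun a => lenAux (x a) (y a) :=
  inferInstanceAs (DefN M fun a => M.app _ ![x a, y a])
instance {x : α → M.N} [DefN M x] : DefN M fun a => len (x a) :=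
  inferInstanceAs (DefN M fun a => M.app _ ![x a])
instance {x y z : α → M.N} [DefN M x] [DefN M y] [DefN M z] :
    DefN M fun a => appendAux (x a) (y a) (z a) :=
  inferInstanceAs (DefN M fun a => M.app _ ![x a, y a, z a])
instance {x y : α → M.N} [DefN M x] [DefN M y] : DefN M fun a => append (x a) (y a) :=
  inferInstanceAs (DefN M fun a => M.app _ ![x a, y a])
instance {x : α → M.N} {c : ℕ} [DefN M x] : DefN M fun a => rep c (x a) :=
  inferInstanceAs (DefN M fun a => M.app _ ![x a])

/-- Numerals. -/
def num (M : Model) : ℕ → M.N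
  | 0 => 0
  | n + 1 => M.num n + 1

theorem num_inj {m n : ℕ} (h : M.num m = M.num n) : m = n := by
  induction m generalizing n with
  | zero =>
    cases n with
    | zero => rfl
    | succ n => exact (add_one_ne_zero _ h.symm).elim
  | succ m ih =>
    cases n with
    | zero => exact (add_one_ne_zero _ h).elim
    | succ n => rw [ih (add_one_inj h)]

theorem num_mono {m n : ℕ} (h : m ≤ n) : M.num m ≤ M.num n := by
  induction h with
  | refl => exact le_rfl
  | step _ ih => exact ih.trans (le_add_right le_rfl)

theorem evN_num (σ : ℕ → M.N) (τ : (k : ℕ) → ℕ → M.F k) (n : ℕ) :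
    M.evN σ τ (NT.num n) = M.num n := by
  induction n with
  | zero => rfl
  | succ n ih => exact (congrArg M.succ ih).trans (succ_eq _)

theorem app_const {r : ℕ} {s : Fin r → ℕ} (f : (j : Fin r) → M.F (s j)) {k : ℕ} (n : ℕ)
    (v : Fin k → M.N) : M.app (M.prf (.const n) f) v = M.num n := by
  induction n with
  | zero => rw [PR.const, app_comp, app_zero]; rfl
  | succ n ih => rw [PR.const, app_comp₁, ih, app_succ]; exact succ_eq _

theorem cons_def (x y : M.N) : cons x y = pair x y + 1 := by
  simp [cons, pr, PR.cons, app_comp₁, app_succ, succ_eq, pair]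

theorem hd_cons (x y : M.N) : hd (cons x y) = x := by
  rw [hd, cons_def, add_tsub_cancel_right, lft_pair]

theorem tl_cons (x y : M.N) : tl (cons x y) = y := by
  rw [tl, cons_def, add_tsub_cancel_right, rgt_pair]

theorem cons_inj {x y x' y' : M.N} : cons x y = cons x' y' ↔ x = x' ∧ y = y' := by
  refine ⟨fun h => ⟨?_, ?_⟩, by rintro ⟨rfl, rfl⟩; rfl⟩
  · rw [← hd_cons x y, h, hd_cons]
  · rw [← tl_cons x y, h, tl_cons]

theorem cons_ne_zero (x y : M.N) : cons x y ≠ 0 := cons_def x y ▸ add_one_ne_zero _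

theorem eq_zero_or_cons (x : M.N) : x = 0 ∨ ∃ i y, x = cons i y := by
  rcases eq_zero_or_succ x with h | ⟨y, rfl⟩
  · exact .inl h
  · exact .inr ⟨lft y, rgt y, by rw [cons_def, pair_eta]⟩

theorem lt_cons (x y : M.N) : y < cons x y := by
  rw [cons_def, lt_succ_iff]; exact le_pair_right x y

theorem cons_mono {x y x' y' : M.N} (h : x ≤ x') (h' : y ≤ y') : cons x y ≤ cons x' y' := by
  rw [cons_def, cons_def]; exact add_le_add_left (pair_mono h h') 1

theorem cons_strictMono {x y y' : M.N} (h : y < y') : cons x y < cons x y' := by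
  rw [cons_def, cons_def, add_lt_add_iff_right, pair_def, pair_def]
  exact add_lt_add_of_le_of_lt (tri_mono (add_le_add_right h.le x)) h

theorem seq_induction {P : M.N → Prop} (x : M.N) [h : Def M fun p : Unit × M.N => P p.2]
    (h₀ : P 0) (h₁ : ∀ i x, P x → P (cons i x)) : P x := by
  refine strong_induction x fun x ih => ?_
  rcases eq_zero_or_cons x with rfl | ⟨i, y, rfl⟩
  · exact h₀
  · exact h₁ i y (ih y (lt_cons i y))

theorem root_zero : root (0 : M.N) = 0 := app_root_zero _

theorem hd_zero : hd (0 : M.N) = 0 := by rw [hd, zero_tsub, lft_def, root_zero, zero_tsub]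

theorem tl_zero : tl (0 : M.N) = 0 := by rw [tl, zero_tsub, rgt_def, zero_tsub]

theorem drop_zero (x : M.N) : drop 0 x = x := by
  simp [drop, pr, ← zero_def, PR.drop, app_prec_zero, app_proj]

theorem drop_succ (n x : M.N) : drop (n + 1) x = tl (drop n x) := by
  rw [← succ_eq]
  simp only [drop, pr, PR.drop, app_prec_succ, app_comp₁, app_proj, PR.tl, app_rgt, tl, rgt_def,
    app_pred, Matrix.cons_val_zero, Matrix.cons_val_one]

theorem drop_succ' (n x : M.N) : drop (n + 1) x = drop n (tl x) := by
  refine induction_on (P := fun n => drop (n + 1) x = drop n (tl x)) n ?_ fun n ih => ?_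
  · rw [drop_succ, drop_zero, drop_zero]
  · rw [drop_succ, ih, ← drop_succ]

theorem drop_nil (n : M.N) : drop n 0 = 0 := by
  refine induction_on (P := fun n => drop n (0 : M.N) = 0) n (drop_zero _) fun n ih => ?_
  rw [drop_succ, ih, tl_zero]

theorem drop_cons (n i x : M.N) : drop (n + 1) (cons i x) = drop n x := by
  rw [drop_succ', tl_cons]

/-- The code of a sequence bounds its length, because each `cons` strictly increases the code.
Consequently `look d e` is the default `0`, meaning undecorated, whenever `e` is not less than `d`.
-/
theorem drop_of_le (x n : M.N) (h : x ≤ n) : drop n x = 0 := by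
  revert h
  refine seq_induction (P := fun x => ∀ n, x ≤ n → drop n x = 0) x (fun n _ => drop_nil n)
    (fun i x ih n h => ?_) n
  rcases eq_zero_or_succ n with rfl | ⟨n, rfl⟩
  · exact absurd ((lt_cons i x).trans_le h) (by simp)
  · rw [drop_cons]
    exact ih n (lt_succ_iff.1 ((lt_cons i x).trans_le h))

theorem look_def (d e : M.N) : look d e = hd (drop e d) := by
  simp only [look, pr, PR.look, app_comp₁, app_comp₂, app_proj, PR.hd, app_lft, app_pred, hd,
    lft_def, drop, Matrix.cons_val_zero, Matrix.cons_val_one]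

theorem look_cons_zero (i x : M.N) : look (cons i x) 0 = i := by
  rw [look_def, drop_zero, hd_cons]

theorem look_cons_succ (i x e : M.N) : look (cons i x) (e + 1) = look x e := by
  rw [look_def, drop_cons, look_def]

theorem look_of_le {d e : M.N} (h : d ≤ e) : look d e = 0 := by
  rw [look_def, drop_of_le _ _ h, hd_zero]

theorem lt_of_look_ne_zero {d e : M.N} (h : look d e ≠ 0) : e < d :=
  lt_of_not_ge fun h' => h (look_of_le h')

theorem lenAux_zero (x : M.N) : lenAux 0 x = 0 := by
  simp only [lenAux, pr, ← zero_def, PR.lenAux, app_prec_zero, app_const]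
  rfl

open Classical in
theorem lenAux_succ (n x : M.N) :
    lenAux (n + 1) x = if drop n x = 0 then lenAux n x else lenAux n x + 1 := by
  rw [← succ_eq]
  simp only [lenAux, pr, PR.lenAux, app_prec_succ, app_comp₁, app_comp₂, app_comp₃, app_proj,
    app_cond, app_succ, drop, Matrix.cons_val_zero, Matrix.cons_val_one, Matrix.cons_val]
  simp only [succ_eq]
  split_ifs with h <;> simp only [h, if_true, if_false]

theorem lenAux_cons (n i x : M.N) : lenAux (n + 1) (cons i x) = lenAux n x + 1 := by
  refine induction_on (P := fun n => lenAux (n + 1) (cons i x) = lenAux n x + 1) n ?_ fun n ih => ?_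
  · rw [lenAux_succ, drop_zero, if_neg (cons_ne_zero i x), lenAux_zero, lenAux_zero]
  · rw [lenAux_succ, ih, drop_cons, lenAux_succ]
    split_ifs <;> rfl

theorem lenAux_add (x n : M.N) : lenAux (x + n) x = lenAux x x := by
  refine induction_on (P := fun n => lenAux (x + n) x = lenAux x x) n (by rw [add_zero])
    fun n ih => ?_
  rw [← add_assoc, lenAux_succ, if_pos (drop_of_le _ _ (le_add_right le_rfl)), ih]

theorem len_def (x : M.N) : len x = lenAux x x := by
  simp only [len, pr, PR.len, app_comp₂, app_proj, lenAux, Matrix.cons_val_zero]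

theorem len_zero : len (0 : M.N) = 0 := by rw [len_def, lenAux_zero]

theorem len_cons (i x : M.N) : len (cons i x) = len x + 1 := by
  rw [len_def]
  -- Removing the first entry leaves a count up to `pair i x` for the sequence `x`; this number is
  -- `x + n`, and counting past `x` adds nothing.
  obtain ⟨n, hn⟩ := le_pair_right i x
  conv_lhs => rw [cons_def, ← cons_def, show cons i x = pair i x + 1 from cons_def i x]
  rw [← cons_def, show lenAux (cons i x) (cons i x) = lenAux (pair i x + 1) (cons i x) by
    rw [← cons_def], lenAux_cons, hn, lenAux_add, len_def]

theorem appendAux_zero (x y : M.N) : appendAux 0 x y = y := by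
  simp [appendAux, pr, ← zero_def, PR.appendAux, app_prec_zero, app_proj]

theorem appendAux_succ (n x y : M.N) :
    appendAux (n + 1) x y = cons (look x (len x - (n + 1))) (appendAux n x y) := by
  rw [← succ_eq]
  simp only [appendAux, pr, PR.appendAux, app_prec_succ, app_comp₁, app_comp₂, app_proj, app_sub,
    app_succ, cons, look, len, Matrix.cons_val_zero, Matrix.cons_val_one, Matrix.cons_val]

theorem append_def (x y : M.N) : append x y = appendAux (len x) x y := by
  simp only [append, pr, PR.append, app_comp₁, app_comp₃, app_proj, appendAux, len,
    Matrix.cons_val_zero, Matrix.cons_val_one]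

theorem appendAux_cons (i x y n : M.N) (h : n ≤ len x) :
    appendAux n (cons i x) y = appendAux n x y := by
  revert h
  refine induction_on (P := fun n => n ≤ len x → appendAux n (cons i x) y = appendAux n x y) n
    (fun _ => by rw [appendAux_zero, appendAux_zero]) fun n ih h => ?_
  obtain ⟨m, hm⟩ := h
  rw [appendAux_succ, appendAux_succ, ih ⟨1 + m, by rw [hm, add_assoc]⟩, len_cons, hm,
    add_tsub_cancel_left, add_assoc, add_tsub_cancel_left, look_cons_succ]

theorem zero_append (y : M.N) : append 0 y = y := by
  rw [append_def, len_zero, appendAux_zero]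

theorem cons_append (i x y : M.N) : append (cons i x) y = cons i (append x y) := by
  rw [append_def, len_cons, appendAux_succ, appendAux_cons _ _ _ _ le_rfl, len_cons, tsub_self,
    look_cons_zero, append_def]

theorem append_zero (x : M.N) : append x 0 = x := by
  refine seq_induction (P := fun x => append x 0 = x) x (zero_append 0) fun i x ih => ?_
  rw [cons_append, ih]

theorem append_assoc (x y z : M.N) : append (append x y) z = append x (append y z) := by
  refine seq_induction (P := fun x => append (append x y) z = append x (append y z)) x ?_ ?_
  · rw [zero_append, zero_append]
  · intro i x ih
    rw [cons_append, cons_append, cons_append, ih]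

theorem len_append (x y : M.N) : len (append x y) = len x + len y := by
  refine seq_induction (P := fun x => len (append x y) = len x + len y) x ?_ ?_
  · rw [zero_append, len_zero, zero_add]
  · intro i x ih
    rw [cons_append, len_cons, len_cons, ih, add_right_comm]

/-- `a * ⟨i⟩`. -/
def snoc (x i : M.N) : M.N := append x (cons i 0)

instance {x y : α → M.N} [DefN M x] [DefN M y] : DefN M fun a => snoc (x a) (y a) := by
  unfold snoc; infer_instance

theorem zero_snoc (i : M.N) : snoc 0 i = cons i 0 := zero_append _

theorem cons_snoc (i x j : M.N) : snoc (cons i x) j = cons i (snoc x j) := cons_append _ _ _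

theorem append_snoc (x y i : M.N) : append x (snoc y i) = snoc (append x y) i :=
  (append_assoc _ _ _).symm

theorem len_snoc (x i : M.N) : len (snoc x i) = len x + 1 := by
  rw [snoc, len_append, len_cons, len_zero, zero_add]

theorem eq_zero_or_snoc (x : M.N) : x = 0 ∨ ∃ y i, x = snoc y i := by
  refine seq_induction (P := fun x => x = 0 ∨ ∃ y i, x = snoc y i) x (.inl rfl) ?_
  rintro i x (rfl | ⟨y, j, rfl⟩)
  · exact .inr ⟨0, i, (zero_snoc i).symm⟩
  · exact .inr ⟨cons i y, j, (cons_snoc i y j).symm⟩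

theorem snoc_ne_zero (x i : M.N) : snoc x i ≠ 0 := by
  intro h
  have := len_snoc x i
  rw [h, len_zero] at this
  exact add_one_ne_zero _ this.symm

theorem snoc_inj {x i y j : M.N} (h : snoc x i = snoc y j) : x = y ∧ i = j := by
  revert h
  refine seq_induction (P := fun x => ∀ y, snoc x i = snoc y j → x = y ∧ i = j) x ?_ ?_ y
  · intro y h
    rcases eq_zero_or_cons y with rfl | ⟨k, y, rfl⟩
    · rw [zero_snoc, zero_snoc] at h
      exact ⟨rfl, (cons_inj.1 h).1⟩
    · rw [zero_snoc, cons_snoc] at h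
      exact absurd (cons_inj.1 h).2.symm (snoc_ne_zero _ _)
  · intro k x ih y h
    rcases eq_zero_or_cons y with rfl | ⟨l, y, rfl⟩
    · rw [zero_snoc, cons_snoc] at h
      exact absurd (cons_inj.1 h).2 (snoc_ne_zero _ _)
    · rw [cons_snoc, cons_snoc, cons_inj] at h
      obtain ⟨rfl, rfl⟩ := ih y h.2
      exact ⟨by rw [h.1], rfl⟩

/-- Children have larger codes than their parents. The induction over a finite type derivation rests
on this. -/
theorem lt_snoc (x i : M.N) : x < snoc x i := by
  refine seq_induction (P := fun x => x < snoc x i) x ?_ fun j x ih => ?_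
  · rw [zero_snoc]; exact lt_cons _ _
  · rw [cons_snoc]; exact cons_strictMono ih

theorem rep_succ (c : ℕ) (x : M.N) : rep c (x + 1) = cons (M.num c) (rep c x) := by
  rw [← succ_eq]
  simp only [rep, pr, PR.rep, app_prec_succ, app_comp₂, app_const, app_proj, cons,
    Matrix.cons_val_one, Matrix.cons_val_zero]

/-- Codes are monotone in the first entry and in the tail, so the largest one is reached with the
maximal entries and the maximal length. -/
theorem le_rep {c : ℕ} (a h : M.N) (ha : ∀ b i e, a = append b (cons i e) → i ≤ M.num c)
    (hl : len a ≤ h) : a ≤ rep c h := by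
  revert ha hl
  refine seq_induction (P := fun a => ∀ h, (∀ b i e, a = append b (cons i e) → i ≤ M.num c) →
    len a ≤ h → a ≤ rep c h) a (fun _ _ _ => zero_le) ?_ h
  intro i a ih h ha hl
  rw [len_cons] at hl
  obtain ⟨z, rfl⟩ := hl
  rw [add_right_comm, rep_succ]
  refine cons_mono (ha 0 i a (zero_append _).symm) (ih _ ?_ (le_add_right le_rfl))
  intro b j e he
  exact ha (cons i b) j e (by rw [cons_append, he])

/-- Bounded comprehension for finite sequences. -/
theorem exists_seq (R : M.N → M.N → Prop) [h : Def M fun p : (Unit × M.N) × M.N => R p.1.2 p.2]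
    (c : ℕ) (n : M.N) (hR : ∀ e < n, ∃ v ≤ M.num c, R e v) :
    ∃ d ≤ rep c n, (∀ e < n, R e (look d e)) ∧ ∀ e, n ≤ e → look d e = 0 := by
  have : ∀ {α : Type} [Ctx M α] (f g : α → M.N) [DefN M f] [DefN M g],
      Def M fun a => R (f a) (g a) := fun f g hf hg => h.comp₂ hf hg
  have key : ∀ k, k + n = n → ∃ d ≤ rep c n, (∀ e < n, R (k + e) (look d e)) ∧
      ∀ e, n ≤ e → look d e = 0 := by
    -- The sequence is built from its end: `d` lists values for the last `j` places, which begin at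
    -- `k`, and one more value is prepended at each step. Internal induction replaces a choice of
    -- values.
    refine induction_on (P := fun j => ∀ k, k + j = n → ∃ d, d ≤ rep c j ∧
      (∀ e < j, R (k + e) (look d e)) ∧ ∀ e, j ≤ e → look d e = 0) n ?_ ?_
    · intro k _
      refine ⟨0, zero_le, fun e he => absurd he (by simp), fun e _ => look_of_le zero_le⟩
    · intro j ih k hk
      obtain ⟨d, hd, h₁, h₂⟩ := ih (k + 1) (by rw [← hk, add_right_comm, add_assoc])
      obtain ⟨v, hv, hkv⟩ := hR k (by
        rw [← hk, lt_iff, ← add_assoc, add_right_comm]; exact le_add_right le_rfl)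
      refine ⟨cons v d, by rw [rep_succ]; exact cons_mono hv hd, ?_, ?_⟩
      · intro e he
        rcases eq_zero_or_succ e with rfl | ⟨e, rfl⟩
        · rwa [add_zero, look_cons_zero]
        · rw [look_cons_succ, add_comm e, ← add_assoc]
          exact h₁ e (by rwa [add_lt_add_iff_right] at he)
      · intro e he
        rcases eq_zero_or_succ e with rfl | ⟨e, rfl⟩
        · exact absurd (lt_succ_iff.2 zero_le) (not_lt.2 he)
        · rw [look_cons_succ]
          exact h₂ e (by rwa [add_le_add_iff_right] at he)
  simpa only [zero_add, true_implies] using key 0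

/-- Finite decorations with prescribed definable entries. -/
theorem exists_decoration {s : ℕ} (Q : Fin s → M.N → Prop)
    [∀ i, Def M fun p : (Unit × M.N) × M.N => Q i p.1.2]
    (hQ : ∀ e i j, Q i e → Q j e → i = j) (n : M.N) :
    ∃ d ≤ rep s n, (∀ e < n, ∀ i : Fin s, look d e = M.num (i + 1) ↔ Q i e) ∧
      ∀ e, n ≤ e → look d e = 0 := by
  -- The entry is `i + 1` for the unique `i` with `Q i e`, and `0` if there is none; so the entries
  -- are at most `s`.
  obtain ⟨d, hd, h₁, h₂⟩ := exists_seq (fun e v => (∃ i : Fin s, v = M.num (i + 1) ∧ Q i e) ∨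
    (v = 0 ∧ ∀ i : Fin s, ¬ Q i e)) s n fun e _ => by
      by_cases h : ∃ i, Q i e
      · obtain ⟨i, hi⟩ := h
        exact ⟨M.num (i + 1), num_mono i.2, .inl ⟨i, rfl, hi⟩⟩
      · exact ⟨0, zero_le, .inr ⟨rfl, not_exists.1 h⟩⟩
  refine ⟨d, hd, fun e he i => ?_, h₂⟩
  rcases h₁ e he with ⟨j, hj, hq⟩ | ⟨h0, hq⟩
  · rw [hj]
    refine ⟨fun h => ?_, fun h => by rw [hQ e i j h hq]⟩
    rwa [show i = j from Fin.ext (by simpa using (num_inj h).symm)]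
  · rw [h0]
    exact ⟨fun h => absurd h.symm (add_one_ne_zero _), fun h => (hq i h).elim⟩

end Model
end IntrinsicTheory

namespace IntrinsicTheory
namespace Model

/-! ## Hyper-terms in a model -/

variable {M : Model} {α : Type} [Ctx M α]

theorem sat_conj (σ : ℕ → M.N) (τ : (k : ℕ) → ℕ → M.F k) (l : List PF) :
    M.sat σ τ (PF.conj l) ↔ ∀ φ ∈ l, M.sat σ τ φ := by
  induction l with
  | nil => simp [PF.conj, Struct.sat]
  | cons φ l ih =>
    rw [List.forall_mem_cons, ← ih]
    rfl

theorem sat_disj (σ : ℕ → M.N) (τ : (k : ℕ) → ℕ → M.F k) (l : List PF) :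
    M.sat σ τ (PF.disj l) ↔ ∃ φ ∈ l, M.sat σ τ φ := by
  induction l with
  | nil => simp [PF.disj, Struct.sat]
  | cons φ l ih =>
    rw [List.exists_mem_cons_iff, ← ih]
    rfl

theorem sat_conj_ofFn (σ : ℕ → M.N) (τ : (k : ℕ) → ℕ → M.F k) {n : ℕ} (f : Fin n → PF) :
    M.sat σ τ (PF.conj (List.ofFn f)) ↔ ∀ i, M.sat σ τ (f i) := by
  rw [sat_conj, List.forall_mem_ofFn_iff]

theorem sat_disj_ofFn (σ : ℕ → M.N) (τ : (k : ℕ) → ℕ → M.F k) {n : ℕ} (f : Fin n → PF) :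
    M.sat σ τ (PF.disj (List.ofFn f)) ↔ ∃ i, M.sat σ τ (f i) := by
  simp [sat_disj, List.mem_ofFn]

/-- The value of a unary function. -/
def ap (f : M.F 1) (x : M.N) : M.N := M.app f ![x]

instance {f : α → M.F 1} {x : α → M.N} [DefF M f] [DefN M x] : DefN M fun a => ap (f a) (x a) :=
  inferInstanceAs (DefN M fun a => M.app _ ![x a])

theorem vec₁ {β : Type} (g : NT → β) (t : NT) : (fun j => g (![t] j)) = ![g t] := by
  funext j; fin_cases j; rfl

theorem vec₂ {β : Type} (g : NT → β) (t u : NT) : (fun j => g (![t, u] j)) = ![g t, g u] := by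
  funext j; fin_cases j <;> rfl

section Eval

variable (σ : ℕ → M.N) (τ : (k : ℕ) → ℕ → M.F k)

theorem evN_at (x : FT 1) (a : NT) : M.evN σ τ (x.at a) = ap (M.evF τ x) (M.evN σ τ a) := by
  rw [FT.at, Struct.evN, vec₁]; rfl

theorem evN_consT (t u : NT) :
    M.evN σ τ (NT.consT t u) = cons (M.evN σ τ t) (M.evN σ τ u) := by
  rw [NT.consT, evN_pr, vec₂]; rfl

theorem evN_appendT (t u : NT) :
    M.evN σ τ (NT.appendT t u) = append (M.evN σ τ t) (M.evN σ τ u) := by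
  rw [NT.appendT, evN_pr, vec₂]; rfl

theorem evN_childT (t : NT) (k : ℕ) :
    M.evN σ τ (NT.childT t k) = snoc (M.evN σ τ t) (M.num k) := by
  rw [NT.childT, evN_appendT, evN_consT, evN_num]; rfl

theorem evN_lookT (t u : NT) :
    M.evN σ τ (NT.lookT t u) = look (M.evN σ τ t) (M.evN σ τ u) := by
  rw [NT.lookT, evN_pr, vec₂]; rfl

theorem evN_lenT (t : NT) : M.evN σ τ (NT.lenT t) = len (M.evN σ τ t) := by
  rw [NT.lenT, evN_pr, vec₁]; rfl

theorem sat_lt (t u : NT) : M.sat σ τ (PF.lt t u) ↔ M.evN σ τ t < M.evN σ τ u := by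
  rw [PF.lt, Struct.sat, evN_pr, vec₂, lt_iff, ← tsub_eq_zero_iff_le, ← succ_eq]; rfl

end Eval

section Trees

variable (C : ConVoc)

/-- `a` is an address of the hyper-term represented by `x`. -/
def Addr (x : M.F 1) (a : M.N) : Prop :=
  ∀ b i e, a = append b (cons i e) →
    ∃ c : Fin C.num, ∃ k : Fin (C.arity c), ap x b = M.num c ∧ i = M.num k

/-- `x` represents a hyper-term. -/
def HTm (x : M.F 1) : Prop := ∀ a, Addr C x a → ∃ c : Fin C.num, ap x a = M.num c

/-- `x` and `y` agree at all addresses. -/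
def Same (x y : M.F 1) : Prop := ∀ a, Addr C x a → ap x a = ap y a

variable {C} (σ : ℕ → M.N) (τ : (k : ℕ) → ℕ → M.F k)

theorem sat_addrForm (x : FT 1) (a : NT) :
    M.sat σ τ (addrForm C x a) ↔ Addr C (M.evF τ x) (M.evN σ τ a) := by
  simp only [addrForm, Struct.sat, sat_disj_ofFn, evN_appendT, evN_consT, Struct.evN_up, evN_at,
    evN_num, Addr]
  rfl

theorem sat_htm (x : FT 1) : M.sat σ τ (htm C x) ↔ HTm C (M.evF τ x) := by
  simp only [htm, Struct.sat, sat_disj_ofFn, sat_addrForm, evN_at, evN_num, HTm]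
  rfl

theorem sat_sameForm (x y : FT 1) :
    M.sat σ τ (sameForm C x y) ↔ Same C (M.evF τ x) (M.evF τ y) := by
  simp only [sameForm, Struct.sat, sat_addrForm, evN_at, Same]
  rfl

instance {x : α → M.F 1} {a : α → M.N} [hx : DefF M x] [ha : DefN M a] :
    Def M fun p => Addr C (x p) (a p) := by
  obtain ⟨t, ht⟩ := hx.out
  obtain ⟨u, hu⟩ := ha.out
  exact ⟨addrForm C t u, fun p => by rw [sat_addrForm, ht, hu]⟩

instance {x : α → M.F 1} [hx : DefF M x] : Def M fun p => HTm C (x p) := by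
  obtain ⟨t, ht⟩ := hx.out
  exact ⟨htm C t, fun p => by rw [sat_htm, ht]⟩

theorem snoc_induction {P : M.N → Prop} (x : M.N) [h : Def M fun p : Unit × M.N => P p.2]
    (h₀ : P 0) (h₁ : ∀ x i, P x → P (snoc x i)) : P x := by
  refine strong_induction x fun x ih => ?_
  rcases eq_zero_or_snoc x with rfl | ⟨y, i, rfl⟩
  · exact h₀
  · exact h₁ y i (ih y (lt_snoc y i))

theorem append_cons_ne_zero (b i e : M.N) : append b (cons i e) ≠ 0 := by
  rcases eq_zero_or_cons b with rfl | ⟨j, b, rfl⟩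
  · rw [zero_append]; exact cons_ne_zero _ _
  · rw [cons_append]; exact cons_ne_zero _ _

theorem addr_zero (x : M.F 1) : Addr C x 0 :=
  fun b i e h => absurd h.symm (append_cons_ne_zero b i e)

theorem addr_snoc {x : M.F 1} {a i : M.N} : Addr C x (snoc a i) ↔
    Addr C x a ∧ ∃ c : Fin C.num, ∃ k : Fin (C.arity c), ap x a = M.num c ∧ i = M.num k := by
  constructor
  · refine fun h => ⟨fun b j e he => h b j (snoc e i) ?_, h a i 0 rfl⟩
    rw [he, ← append_snoc, cons_snoc]
  · rintro ⟨h, h'⟩ b j e he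
    rcases eq_zero_or_snoc e with rfl | ⟨e, l, rfl⟩
    · obtain ⟨rfl, rfl⟩ := snoc_inj he
      exact h'
    · rw [← cons_snoc, append_snoc] at he
      exact h b j e (snoc_inj he).1

theorem Addr.of_append {x : M.F 1} {a e : M.N} (h : Addr C x (append a e)) : Addr C x a :=
  fun b i e' he => h b i (append e' e) (by rw [he, append_assoc, cons_append])

/-- The sub-term of `x` at the address `a`. -/
theorem exists_sub (x : M.F 1) (a : M.N) : ∃ y : M.F 1, ∀ e, ap y e = ap x (append a e) :=
  exists_fun fun e => ap x (append a e)

/-- Explicit definition provides such a function for each `a`, but the selection is made outside the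
model and need not be definable in `a`. Under internal induction it is therefore replaced by an
existential quantifier over functions or by `TypedAt`. -/
noncomputable def sub (x : M.F 1) (a : M.N) : M.F 1 := (exists_sub x a).choose

theorem ap_sub (x : M.F 1) (a e : M.N) : ap (sub x a) e = ap x (append a e) :=
  (exists_sub x a).choose_spec e

theorem Addr.sub {x : M.F 1} {a e : M.N} (h : Addr C x (append a e)) :
    Addr C (Model.sub x a) e := by
  intro b i e' he
  rw [ap_sub]
  exact h _ i e' (by rw [he, append_assoc])

theorem addr_append {x : M.F 1} {a e : M.N} (ha : Addr C x a) :
    Addr C x (append a e) ↔ Addr C (Model.sub x a) e := by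
  refine ⟨Addr.sub, ?_⟩
  refine snoc_induction (P := fun e => Addr C (Model.sub x a) e → Addr C x (append a e)) e ?_ ?_
  · intro _; rwa [append_zero]
  · intro e i ih h
    rw [addr_snoc, ap_sub] at h
    rw [append_snoc, addr_snoc]
    exact ⟨ih h.1, h.2⟩

/-- Whether `a * ⟨i⟩` is an address depends only on `a` being one and on the value at `a`. Agreement
on the addresses of `x` alone therefore determines those of `y`, which makes `Same` symmetric. -/
theorem addr_congr {x y : M.F 1} (h : ∀ a, Addr C x a → ap x a = ap y a) (a : M.N) :
    Addr C x a ↔ Addr C y a := by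
  refine snoc_induction (P := fun a => Addr C x a ↔ Addr C y a) a
    (iff_of_true (addr_zero x) (addr_zero y)) fun a i ih => ?_
  rw [addr_snoc, addr_snoc, ← ih]
  refine and_congr_right fun ha => ?_
  rw [h a ha]

theorem Same.addr_iff {x y : M.F 1} (h : Same C x y) {a : M.N} : Addr C x a ↔ Addr C y a :=
  addr_congr h a

theorem Same.refl (x : M.F 1) : Same C x x := fun _ _ => rfl

theorem Same.symm {x y : M.F 1} (h : Same C x y) : Same C y x :=
  fun a ha => (h a (h.addr_iff.2 ha)).symm

theorem Same.trans {x y z : M.F 1} (h : Same C x y) (h' : Same C y z) : Same C x z :=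
  fun a ha => (h a ha).trans (h' a (h.addr_iff.1 ha))

theorem Same.of_ap {x y : M.F 1} (h : ∀ a, ap x a = ap y a) : Same C x y := fun a _ => h a

theorem Same.htm {x y : M.F 1} (h : Same C x y) (hx : HTm C x) : HTm C y := by
  intro a ha
  rw [← h a (h.addr_iff.2 ha)]
  exact hx a (h.addr_iff.2 ha)

theorem Same.sub {x y : M.F 1} (h : Same C x y) {a : M.N} (ha : Addr C x a) :
    Same C (sub x a) (sub y a) := by
  intro e he
  rw [ap_sub, ap_sub]
  exact h _ ((addr_append ha).2 he)

theorem HTm.sub {x : M.F 1} (h : HTm C x) {a : M.N} (ha : Addr C x a) : HTm C (sub x a) := by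
  intro e he
  rw [ap_sub]
  exact h _ ((addr_append ha).2 he)

theorem same_sub_zero (x : M.F 1) : Same C (sub x 0) x :=
  .of_ap fun a => by rw [ap_sub, zero_append]

theorem same_sub_sub (x : M.F 1) (a b : M.N) : Same C (sub (sub x a) b) (sub x (append a b)) :=
  .of_ap fun e => by rw [ap_sub, ap_sub, ap_sub, append_assoc]

/-- The position is an external numeral, so an induction on the list suffices: each test of the
selector against `0` uses up one entry and passes on the predecessor. -/
theorem app_select {r : ℕ} {s : Fin r → ℕ} (f : (j : Fin r) → M.F (s j)) {k : ℕ}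
    (v : Fin k → M.N) (l : List (PR s k)) : ∀ (x : PR s k) (j : ℕ) (g : PR s k),
      M.app (M.prf x f) v = M.num j → l[j]? = some g →
      M.app (M.prf (.select x l) f) v = M.app (M.prf g f) v := by
  induction l with
  | nil => intro x j g _ h; simp at h
  | cons g' l ih =>
    intro x j g hx h
    rw [PR.select, app_comp₃, app_cond, hx]
    cases j with
    | zero =>
      rw [if_pos (show M.num 0 = 0 from rfl)]
      simp at h
      rw [h]
    | succ j =>
      rw [if_neg (show M.num (j + 1) ≠ 0 from add_one_ne_zero _)]
      refine ih _ j g ?_ (by simpa using h)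
      rw [app_comp₁, app_pred, hx, num, add_tsub_cancel_right]

/-- The representation of `c(f₀, …, f_{r-1})`. -/
def con (c : Fin C.num) (f : Fin (C.arity c) → M.F 1) : M.F 1 :=
  M.prf (PR.graft (C.arity c) c) f

theorem evF_conT (c : Fin C.num) (f : Fin (C.arity c) → FT 1) :
    M.evF τ (conT C c f) = con c fun k => M.evF τ (f k) := rfl

theorem con_zero (c : Fin C.num) (f : Fin (C.arity c) → M.F 1) : ap (con c f) 0 = M.num c := by
  rw [ap, con, PR.graft, ← zero_def, app_prec_zero, app_const]

theorem con_cons (c : Fin C.num) (f : Fin (C.arity c) → M.F 1) (j : Fin (C.arity c)) (a : M.N) :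
    ap (con c f) (cons (M.num j) a) = ap (f j) a := by
  rw [ap, con, cons_def, ← succ_eq, PR.graft, app_prec_succ]
  rw [app_select f _ _ _ j (.comp (.fn j) ![.comp .rgt ![.proj 0]])]
  · rw [app_comp₁, app_comp₁, app_fn, app_rgt, ← rgt_def, app_proj]
    show M.app (f j) ![rgt (pair _ a)] = _
    rw [rgt_pair]; rfl
  · rw [app_comp₁, app_lft, ← rgt_def, app_proj]
    show root (pair _ a) - rgt (pair _ a) = _
    rw [root_pair, rgt_pair, add_tsub_cancel_right]
  · simp

theorem addr_cons {x : M.F 1} {i a : M.N} : Addr C x (cons i a) ↔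
    (∃ c : Fin C.num, ∃ k : Fin (C.arity c), ap x 0 = M.num c ∧ i = M.num k) ∧
      Addr C (Model.sub x (cons i 0)) a := by
  have e : cons i a = append (cons i 0) a := by rw [cons_append, zero_append]
  have h := addr_snoc (C := C) (x := x) (a := 0) (i := i)
  rw [zero_snoc] at h
  constructor
  · intro h'
    rw [e] at h'
    exact ⟨(h.1 h'.of_append).2, h'.sub⟩
  · rintro ⟨h₁, h₂⟩
    rw [e]
    exact (addr_append (h.2 ⟨addr_zero x, h₁⟩)).2 h₂

theorem num_fin_inj {n : ℕ} {c d : Fin n} (h : M.num c = M.num d) : c = d := Fin.ext (num_inj h)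

theorem sub_con (c : Fin C.num) (f : Fin (C.arity c) → M.F 1) (j : Fin (C.arity c)) :
    Same C (Model.sub (con c f) (cons (M.num j) 0)) (f j) :=
  .of_ap fun a => by rw [ap_sub, cons_append, zero_append, con_cons]

theorem addr_con (c : Fin C.num) (f : Fin (C.arity c) → M.F 1) (i a : M.N) :
    Addr C (con c f) (cons i a) ↔ ∃ j : Fin (C.arity c), i = M.num j ∧ Addr C (f j) a := by
  rw [addr_cons, con_zero]
  constructor
  · rintro ⟨⟨d, k, hd, rfl⟩, h⟩
    obtain rfl := num_fin_inj hd
    exact ⟨k, rfl, (sub_con c f k).addr_iff.1 h⟩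
  · rintro ⟨j, rfl, h⟩
    exact ⟨⟨c, j, rfl, rfl⟩, (sub_con c f j).addr_iff.2 h⟩

theorem htm_con (c : Fin C.num) {f : Fin (C.arity c) → M.F 1} (h : ∀ j, HTm C (f j)) :
    HTm C (con c f) := by
  intro a ha
  rcases eq_zero_or_cons a with rfl | ⟨i, a, rfl⟩
  · exact ⟨c, con_zero c f⟩
  · obtain ⟨j, rfl, hj⟩ := (addr_con c f i a).1 ha
    rw [con_cons]
    exact h j a hj

theorem same_con (c : Fin C.num) {f g : Fin (C.arity c) → M.F 1} (h : ∀ j, Same C (f j) (g j)) :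
    Same C (con c f) (con c g) := by
  intro a ha
  rcases eq_zero_or_cons a with rfl | ⟨i, a, rfl⟩
  · rw [con_zero, con_zero]
  · obtain ⟨j, rfl, hj⟩ := (addr_con c f i a).1 ha
    rw [con_cons, con_cons]
    exact h j a hj

theorem con_inj (c : Fin C.num) {f g : Fin (C.arity c) → M.F 1} (h : Same C (con c f) (con c g))
    (j : Fin (C.arity c)) : Same C (f j) (g j) := by
  intro a ha
  have := h (cons (M.num j) a) ((addr_con c f _ a).2 ⟨j, rfl, ha⟩)
  rwa [con_cons, con_cons] at this

theorem con_ne {c d : Fin C.num} {f : Fin (C.arity c) → M.F 1} {g : Fin (C.arity d) → M.F 1}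
    (h : Same C (con c f) (con d g)) : c = d := by
  have := h 0 (addr_zero _)
  rw [con_zero, con_zero] at this
  exact num_fin_inj this

theorem addr_child {x : M.F 1} {c : Fin C.num} (h : ap x 0 = M.num c) (j : Fin (C.arity c)) :
    Addr C x (cons (M.num j) 0) :=
  addr_cons.2 ⟨⟨c, j, h, rfl⟩, addr_zero _⟩

/-- Agreement is claimed at addresses only: below an entry that is not less than the arity, the
values of `x` are arbitrary. -/
theorem same_con_sub {x : M.F 1} {c : Fin C.num} (h : ap x 0 = M.num c) :
    Same C x (con c fun j => sub x (cons (M.num j) 0)) := by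
  intro a ha
  rcases eq_zero_or_cons a with rfl | ⟨i, a, rfl⟩
  · rw [con_zero, h]
  · obtain ⟨⟨d, k, hd, rfl⟩, _⟩ := addr_cons.1 ha
    obtain rfl := num_fin_inj (h.symm.trans hd)
    rw [con_cons, ap_sub, cons_append, zero_append]

theorem exists_htm (C : ConVoc) : ∃ x : M.F 1, HTm C x := by
  obtain ⟨o, ho⟩ := C.nullary
  exact ⟨con o fun j => (ho ▸ j).elim0, htm_con o fun j => (ho ▸ j).elim0⟩

end Trees

end Model
end IntrinsicTheory

namespace IntrinsicTheory
namespace Model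

/-! ## Types in a model -/

variable {M : Model} {α : Type} [Ctx M α] {C : ConVoc} (D : DataSystem C)

/-- The decoration `d` is correct at `e`, where the constructor has the code `v`. -/
def Local (b : Fin D.bundles)
    (low : (b' : Fin D.bundles) → b' < b → Fin (D.size b') → M.N → Prop) (v d e : M.N) : Prop :=
  ∀ i : Fin (D.size b), look d e = M.num (i + 1) → ∃ R ∈ D.rules b i, v = M.num R.con ∧
    ∀ k : Fin (C.arity R.con), match R.arg k with
      | .own j => look d (snoc e (M.num k)) = M.num (j + 1)
      | .lower b' h j => low b' h j (snoc e (M.num k))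

/-- The sub-term of `x` at `a` has the type `i` of the bundle `b`. -/
def TypedAt (b : Fin D.bundles) (i : Fin (D.size b)) (x : M.F 1) (a : M.N) : Prop :=
  match D.kind b with
  | .ind => ∃ d, look d 0 = M.num (i + 1) ∧ ∀ e < d,
      Local D b (fun b' _ j e' => TypedAt b' j x (append a e')) (ap x (append a e)) d e
  | .coind => ∀ h, ∃ d < rep (D.size b) (rep C.maxArity h + 1) + 1, look d 0 = M.num (i + 1) ∧
      ∀ e < d, len e < h →
        Local D b (fun b' _ j e' => TypedAt b' j x (append a e')) (ap x (append a e)) d e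
termination_by b

theorem sat_localForm (σ : ℕ → M.N) (τ : (k : ℕ) → ℕ → M.F k) (b : Fin D.bundles)
    (low : (b' : Fin D.bundles) → b' < b → Fin (D.size b') → NT → PF)
    (low' : (b' : Fin D.bundles) → b' < b → Fin (D.size b') → M.N → Prop) (x : FT 1) (a d e : NT)
    (h : ∀ b' h i t, M.sat σ τ (low b' h i (NT.appendT a t)) ↔ low' b' h i (M.evN σ τ t)) :
    M.sat σ τ (localForm D b low x a d e) ↔
      Local D b low' (ap (M.evF τ x) (append (M.evN σ τ a) (M.evN σ τ e)))
        (M.evN σ τ d) (M.evN σ τ e) := by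
  simp only [localForm, sat_conj_ofFn, Struct.sat, sat_disj, List.mem_map, exists_exists_and_eq_and,
    evN_lookT, evN_num, evN_at, evN_appendT, Local]
  refine forall_congr' fun i => imp_congr_right fun _ => exists_congr fun R =>
    and_congr_right fun _ => and_congr_right fun _ => forall_congr' fun k => ?_
  cases R.arg k with
  | own j => simp only [Struct.sat, evN_lookT, evN_childT, evN_num]
  | lower b' h' j => rw [h, evN_childT]

theorem sat_typeForm (b : Fin D.bundles) : ∀ (σ : ℕ → M.N) (τ : (k : ℕ) → ℕ → M.F k)
    (i : Fin (D.size b)) (x : FT 1) (a : NT),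
    M.sat σ τ (typeForm D b i x a) ↔ TypedAt D b i (M.evF τ x) (M.evN σ τ a) := by
  induction b using WellFoundedLT.induction with
  | ind b ih =>
    intro σ τ i x a
    rw [typeForm, TypedAt]
    have key : ∀ (σ : ℕ → M.N) (a d e : NT),
        M.sat σ τ (localForm D b (fun b' _ j a' => typeForm D b' j x a') x a d e) ↔
        Local D b (fun b' _ j e' => TypedAt D b' j (M.evF τ x) (append (M.evN σ τ a) e'))
          (ap (M.evF τ x) (append (M.evN σ τ a) (M.evN σ τ e)))
          (M.evN σ τ d) (M.evN σ τ e) := by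
      intro σ a d e
      refine sat_localForm D σ τ b _ _ x a d e fun b' h j t => ?_
      rw [ih b' h, evN_appendT]
    cases D.kind b with
    | ind =>
      simp only [Struct.sat, evN_lookT, evN_num, sat_lt, key, Struct.evN_up]
      rfl
    | coind =>
      simp only [Struct.sat, evN_lookT, evN_num, sat_lt, key, Struct.evN_up, evN_lenT, Struct.evN,
        evN_pr, vec₁, succ_eq]
      rfl

instance {b : Fin D.bundles} {i : Fin (D.size b)} {x : α → M.F 1} {a : α → M.N} [hx : DefF M x]
    [ha : DefN M a] : Def M fun p => TypedAt D b i (x p) (a p) := by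
  obtain ⟨t, ht⟩ := hx.out
  obtain ⟨u, hu⟩ := ha.out
  exact ⟨typeForm D b i t u, fun p => by rw [sat_typeForm, ht, hu]⟩

/-- `x` has the type `i` of the bundle `b`; only addresses of `x` matter here. -/
def Typed (b : Fin D.bundles) (i : Fin (D.size b)) (x : M.F 1) : Prop :=
  match D.kind b with
  | .ind => ∃ d, look d 0 = M.num (i + 1) ∧ ∀ e, Addr C x e →
      Local D b (fun b' _ j e' => Typed b' j (sub x e')) (ap x e) d e
  | .coind => ∀ h, ∃ d, look d 0 = M.num (i + 1) ∧ ∀ e, Addr C x e → len e < h →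
      Local D b (fun b' _ j e' => Typed b' j (sub x e')) (ap x e) d e
termination_by b

/-- The decoration `d` is correct at all addresses of `x` in `S`. -/
def Correct (b : Fin D.bundles) (x : M.F 1) (S : M.N → Prop) (d : M.N) : Prop :=
  ∀ e, Addr C x e → S e → Local D b (fun b' _ j e' => Typed D b' j (sub x e')) (ap x e) d e

variable {D} {b : Fin D.bundles}

theorem typed_ind (hb : D.kind b = .ind) {i : Fin (D.size b)} {x : M.F 1} : Typed D b i x ↔
    ∃ d, look d 0 = M.num (i + 1) ∧ Correct D b x (fun _ => True) d := by
  rw [Typed, hb]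
  simp only [Correct, true_implies]

theorem typed_coind (hb : D.kind b = .coind) {i : Fin (D.size b)} {x : M.F 1} : Typed D b i x ↔
    ∀ h, ∃ d, look d 0 = M.num (i + 1) ∧ Correct D b x (fun e => len e < h) d := by
  rw [Typed, hb]
  rfl

/-- A correct place stays correct if no type is added there and the required types of its children
persist. Only child positions allowed by the constructor with code `v` have to be considered, which
is where membership in the tree becomes available. -/
theorem Local.imp {low low' : (b' : Fin D.bundles) → b' < b → Fin (D.size b') → M.N → Prop}
    {v d d' e e' : M.N} (h : Local D b low v d e)
    (hi : ∀ i : Fin (D.size b), look d' e' = M.num (i + 1) → look d e = M.num (i + 1))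
    (hc : ∀ (c : Fin C.num) (k : Fin (C.arity c)) (j : Fin (D.size b)), v = M.num c →
      look d (snoc e (M.num k)) = M.num (j + 1) → look d' (snoc e' (M.num k)) = M.num (j + 1))
    (hl : ∀ (c : Fin C.num) (k : Fin (C.arity c)) b' h j, v = M.num c →
      low b' h j (snoc e (M.num k)) → low' b' h j (snoc e' (M.num k))) :
    Local D b low' v d' e' := by
  intro i h'
  obtain ⟨R, hR, hv, hk⟩ := h i (hi i h')
  refine ⟨R, hR, hv, fun k => ?_⟩
  have := hk k
  revert this
  cases R.arg k with
  | own j => exact hc _ k j hv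
  | lower b' h' j => exact hl _ k b' h' j hv

theorem look_ne_zero {d e : M.N} {i : ℕ} (h : look d e = M.num (i + 1)) : look d e ≠ 0 :=
  h ▸ add_one_ne_zero _

theorem Local.of_le {low : (b' : Fin D.bundles) → b' < b → Fin (D.size b') → M.N → Prop}
    {v d e : M.N} (h : d ≤ e) : Local D b low v d e :=
  fun _ h' => absurd (look_of_le h) (look_ne_zero h')

theorem addr_snoc_num {x : M.F 1} {a : M.N} (ha : Addr C x a) {c : Fin C.num}
    (h : ap x a = M.num c) (k : Fin (C.arity c)) : Addr C x (snoc a (M.num k)) :=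
  addr_snoc.2 ⟨ha, c, k, h, rfl⟩

/-- Correctness is demanded at addresses only, where the two functions agree; premises from earlier
bundles are handled by induction on the bundle. -/
theorem Typed.congr (b : Fin D.bundles) : ∀ {i : Fin (D.size b)} {x y : M.F 1}, Same C x y →
    Typed D b i x → Typed D b i y := by
  induction b using WellFoundedLT.induction with
  | ind b ih =>
    intro i x y hxy h
    have key : ∀ S d, Correct D b x S d → Correct D b y S d := by
      intro S d h e he hS
      have he' := hxy.addr_iff.2 he
      rw [← hxy e he']
      refine (h e he' hS).imp (fun _ => id) (fun _ _ _ _ => id) fun c k b' hb' j hv => ?_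
      exact ih b' hb' (hxy.sub (addr_snoc_num he' hv k))
    rcases hb : D.kind b
    · rw [typed_ind hb] at h ⊢
      exact h.imp fun d hd => ⟨hd.1, key _ d hd.2⟩
    · rw [typed_coind hb] at h ⊢
      exact fun n => (h n).imp fun d hd => ⟨hd.1, key _ d hd.2⟩

theorem typed_congr {i : Fin (D.size b)} {x y : M.F 1} (h : Same C x y) :
    Typed D b i x ↔ Typed D b i y := ⟨Typed.congr b h, Typed.congr b h.symm⟩

theorem Addr.le_rep {x : M.F 1} {a h : M.N} (ha : Addr C x a) (hl : len a ≤ h) :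
    a ≤ rep C.maxArity h := by
  refine Model.le_rep a h (fun b i e he => ?_) hl
  obtain ⟨c, k, -, rfl⟩ := ha b i e he
  exact num_mono (k.2.le.trans (Finset.le_sup (f := C.arity) (Finset.mem_univ c)))

/-- `TypedAt` asks for correctness at all decorated numbers and, in the coinductive case, for a
bounded decoration; `Typed` does neither. Passing to `Typed` forgets conditions. Conversely, a
decoration is cleared outside the addresses and beyond a suitable bound, which makes the extra
conditions vacuous. -/
theorem typedAt_iff (b : Fin D.bundles) : ∀ {i : Fin (D.size b)} {x : M.F 1} {a : M.N},
    Addr C x a → (TypedAt D b i x a ↔ Typed D b i (sub x a)) := by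
  induction b using WellFoundedLT.induction with
  | ind b ih =>
    intro i x a ha
    have low : ∀ b' < b, ∀ (j : Fin (D.size b')) (e : M.N), Addr C (sub x a) e →
        (TypedAt D b' j x (append a e) ↔ Typed D b' j (sub (sub x a) e)) := by
      intro b' hb' j e he
      rw [ih b' hb' ((addr_append ha).2 he), typed_congr (same_sub_sub x a e)]
    -- The cut-down decoration keeps exactly the entries of `d` at addresses below `n`. The third
    -- hypothesis ensures that no child required at a place in `S` is lost.
    have restrict : ∀ (d n : M.N) (S : M.N → Prop), look d 0 = M.num (i + 1) → 0 < n →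
        (∀ e c (k : Fin (C.arity c)) (j : Fin (D.size b)), Addr C (sub x a) e → S e →
          ap (sub x a) e = M.num c → look d (snoc e (M.num k)) = M.num (j + 1) →
            snoc e (M.num k) < n) →
        Correct D b (sub x a) S d →
        ∃ d' ≤ rep (D.size b) n, look d' 0 = M.num (i + 1) ∧ ∀ e, S e →
          Local D b (fun b' _ j e' => TypedAt D b' j x (append a e')) (ap x (append a e)) d' e := by
      intro d n S h0 hn hS hd
      obtain ⟨d', hd', h₁, h₂⟩ := exists_decoration (M := M) (s := D.size b)
        (fun i e => Addr C (sub x a) e ∧ look d e = M.num (i + 1))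
        (fun e i j hi hj => Fin.ext (by simpa using num_inj (hi.2.symm.trans hj.2))) n
      refine ⟨d', hd', (h₁ 0 hn i).2 ⟨addr_zero _, h0⟩, fun e hSe => ?_⟩
      by_cases he : Addr C (sub x a) e
      · rw [← ap_sub]
        refine (hd e he hSe).imp (fun j hj => ?_) (fun c k j hv hj => ?_)
          (fun c k b' hb' j hv hj => ?_)
        · rcases lt_or_ge e n with hen | hen
          · exact ((h₁ e hen j).1 hj).2
          · exact absurd (h₂ e hen) (look_ne_zero hj)
        · exact (h₁ _ (hS e c k j he hSe hv hj) j).2 ⟨addr_snoc_num he hv k, hj⟩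
        · exact (low b' hb' j _ (addr_snoc_num he hv k)).2 hj
      · intro j hj
        rcases lt_or_ge e n with hen | hen
        · exact absurd ((h₁ e hen j).1 hj).1 he
        · exact absurd (h₂ e hen) (look_ne_zero hj)
    have forward : ∀ d e, Addr C (sub x a) e →
        (e < d → Local D b (fun b' _ j e' => TypedAt D b' j x (append a e'))
          (ap x (append a e)) d e) →
        Local D b (fun b' _ j e' => Typed D b' j (sub (sub x a) e')) (ap (sub x a) e) d e := by
      intro d e he h
      rcases lt_or_ge e d with hed | hed
      · rw [ap_sub]
        refine (h hed).imp (fun _ => id) (fun _ _ _ _ => id) fun c k b' hb' j hv => ?_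
        exact (low b' hb' j _ (addr_snoc_num he (by rw [ap_sub, hv]) k)).1
      · exact .of_le hed
    rcases hb : D.kind b
    · rw [typed_ind hb, TypedAt, hb]
      constructor
      · rintro ⟨d, h0, h⟩
        exact ⟨d, h0, fun e he _ => forward d e he (h e)⟩
      · rintro ⟨d, h0, h⟩
        -- Here `d` is its own bound: entries at places not less than `d` are `0`.
        obtain ⟨d', -, h0', h'⟩ := restrict d d _ h0 (lt_of_look_ne_zero (look_ne_zero h0))
          (fun e c k j _ _ _ hj => lt_of_look_ne_zero (look_ne_zero hj)) h
        exact ⟨d', h0', fun e _ => h' e trivial⟩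
    · rw [typed_coind hb, TypedAt, hb]
      refine forall_congr' fun n => ?_
      constructor
      · rintro ⟨d, -, h0, h⟩
        exact ⟨d, h0, fun e he hl => forward d e he fun hed => h e hed hl⟩
      · rintro ⟨d, h0, h⟩
        -- Children of addresses of length less than `n` have length at most `n` and entries below
        -- the maximal arity, hence codes at most `rep C.maxArity n`; the added `1` makes the bound
        -- strict.
        obtain ⟨d', hd', h0', h'⟩ := restrict d (rep C.maxArity n + 1) _ h0
          (lt_succ_iff.2 zero_le) (fun e c k j he hl hv _ => lt_succ_iff.2
            ((addr_snoc_num he hv k).le_rep (by rw [len_snoc]; exact lt_iff.1 hl))) h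
        exact ⟨d', lt_succ_iff.2 hd', h0', fun e _ => h' e⟩

/-! ### The rules and schemas of inductive and coinductive types, for `Typed`. -/

theorem exists_bound {ι : Type} (l : List ι) (f : ι → M.N) : ∃ n, ∀ i ∈ l, f i ≤ n := by
  induction l with
  | nil => exact ⟨0, by simp⟩
  | cons i l ih =>
    obtain ⟨n, hn⟩ := ih
    refine ⟨f i + n, fun j hj => ?_⟩
    rcases List.mem_cons.1 hj with rfl | hj
    · exact le_add_right le_rfl
    · exact (hn j hj).trans (le_add_left le_rfl)

/-- `y` has the type `Q`, with the types of the bundle `b` replaced by `P`. -/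
def ArgTyped (P : Fin (D.size b) → M.F 1 → Prop) (Q : ArgType D.size b) (y : M.F 1) : Prop :=
  match Q with
  | .own j => P j y
  | .lower b' _ j => Typed D b' j y

/-- Decorations of the immediate sub-terms can be combined. -/
theorem exists_combined {x : M.F 1} {i : Fin (D.size b)} {R : Rule C D.size b}
    (hR : R ∈ D.rules b i) (hx : ap x 0 = M.num R.con) {S S' : M.N → Prop}
    (hS : ∀ k e, S (cons k e) → S' e)
    (hk : ∀ k, ArgTyped (fun j y => ∃ d, look d 0 = M.num (j + 1) ∧ Correct D b y S' d) (R.arg k)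
      (sub x (cons (M.num k) 0))) :
    ∃ d, look d 0 = M.num (i + 1) ∧ Correct D b x S d := by
  -- A child whose required type belongs to an earlier bundle needs no decoration in this bundle;
  -- the empty sequence `0` serves.
  have : ∀ k, ∃ d, (∀ j, R.arg k = .own j → look d 0 = M.num (j + 1)) ∧
      Correct D b (sub x (cons (M.num k) 0)) S' d := by
    intro k
    have := hk k
    revert this
    cases R.arg k with
    | own j =>
      rintro ⟨d, h0, hd⟩
      exact ⟨d, fun j' h => by cases h; exact h0, hd⟩
    | lower b' h j => exact fun _ => ⟨0, by simp, fun e _ _ => .of_le zero_le⟩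
  choose d h0 hd using this
  obtain ⟨n, hn⟩ := exists_bound (List.finRange _) fun k : Fin (C.arity R.con) =>
    cons (M.num k) (d k)
  -- The root receives `i`, and a place below the child `k` what `d k` prescribes there. A place `e`
  -- decorated by `d k` is less than `d k`, so `cons k e` is less than `cons k (d k)`, hence below
  -- the common bound `n`.
  obtain ⟨d', -, h₁, h₂⟩ := exists_decoration (M := M) (s := D.size b)
    (fun i' e => (e = 0 ∧ i' = i) ∨ ∃ k : Fin (C.arity R.con), ∃ e', e = cons (M.num k) e' ∧
      look (d k) e' = M.num (i' + 1)) (by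
    rintro e i₁ i₂ (⟨rfl, rfl⟩ | ⟨k, e', rfl, h⟩) (⟨h', rfl⟩ | ⟨k', e'', h', h''⟩)
    · rfl
    · exact absurd h'.symm (cons_ne_zero _ _)
    · exact absurd h' (cons_ne_zero _ _)
    · obtain ⟨hk, rfl⟩ := cons_inj.1 h'
      obtain rfl := num_fin_inj hk
      exact Fin.ext (by simpa using num_inj (h.symm.trans h''))) (n + 1)
  have child : ∀ (k : Fin (C.arity R.con)) e (j : Fin (D.size b)),
      look d' (cons (M.num k) e) = M.num (j + 1) ↔ look (d k) e = M.num (j + 1) := by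
    intro k e j
    constructor
    · intro h
      have hlt : cons (M.num k) e < n + 1 := lt_of_not_ge fun h' => look_ne_zero h (h₂ _ h')
      rcases (h₁ _ hlt j).1 h with ⟨h', -⟩ | ⟨k', e', h', h''⟩
      · exact absurd h' (cons_ne_zero _ _)
      · obtain ⟨hk, rfl⟩ := cons_inj.1 h'
        obtain rfl := num_fin_inj hk
        exact h''
    · intro h
      refine (h₁ _ ?_ j).2 (.inr ⟨k, e, rfl, h⟩)
      exact ((cons_strictMono (lt_of_look_ne_zero (look_ne_zero h))).trans_le
        (hn k (List.mem_finRange k))).trans_le (le_add_right le_rfl)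
  refine ⟨d', (h₁ 0 (lt_succ_iff.2 zero_le) i).2 (.inl ⟨rfl, rfl⟩), fun e he hSe => ?_⟩
  rcases eq_zero_or_cons e with rfl | ⟨l, e, rfl⟩
  · intro i' hi'
    rcases (h₁ 0 (lt_succ_iff.2 zero_le) i').1 hi' with ⟨-, rfl⟩ | ⟨k, e', h', -⟩
    · refine ⟨R, hR, hx, fun k => ?_⟩
      have h := hk k
      have h' := h0 k
      revert h h'
      simp only [zero_snoc]
      cases R.arg k with
      | own j => exact fun _ h' => (child k 0 j).2 (h' j rfl)
      | lower b' hb' j => exact fun h _ => h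
    · exact absurd h'.symm (cons_ne_zero _ _)
  · obtain ⟨⟨c, k, hc, rfl⟩, he'⟩ := addr_cons.1 he
    obtain rfl := num_fin_inj (hx.symm.trans hc)
    have := hd k e he' (hS _ _ hSe)
    rw [ap_sub, cons_append, zero_append] at this
    refine this.imp (fun j => (child k e j).1) (fun c k' j _ h => ?_) fun c k' b' hb' j _ => ?_
    · rw [cons_snoc]; exact (child k _ j).2 h
    · refine Typed.congr b' ((same_sub_sub _ _ _).trans (.of_ap fun a => ?_))
      rw [cons_append, zero_append, cons_snoc]

theorem typed_construction (hb : D.kind b = .ind) {x : M.F 1} {i : Fin (D.size b)}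
    {R : Rule C D.size b} (hR : R ∈ D.rules b i) (hx : ap x 0 = M.num R.con)
    (hk : ∀ k, ArgTyped (Typed D b) (R.arg k) (sub x (cons (M.num k) 0))) : Typed D b i x := by
  rw [typed_ind hb]
  refine exists_combined (S' := fun _ => True) hR hx (fun _ _ _ => trivial) fun k => ?_
  have := hk k
  revert this
  cases R.arg k with
  | own j => exact (typed_ind hb).1
  | lower b' h j => exact id

/-- The part of the decoration that lies below a child is a decoration of that child, and one level
of depth is spent on the step to it. The number `d` still bounds the places involved, since `cons`
only increases codes. -/
theorem Correct.shift {x : M.F 1} {d h : M.N} (hd : Correct D b x (fun e => len e < h + 1) d)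
    {c : Fin C.num} (hx : ap x 0 = M.num c) (k : Fin (C.arity c)) {j : Fin (D.size b)}
    (hj : look d (cons (M.num k) 0) = M.num (j + 1)) :
    ∃ d', look d' 0 = M.num (j + 1) ∧
      Correct D b (sub x (cons (M.num k) 0)) (fun e => len e < h) d' := by
  obtain ⟨d', -, h₁, h₂⟩ := exists_decoration (M := M) (s := D.size b)
    (fun i e => look d (cons (M.num k) e) = M.num (i + 1))
    (fun e i j hi hj => Fin.ext (by simpa using num_inj (hi.symm.trans hj))) d
  have key : ∀ e (i : Fin (D.size b)),
      look d' e = M.num (i + 1) ↔ look d (cons (M.num k) e) = M.num (i + 1) := by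
    intro e i
    rcases lt_or_ge e d with he | he
    · exact h₁ e he i
    · exact ⟨fun h => absurd (h₂ e he) (look_ne_zero h),
        fun h => absurd (look_of_le (he.trans (lt_cons _ _).le)) (look_ne_zero h)⟩
  refine ⟨d', (key 0 j).2 hj, fun e he hl => ?_⟩
  have := hd (cons (M.num k) e) (addr_cons.2 ⟨⟨c, k, hx, rfl⟩, he⟩)
    (by change len _ < _; rw [len_cons, add_lt_add_iff_right]; exact hl)
  rw [ap_sub, cons_append, zero_append]
  refine this.imp (fun i => (key e i).1) (fun c k' j _ h => ?_) fun c k' b' hb' j _ => ?_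
  · rw [cons_snoc] at h; exact (key _ j).2 h
  · refine Typed.congr b' (Same.trans (.of_ap fun a => ?_) (same_sub_sub _ _ _).symm)
    rw [cons_append, zero_append, cons_snoc]

/-- Decorations for different depths may use different rules at the root, and a rule good for all
depths is wanted. There are only finitely many rules, so if each had a depth at which it fails, one
decoration reaching beyond all these depths would refute this. No infinite branch has to be chosen.
-/
theorem typed_deconstruction (hb : D.kind b = .coind) {x : M.F 1} {i : Fin (D.size b)}
    (h : Typed D b i x) : ∃ R ∈ D.rules b i, ap x 0 = M.num R.con ∧
      ∀ k, ArgTyped (Typed D b) (R.arg k) (sub x (cons (M.num k) 0)) := by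
  by_contra! hcon
  -- A depth at which the applicable rule `R` fails. The value `0` is a default when `R` does not
  -- apply, or when the failing premise belongs to an earlier bundle, where depth plays no role.
  have : ∀ R : Rule C D.size b, ∃ h : M.N, R ∈ D.rules b i → ap x 0 = M.num R.con →
      ∃ k, ¬ ArgTyped (fun j y => ∃ d, look d 0 = M.num (j + 1) ∧
        Correct D b y (fun e => len e < h) d) (R.arg k) (sub x (cons (M.num k) 0)) := by
    intro R
    by_cases hR : R ∈ D.rules b i ∧ ap x 0 = M.num R.con
    · obtain ⟨k, hk⟩ := hcon R hR.1 hR.2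
      revert hk
      cases e : R.arg k with
      | own j =>
        intro hk
        obtain ⟨h, hh⟩ := not_forall.1 (fun h' => hk ((typed_coind hb).2 h'))
        exact ⟨h, fun _ _ => ⟨k, by rw [e]; exact hh⟩⟩
      | lower b' h j => exact fun hk => ⟨0, fun _ _ => ⟨k, by rw [e]; exact hk⟩⟩
    · exact ⟨0, fun h h' => (hR ⟨h, h'⟩).elim⟩
  choose n hn using this
  obtain ⟨m, hm⟩ := exists_bound (D.rules b i) n
  -- The extra level covers the root, so that its children are decorated correctly to depth `m`.
  obtain ⟨d, h0, hd⟩ := (typed_coind hb).1 h (m + 1)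
  obtain ⟨R, hR, hx, hk⟩ := hd 0 (addr_zero x)
    (by change len _ < _; rw [len_zero]; exact lt_succ_iff.2 zero_le) i h0
  obtain ⟨k, hk'⟩ := hn R hR hx
  have := hk k
  revert this hk'
  rw [zero_snoc]
  cases R.arg k with
  | own j =>
    intro hk' hj
    obtain ⟨d', h0', hd'⟩ := hd.shift hx k hj
    exact hk' ⟨d', h0', fun e he hl => hd' e he (lt_of_lt_of_le hl (hm R hR))⟩
  | lower b' h j => exact fun hk' h => hk' h

theorem ArgTyped.congr {P : Fin (D.size b) → M.F 1 → Prop}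
    (hP : ∀ i x y, Same C x y → P i x → P i y) {Q : ArgType D.size b} {x y : M.F 1}
    (h : Same C x y) (hx : ArgTyped P Q x) : ArgTyped P Q y := by
  cases Q with
  | own j => exact hP j x y h hx
  | lower b' hb' j => exact Typed.congr b' h hx

/-- A type derivation is finite in the sense of `M`: its decorated places have codes below `d`, and
codes grow towards the leaves. The claim is proved for all decorated addresses by induction on the
distance of their codes from `d`. -/
theorem typed_induction (hb : D.kind b = .ind) (P : Fin (D.size b) → M.F 1 → Prop)
    [hdef : ∀ i, Def M fun p : Unit × M.F 1 => P i p.2]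
    (hP : ∀ i x y, Same C x y → P i x → P i y)
    (hstep : ∀ i, ∀ R ∈ D.rules b i, ∀ x, HTm C x → ap x 0 = M.num R.con →
      (∀ k, ArgTyped P (R.arg k) (sub x (cons (M.num k) 0))) → P i x)
    {i : Fin (D.size b)} {x : M.F 1} (hx : HTm C x) (h : Typed D b i x) : P i x := by
  obtain ⟨d, h0, hd⟩ := (typed_ind hb).1 h
  have : ∀ (i : Fin (D.size b)) {α : Type} [Ctx M α] (f : α → M.F 1) [DefF M f],
      Def M fun a => P i (f a) := fun i _ _ f hf => (hdef i).compF hf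
  have key : ∀ e, d ≤ e + d → Addr C x e → ∀ i : Fin (D.size b), look d e = M.num (i + 1) →
      ∃ y, (∀ a, ap y a = ap x (append e a)) ∧ P i y := by
    -- `m` bounds the distance from `e` to `d`. At `m = 0` nothing is decorated. The quantified `y`
    -- stands for `sub x e`, which need not be definable in `e`; invariance of `P` under `Same`
    -- makes the two interchangeable.
    refine induction_on (P := fun m => ∀ e, d ≤ e + m → Addr C x e → ∀ i : Fin (D.size b),
      look d e = M.num (i + 1) → ∃ y : M.F 1, (∀ a, ap y a = ap x (append e a)) ∧ P i y) d ?_ ?_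
    · intro e he _ i hi
      rw [add_zero] at he
      exact absurd (look_of_le he) (look_ne_zero hi)
    · intro m ih e he hae i hi
      refine ⟨sub x e, ap_sub x e, ?_⟩
      obtain ⟨R, hR, hv, hk⟩ := hd e hae trivial i hi
      refine hstep i R hR _ (hx.sub hae) (by rw [ap_sub, append_zero, hv]) fun k => ?_
      have hs : Same C (sub x (snoc e (M.num k))) (sub (sub x e) (cons (M.num k) 0)) :=
        (same_sub_sub x e _).symm
      refine ArgTyped.congr hP hs ?_
      have := hk k
      revert this
      cases R.arg k with
      | own j =>
        intro hj
        obtain ⟨y, hy, hPy⟩ := ih (snoc e (M.num k)) (he.trans (by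
          rw [add_comm m, ← add_assoc]
          exact add_le_add_left (lt_iff.1 (lt_snoc e _)) m)) (addr_snoc_num hae hv k) j hj
        exact hP j y _ (.of_ap fun a => by rw [hy, ap_sub]) hPy
      | lower b' hb' j => exact id
  obtain ⟨y, hy, hPy⟩ := key 0 (by rw [zero_add]) (addr_zero x) i h0
  exact hP i y x (.of_ap fun a => by rw [hy, zero_append]) hPy

/-- Correctness of a decoration of `x`, expressed by a formula. -/
theorem correct_iff {x : M.F 1} {S : M.N → Prop} {d : M.N} : Correct D b x S d ↔
    ∀ e, Addr C x e → S e → Local D b (fun b' _ j e' => TypedAt D b' j x e') (ap x e) d e := by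
  refine forall_congr' fun e => forall_congr' fun he => imp_congr_right fun _ => ?_
  constructor
  · refine fun h => h.imp (fun _ => id) (fun _ _ _ _ => id) fun c k b' hb' j hv => ?_
    exact (typedAt_iff b' (addr_snoc_num he hv k)).2
  · refine fun h => h.imp (fun _ => id) (fun _ _ _ _ => id) fun c k b' hb' j hv => ?_
    exact (typedAt_iff b' (addr_snoc_num he hv k)).1

instance {x : α → M.F 1} {v d e : α → M.N} [DefF M x] [DefN M v] [DefN M d] [DefN M e] :
    Def M fun a => Local D b (fun b' _ j e' => TypedAt D b' j (x a) e') (v a) (d a) (e a) := by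
  have : ∀ (R : Rule C D.size b) (k : Fin (C.arity R.con)), Def M fun a => match R.arg k with
      | .own j => look (d a) (snoc (e a) (M.num k)) = M.num (j + 1)
      | .lower b' h j => TypedAt D b' j (x a) (snoc (e a) (M.num k)) := by
    intro R k
    cases R.arg k <;> infer_instance
  unfold Local
  beta_reduce
  have : ∀ (R : Rule C D.size b), Def M fun a => ∀ (k : Fin (C.arity R.con)), match R.arg k with
      | .own j => look (d a) (snoc (e a) (M.num k)) = M.num (j + 1)
      | .lower b' h j => TypedAt D b' j (x a) (snoc (e a) (M.num k)) := fun R => inferInstance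
  infer_instance

/-- For every depth `n`, all hyper-terms satisfying `P i` have a decoration correct to depth `n`:
the closure of `P` yields a rule at the root and sub-terms satisfying `P`, whose decorations to the
previous depth are combined. The induction hypothesis must quantify over all functions `x`, and so
uses induction for non-arithmetical formulas. -/
theorem typed_coinduction (hb : D.kind b = .coind) (P : Fin (D.size b) → M.F 1 → Prop)
    [hdef : ∀ i, Def M fun p : Unit × M.F 1 => P i p.2]
    (hstep : ∀ i x, HTm C x → P i x → ∃ R ∈ D.rules b i, ap x 0 = M.num R.con ∧
      ∀ k, ArgTyped P (R.arg k) (sub x (cons (M.num k) 0)))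
    {i : Fin (D.size b)} {x : M.F 1} (hx : HTm C x) (h : P i x) : Typed D b i x := by
  have : ∀ (i : Fin (D.size b)) {α : Type} [Ctx M α] (f : α → M.F 1) [DefF M f],
      Def M fun a => P i (f a) := fun i _ _ f hf => (hdef i).compF hf
  -- Correctness is phrased with `TypedAt` at addresses of `x`, because the version with `sub` is
  -- not visibly definable; `correct_iff` translates between the two.
  have key : ∀ n : M.N, ∀ (i : Fin (D.size b)) (x : M.F 1), HTm C x → P i x →
      ∃ d, look d 0 = M.num (i + 1) ∧ ∀ e, Addr C x e → len e < n →
        Local D b (fun b' _ j e' => TypedAt D b' j x e') (ap x e) d e := by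
    intro n
    refine induction_on (P := fun n => ∀ (i : Fin (D.size b)) (x : M.F 1), HTm C x → P i x →
      ∃ d, look d 0 = M.num (i + 1) ∧ ∀ e, Addr C x e → len e < n →
        Local D b (fun b' _ j e' => TypedAt D b' j x e') (ap x e) d e) n ?_ ?_
    · intro i x _ _
      -- At depth `0` only the type of the root is prescribed; correctness is vacuous.
      exact ⟨cons (M.num (i + 1)) 0, look_cons_zero _ _, fun e _ h => absurd h (by simp)⟩
    · intro n ih i x hx h
      simp only [← correct_iff (S := fun e => len e < n)] at ih
      suffices h : ∃ d, look d 0 = M.num (i + 1) ∧ Correct D b x (fun e => len e < n + 1) d from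
        h.imp fun d hd => ⟨hd.1, correct_iff.1 hd.2⟩
      obtain ⟨R, hR, hv, hk⟩ := hstep i x hx h
      refine exists_combined (S' := fun e => len e < n) hR hv (fun k e h => ?_) fun k => ?_
      · rwa [len_cons, add_lt_add_iff_right] at h
      · have := hk k
        revert this
        cases R.arg k with
        | own j => exact ih j _ (hx.sub (addr_child hv k))
        | lower b' hb' j => exact id
  refine (typed_coind hb).2 fun n => ?_
  obtain ⟨d, h0, hd⟩ := key n i x hx h
  exact ⟨d, h0, correct_iff.2 hd⟩

end Model
end IntrinsicTheory

namespace IntrinsicTheory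
namespace Model

/-! ## Semantics of intrinsic theories in a model -/

variable {M : Model} {C : ConVoc} {D : DataSystem C} {P : List ℕ}

theorem sat_imps (σ : ℕ → M.N) (τ : (k : ℕ) → ℕ → M.F k) (l : List PF) (ψ : PF) :
    M.sat σ τ (PF.imps l ψ) ↔ ((∀ φ ∈ l, M.sat σ τ φ) → M.sat σ τ ψ) := by
  induction l with
  | nil => simp [PF.imps]
  | cons φ l ih =>
    rw [List.forall_mem_cons, and_imp, ← ih]
    rfl

/-- Only the values at the quantified variables are recorded; these are all that `rep_of_sat` needs
in order to read off `Rep`. -/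
theorem exists_of_sat_allFs (σ : ℕ → M.N) (τ : (k : ℕ) → ℕ → M.F k) (m : ℕ) : ∀ (φ : PF)
    (w : Fin m → M.F 1), M.sat σ τ (PF.allFs m φ) →
      ∃ τ' : (k : ℕ) → ℕ → M.F k, (∀ j : Fin m, τ' 1 j = w j) ∧ M.sat σ τ' φ := by
  induction m with
  | zero => exact fun φ w h => ⟨τ, fun j => j.elim0, h⟩
  | succ m ih =>
    intro φ w h
    obtain ⟨τ', hτ, h⟩ := ih (.allF 1 φ) (fun j => w j.succ) h
    refine ⟨Struct.pushF (w 0) τ', Fin.cases (by simp [Struct.pushF]) fun j => ?_, h (w 0)⟩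
    rw [← hτ]
    simp [Struct.pushF]

/-- The functions over representations of hyper-terms given by the functional variables of the
program-functions respect the equality of hyper-terms. -/
def Rep (M : Model) (C : ConVoc) (P : List ℕ) : Prop :=
  ∀ (f : Fin P.length) (x y : Fin (P.get f) → M.F 1), (∀ j, HTm C (x j)) → (∀ j, HTm C (y j)) →
    (∀ j, Same C (x j) (y j)) → HTm C (M.fnl (fun _ => 1) 1 f x) ∧
      Same C (M.fnl (fun _ => 1) 1 f x) (M.fnl (fun _ => 1) 1 f y)

theorem rep_of_sat (σ : ℕ → M.N) (τ : (k : ℕ) → ℕ → M.F k)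
    (h : ∀ φ ∈ progForms C P, M.sat σ τ φ) : Rep M C P := by
  intro f x y hx hy hxy
  obtain ⟨τ', hτ, h⟩ := exists_of_sat_allFs σ τ _ _ (Fin.append x y)
    (h _ (List.mem_ofFn.2 ⟨f, rfl⟩))
  have hx' : ∀ j : Fin (P.get f), τ' 1 j = x j := fun j => by
    simpa using hτ (Fin.castAdd _ j)
  have hy' : ∀ j : Fin (P.get f), τ' 1 (P.get f + j) = y j := fun j => by
    exact (hτ (Fin.natAdd _ j)).trans (Fin.append_right x y j)
  simp only [Struct.sat, sat_conj_ofFn, sat_htm, sat_sameForm, progT, Struct.evF, hx', hy'] at h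
  exact h fun j => ⟨hx j, hy j, hxy j⟩

/-- The function represented by a program-term. -/
def val {n : ℕ} (v : Fin n → M.F 1) : Tm C P n → M.F 1
  | .var i => v i
  | .con c ts => con c fun k => val v (ts k)
  | .prog f ts => M.fnl (fun _ => 1) 1 f fun k => val v (ts k)

/-- Satisfaction of a formula by representations of hyper-terms. -/
def Sem : {n : ℕ} → (Fin n → M.F 1) → Fm D P n → Prop
  | _, _, .bot => False
  | _, v, .eq t u => Same C (val v t) (val v u)
  | _, v, .ty b i t => Typed D b i (val v t)
  | _, v, .imp φ ψ => Sem v φ → Sem v ψ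
  | _, v, .and φ ψ => Sem v φ ∧ Sem v ψ
  | _, v, .or φ ψ => Sem v φ ∨ Sem v ψ
  | _, v, .all φ => ∀ x : M.F 1, HTm C x → Sem (Fin.cons x v) φ
  | _, v, .ex φ => ∃ x : M.F 1, HTm C x ∧ Sem (Fin.cons x v) φ

theorem evF_interp {n : ℕ} (τ : (k : ℕ) → ℕ → M.F k) (t : Tm C P n) :
    M.evF τ t.interp = val (fun i => τ 1 i) t := by
  induction t with
  | var i => rfl
  | con c ts ih => simp only [Tm.interp, val, evF_conT, ih]
  | prog f ts ih => simp only [Tm.interp, val, progT, Struct.evF, ih]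

theorem pushF_eq_cons {n : ℕ} (x : M.F 1) (τ : (k : ℕ) → ℕ → M.F k) :
    (fun i : Fin (n + 1) => Struct.pushF x τ 1 i) =
      Fin.cons (α := fun _ => M.F 1) x (fun i : Fin n => τ 1 i) := by
  funext i
  refine Fin.cases ?_ (fun i => ?_) i <;> simp [Struct.pushF]

theorem sat_interp {n : ℕ} (φ : Fm D P n) : ∀ (σ : ℕ → M.N) (τ : (k : ℕ) → ℕ → M.F k),
    M.sat σ τ φ.interp ↔ Sem (fun i => τ 1 i) φ := by
  induction φ with
  | bot => intros; rfl
  | eq t u => intros; simp only [Fm.interp, Sem, sat_sameForm, evF_interp]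
  | ty b i t =>
    intro σ τ
    simp only [Fm.interp, Sem, sat_typeForm, evF_interp]
    -- The translation types the sub-term at the empty address, which is the whole term up to
    -- `Same`.
    exact (typedAt_iff b (addr_zero _)).trans (typed_congr (same_sub_zero _))
  | imp φ ψ ih ih' => intros; simp only [Fm.interp, Sem, Struct.sat, ih, ih']
  | and φ ψ ih ih' => intros; simp only [Fm.interp, Sem, Struct.sat, ih, ih']
  | or φ ψ ih ih' => intros; simp only [Fm.interp, Sem, Struct.sat, ih, ih']
  | all φ ih =>
    intros
    simp only [Fm.interp, Sem, Struct.sat, ih, sat_htm, pushF_eq_cons]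
    simp only [Struct.evF, Struct.pushF, dite_true]
  | ex φ ih =>
    intros
    simp only [Fm.interp, Sem, Struct.sat, ih, sat_htm, pushF_eq_cons]
    simp only [Struct.evF, Struct.pushF, dite_true]

/-- The translation of `φ` is itself the defining formula, once terms for the values of the
variables are substituted. This makes the schemas of the intrinsic theory instances of definable
induction in `M`. -/
theorem def_sem {α : Type} [Ctx M α] {n : ℕ} (φ : Fm D P n) (v : α → Fin n → M.F 1)
    (hv : ∀ i, DefF M fun a => v a i) : Def M fun a => Sem (v a) φ := by
  choose t ht using fun i => (hv i).out
  let τ : (k : ℕ) → ℕ → FT k := fun k j => if h : k = 1 ∧ j < n then h.1 ▸ t ⟨j, h.2⟩ else .var k j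
  refine ⟨φ.interp.subst NT.var τ, fun a => ?_⟩
  have : (fun i : Fin n => M.evF (Ctx.envF a) (τ 1 i)) = v a := by
    funext i
    simp [τ, ht]
  rw [Struct.sat_subst, sat_interp, this]

theorem val_subst {n m : ℕ} (s : Fin n → Tm C P m) (v : Fin m → M.F 1) (t : Tm C P n) :
    val v (t.subst s) = val (fun i => val v (s i)) t := by
  induction t with
  | var i => rfl
  | con c ts ih => simp only [Tm.subst, val, ih]
  | prog f ts ih => simp only [Tm.subst, val, ih]

theorem val_up {n : ℕ} (x : M.F 1) (v : Fin n → M.F 1) (t : Tm C P n) :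
    val (Fin.cons x v : Fin (n + 1) → M.F 1) t.up = val v t := by
  rw [Tm.up, val_subst]
  rfl

theorem val_liftSubst {n m : ℕ} (s : Fin n → Tm C P m) (x : M.F 1) (v : Fin m → M.F 1) :
    (fun i => val (Fin.cons x v : Fin (m + 1) → M.F 1) (liftSubst s i)) =
      Fin.cons (α := fun _ => M.F 1) x fun i => val v (s i) := by
  funext i
  refine Fin.cases rfl (fun i => ?_) i
  exact val_up x v (s i)

theorem sem_subst {n : ℕ} (φ : Fm D P n) : ∀ {m : ℕ} (s : Fin n → Tm C P m) (v : Fin m → M.F 1),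
    Sem v (φ.subst s) ↔ Sem (fun i => val v (s i)) φ := by
  induction φ with
  | bot => intros; rfl
  | eq t u => intros; simp only [Fm.subst, Sem, val_subst]
  | ty b i t => intros; simp only [Fm.subst, Sem, val_subst]
  | imp φ ψ ih ih' => intros; simp only [Fm.subst, Sem, ih, ih']
  | and φ ψ ih ih' => intros; simp only [Fm.subst, Sem, ih, ih']
  | or φ ψ ih ih' => intros; simp only [Fm.subst, Sem, ih, ih']
  | all φ ih => intros; simp only [Fm.subst, Sem, ih, val_liftSubst]
  | ex φ ih => intros; simp only [Fm.subst, Sem, ih, val_liftSubst]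

theorem sem_up {n : ℕ} (φ : Fm D P n) (x : M.F 1) (v : Fin n → M.F 1) :
    Sem (Fin.cons x v : Fin (n + 1) → M.F 1) φ.up ↔ Sem v φ := by
  rw [Fm.up, sem_subst]
  rfl

theorem val_cases {n m : ℕ} (t : Tm C P m) (s : Fin n → Tm C P m) (v : Fin m → M.F 1) :
    (fun i => val v (Fin.cases (motive := fun _ => Tm C P m) t s i)) =
      Fin.cons (α := fun _ => M.F 1) (val v t) fun i => val v (s i) := by
  funext i
  refine Fin.cases rfl (fun i => rfl) i

theorem sem_inst {n : ℕ} (φ : Fm D P (n + 1)) (t : Tm C P n) (v : Fin n → M.F 1) :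
    Sem v (φ.inst t) ↔ Sem (Fin.cons (val v t) v : Fin (n + 1) → M.F 1) φ := by
  rw [Fm.inst, sem_subst, val_cases]
  rfl

theorem sem_conj {n : ℕ} (v : Fin n → M.F 1) (l : List (Fm D P n)) :
    Sem v (Fm.conj l) ↔ ∀ φ ∈ l, Sem v φ := by
  induction l with
  | nil => simp [Fm.conj, Sem]
  | cons φ l ih =>
    rw [List.forall_mem_cons, ← ih]
    rfl

theorem sem_disj {n : ℕ} (v : Fin n → M.F 1) (l : List (Fm D P n)) :
    Sem v (Fm.disj l) ↔ ∃ φ ∈ l, Sem v φ := by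
  induction l with
  | nil => simp [Fm.disj, Sem]
  | cons φ l ih =>
    rw [List.exists_mem_cons_iff, ← ih]
    rfl

theorem sem_conj_ofFn {n m : ℕ} (v : Fin n → M.F 1) (f : Fin m → Fm D P n) :
    Sem v (Fm.conj (List.ofFn f)) ↔ ∀ i, Sem v (f i) := by
  rw [sem_conj, List.forall_mem_ofFn_iff]

/-- The values `w` for the first `r` variables, followed by `v`. -/
def pushes {n r : ℕ} (w : Fin r → M.F 1) (v : Fin n → M.F 1) (i : Fin (n + r)) : M.F 1 :=
  if h : i < r then w ⟨i, h⟩ else v ⟨i - r, by omega⟩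

theorem cons_pushes {n r : ℕ} (x : M.F 1) (w : Fin r → M.F 1) (v : Fin n → M.F 1) :
    (Fin.cons x (pushes w v) : Fin (n + r + 1) → M.F 1) =
      pushes (Fin.cons x w : Fin (r + 1) → M.F 1) v := by
  funext i
  refine Fin.cases ?_ (fun i => ?_) i
  · simp [pushes]
  · simp only [Fin.cons_succ, pushes, Fin.val_succ, add_lt_add_iff_right, Nat.add_sub_add_right]
    rfl

theorem forall_cons_iff {r : ℕ} {p : (Fin (r + 1) → M.F 1) → Prop} :
    (∀ w : Fin (r + 1) → M.F 1, p w) ↔ ∀ (w : Fin r → M.F 1) (x : M.F 1), p (Fin.cons x w) :=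
  ⟨fun h _ _ => h _, fun h w => Fin.cons_self_tail w ▸ h _ _⟩

theorem sem_alls {n : ℕ} (v : Fin n → M.F 1) (r : ℕ) : ∀ φ : Fm D P (n + r),
    Sem v (Fm.alls r φ) ↔ ∀ w : Fin r → M.F 1, (∀ k, HTm C (w k)) → Sem (pushes w v) φ := by
  induction r with
  | zero =>
    intro φ
    exact ⟨fun h w _ => h, fun h => h Fin.elim0 fun k => k.elim0⟩
  | succ r ih =>
    intro φ
    rw [Fm.alls, ih, forall_cons_iff]
    refine forall_congr' fun w => ?_
    simp only [Sem, Fin.forall_fin_succ, Fin.cons_zero, Fin.cons_succ, cons_pushes]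
    exact ⟨fun h x hx => h hx.2 x hx.1, fun h hw x hx => h x ⟨hx, hw⟩⟩

theorem sem_exs {n : ℕ} (v : Fin n → M.F 1) (r : ℕ) : ∀ φ : Fm D P (n + r),
    Sem v (Fm.exs r φ) ↔ ∃ w : Fin r → M.F 1, (∀ k, HTm C (w k)) ∧ Sem (pushes w v) φ := by
  induction r with
  | zero =>
    intro φ
    exact ⟨fun h => ⟨Fin.elim0, fun k => k.elim0, h⟩, fun ⟨w, _, h⟩ => h⟩
  | succ r ih =>
    intro φ
    rw [Fm.exs, ih]
    simp only [Sem, cons_pushes]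
    constructor
    · rintro ⟨w, hw, x, hx, h⟩
      exact ⟨Fin.cons x w, Fin.cases hx hw, h⟩
    · rintro ⟨w, hw, h⟩
      exact ⟨fun k => w k.succ, fun k => hw k.succ, w 0, hw 0, by
        rwa [← Fin.cons_self_tail w] at h⟩

theorem val_bvars {n r : ℕ} (w : Fin r → M.F 1) (v : Fin n → M.F 1) (k : Fin r) :
    val (pushes w v) (bvars C P n r k) = w k := by
  simp [bvars, val, pushes]

theorem pushes_addNat {n r : ℕ} (w : Fin r → M.F 1) (v : Fin n → M.F 1) (j : Fin n) :
    pushes w v (j.addNat r) = v j := by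
  simp [pushes]

theorem sem_argForm {b : Fin D.bundles} {n m : ℕ} (φ : Fin (D.size b) → Fm D P (n + 1))
    (ρ : Fin n → Fin m) (Q : ArgType D.size b) (t : Tm C P m) (v : Fin m → M.F 1) :
    Sem v (argForm D φ ρ Q t) ↔
      ArgTyped (fun i x => Sem (Fin.cons x fun j => v (ρ j) : Fin (n + 1) → M.F 1) (φ i)) Q
        (val v t) := by
  cases Q with
  | own i =>
    rw [argForm, sem_subst, val_cases]
    rfl
  | lower b' h i => rfl

theorem sem_constrForm {n : ℕ} (b : Fin D.bundles) (φ : Fin (D.size b) → Fm D P (n + 1))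
    (v : Fin n → M.F 1) : Sem v (constrForm D b φ) ↔
      ∀ i, ∀ R ∈ D.rules b i, ∀ w : Fin (C.arity R.con) → M.F 1, (∀ k, HTm C (w k)) →
        (∀ k, ArgTyped (fun i x => Sem (Fin.cons x v : Fin (n + 1) → M.F 1) (φ i)) (R.arg k)
          (w k)) →
        Sem (Fin.cons (con R.con w) v : Fin (n + 1) → M.F 1) (φ i) := by
  rw [constrForm, sem_conj_ofFn]
  refine forall_congr' fun i => ?_
  rw [sem_conj, List.forall_mem_map]
  refine forall₂_congr fun R _ => ?_
  simp only [sem_alls, Sem, sem_conj_ofFn, sem_argForm, pushes_addNat, val_bvars, val]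
  rfl

theorem sem_deconstrForm {n : ℕ} (b : Fin D.bundles) (φ : Fin (D.size b) → Fm D P (n + 1))
    (v : Fin n → M.F 1) : Sem v (deconstrForm D b φ) ↔
      ∀ i, ∀ x, HTm C x → Sem (Fin.cons x v : Fin (n + 1) → M.F 1) (φ i) →
        ∃ R ∈ D.rules b i, ∃ w : Fin (C.arity R.con) → M.F 1, (∀ k, HTm C (w k)) ∧
          Same C x (con R.con w) ∧
          ∀ k, ArgTyped (fun i x => Sem (Fin.cons x v : Fin (n + 1) → M.F 1) (φ i)) (R.arg k)
            (w k) := by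
  simp only [deconstrForm, sem_conj_ofFn, Sem, sem_disj, List.mem_map, exists_exists_and_eq_and,
    sem_exs, sem_argForm, pushes_addNat, val_bvars, val, Fin.cons_zero, Fin.cons_succ]

/-! ### Invariance under `Same`, and soundness of the intrinsic theory. -/

variable (hP : Rep M C P)
include hP

theorem htm_val {n : ℕ} {v : Fin n → M.F 1} (hv : ∀ i, HTm C (v i)) (t : Tm C P n) :
    HTm C (val v t) := by
  induction t with
  | var i => exact hv i
  | con c ts ih => exact htm_con c ih
  | prog f ts ih => exact (hP f _ _ ih ih fun j => .refl _).1

theorem same_val {n : ℕ} {v w : Fin n → M.F 1} (hv : ∀ i, HTm C (v i))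
    (h : ∀ i, Same C (v i) (w i)) (t : Tm C P n) : Same C (val v t) (val w t) := by
  induction t with
  | var i => exact h i
  | con c ts ih => exact same_con c ih
  | prog f ts ih =>
    exact (hP f _ _ (fun j => htm_val hP hv _)
      (fun j => htm_val hP (fun i => (h i).htm (hv i)) _) ih).2

/-- Leibniz's law for translated formulas. Program-functions respect `Same` on hyper-terms only, so
the values must represent hyper-terms; relativized quantifiers preserve this. -/
theorem sem_congr {n : ℕ} (φ : Fm D P n) : ∀ {v w : Fin n → M.F 1}, (∀ i, HTm C (v i)) →
    (∀ i, Same C (v i) (w i)) → (Sem v φ ↔ Sem w φ) := by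
  induction φ with
  | bot => intros; rfl
  | eq t u =>
    intro v w hv h
    have ht := same_val hP hv h t
    have hu := same_val hP hv h u
    exact ⟨fun e => (ht.symm.trans e).trans hu, fun e => (ht.trans e).trans hu.symm⟩
  | ty b i t => exact fun hv h => typed_congr (same_val hP hv h t)
  | imp φ ψ ih ih' => exact fun hv h => imp_congr (ih hv h) (ih' hv h)
  | and φ ψ ih ih' => exact fun hv h => and_congr (ih hv h) (ih' hv h)
  | or φ ψ ih ih' => exact fun hv h => or_congr (ih hv h) (ih' hv h)
  | all φ ih =>
    exact fun hv h => forall_congr' fun x => imp_congr_right fun hx =>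
      ih (Fin.cases hx hv) (Fin.cases (.refl x) h)
  | ex φ ih =>
    exact fun hv h => exists_congr fun x => and_congr_right fun hx =>
      ih (Fin.cases hx hv) (Fin.cases (.refl x) h)

omit hP in
theorem ArgTyped.mono {b : Fin D.bundles} {p q : Fin (D.size b) → M.F 1 → Prop}
    (h : ∀ i x, p i x → q i x) {Q : ArgType D.size b} {x : M.F 1} (hx : ArgTyped p Q x) :
    ArgTyped q Q x := by
  cases Q with
  | own j => exact h j x hx
  | lower b' hb' j => exact hx

theorem sem_axiom {n : ℕ} {φ : Fm D P n} (h : ITAxiom D φ) {v : Fin n → M.F 1}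
    (hv : ∀ i, HTm C (v i)) : Sem v φ := by
  have congr : ∀ (φ : Fm D P (n + 1)) (x y : M.F 1), HTm C x → Same C x y →
      Sem (Fin.cons x v : Fin (n + 1) → M.F 1) φ → Sem (Fin.cons y v : Fin (n + 1) → M.F 1) φ :=
    fun φ x y hx h => (sem_congr hP φ (Fin.cases hx hv) (Fin.cases h fun i => .refl _)).1
  have hdef : ∀ φ : Fm D P (n + 1), Def M fun p : Unit × M.F 1 =>
      Sem (Fin.cons p.2 v : Fin (n + 1) → M.F 1) φ := fun φ =>
    def_sem φ (fun p : Unit × M.F 1 => (Fin.cons p.2 v : Fin (n + 1) → M.F 1))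
      (Fin.cases (inferInstanceAs (DefF M fun p : Unit × M.F 1 => p.2))
        fun i => inferInstanceAs (DefF M fun p : Unit × M.F 1 => v i))
  cases h with
  | sep_inj c s t k => exact fun h => con_inj c h k
  | sep_ne c d hcd s t => exact fun h => hcd (con_ne h)
  | construction b hb =>
    rw [sem_constrForm]
    intro i R hR w hw hk
    refine typed_construction hb hR (con_zero _ _) fun k => ?_
    exact ArgTyped.congr (P := Typed D b) (fun i x y h => Typed.congr b h) (sub_con _ w k).symm
      (hk k)
  | deconstruction b hb =>
    rw [sem_deconstrForm]
    intro i x hx h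
    obtain ⟨R, hR, hc, hk⟩ := typed_deconstruction hb h
    exact ⟨R, hR, _, fun k => hx.sub (addr_child hc k), same_con_sub hc, hk⟩
  | induction b hb φ =>
    intro h
    rw [sem_constrForm] at h
    rw [sem_conj_ofFn]
    intro i x hx hi
    -- The conjunct `HTm C x` is added because `typed_induction` wants a predicate invariant under
    -- `Same` for arbitrary functions, whereas `sem_congr` applies to hyper-terms only.
    refine (typed_induction hb
      (fun i x => HTm C x ∧ Sem (Fin.cons x v : Fin (n + 1) → M.F 1) (φ i))
      (fun i x y hxy h => ⟨hxy.htm h.1, congr _ x y h.1 hxy h.2⟩)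
      (fun i R hR x hx hc hk => ⟨hx, ?_⟩) hx hi).2
    have hsub := fun k => hx.sub (addr_child hc k)
    exact congr _ _ x (htm_con _ hsub) (same_con_sub hc).symm
      (h i R hR _ hsub fun k => (hk k).mono fun i x h => h.2)
  | coinduction b hb φ =>
    intro h
    rw [sem_deconstrForm] at h
    rw [sem_conj_ofFn]
    intro i x hx hi
    refine typed_coinduction hb
      (fun i x => HTm C x ∧ Sem (Fin.cons x v : Fin (n + 1) → M.F 1) (φ i))
      (fun i x hx h' => ?_) hx ⟨hx, hi⟩
    obtain ⟨R, hR, w, hw, hxw, hk⟩ := h i x hx h'.2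
    have hc : ap x 0 = M.num R.con := (hxw 0 (addr_zero x)).trans (con_zero _ w)
    refine ⟨R, hR, hc, fun k => ?_⟩
    -- The arguments supplied by the deconstruction formula are, up to `Same`, the actual immediate
    -- sub-terms of `x`.
    have hs : Same C (w k) (sub x (cons (M.num k) 0)) :=
      ((hxw.sub (addr_child hc k)).trans (sub_con _ w k)).symm
    have := hk k
    revert this
    cases R.arg k with
    | own j => exact fun h => ⟨hs.htm (hw k), congr _ _ _ (hw k) hs h⟩
    | lower b' hb' j => exact Typed.congr b' hs

/-- Soundness of intrinsic theories. -/
theorem sem_of_der {n : ℕ} {Γ : List (Fm D P n)} {φ : Fm D P n} (h : ITDer D Γ φ) :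
    ∀ {v : Fin n → M.F 1}, (∀ i, HTm C (v i)) → (∀ ψ ∈ Γ, Sem v ψ) → Sem v φ := by
  have up : ∀ {n : ℕ} {Γ : List (Fm D P n)} {v : Fin n → M.F 1} {x : M.F 1},
      (∀ ψ ∈ Γ, Sem v ψ) → ∀ ψ ∈ Γ.map Fm.up, Sem (Fin.cons x v : Fin (n + 1) → M.F 1) ψ := by
    intro n Γ v x h
    simpa only [List.forall_mem_map, sem_up] using h
  induction h with
  | ax h => exact fun hv _ => sem_axiom hP h hv
  | hyp h => exact fun _ hΓ => hΓ _ h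
  | raa _ ih => exact fun hv hΓ => by_contra fun h => ih hv (List.forall_mem_cons.2 ⟨h, hΓ⟩)
  | impI _ ih => exact fun hv hΓ h => ih hv (List.forall_mem_cons.2 ⟨h, hΓ⟩)
  | impE _ _ ih ih' => exact fun hv hΓ => ih hv hΓ (ih' hv hΓ)
  | andI _ _ ih ih' => exact fun hv hΓ => ⟨ih hv hΓ, ih' hv hΓ⟩
  | andE₁ _ ih => exact fun hv hΓ => (ih hv hΓ).1
  | andE₂ _ ih => exact fun hv hΓ => (ih hv hΓ).2
  | orI₁ _ ih => exact fun hv hΓ => .inl (ih hv hΓ)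
  | orI₂ _ ih => exact fun hv hΓ => .inr (ih hv hΓ)
  | orE _ _ _ ih ih₁ ih₂ =>
    exact fun hv hΓ => (ih hv hΓ).elim (fun h => ih₁ hv (List.forall_mem_cons.2 ⟨h, hΓ⟩))
      fun h => ih₂ hv (List.forall_mem_cons.2 ⟨h, hΓ⟩)
  | allI _ ih => exact fun hv hΓ x hx => ih (Fin.cases hx hv) (up hΓ)
  | allE _ t ih => exact fun hv hΓ => (sem_inst _ t _).2 (ih hv hΓ _ (htm_val hP hv t))
  | exI t _ ih => exact fun hv hΓ => ⟨_, htm_val hP hv t, (sem_inst _ t _).1 (ih hv hΓ)⟩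
  | exE _ _ ih ih₁ =>
    intro v hv hΓ
    obtain ⟨x, hx, h⟩ := ih hv hΓ
    exact (sem_up _ x v).1 (ih₁ (Fin.cases hx hv) (List.forall_mem_cons.2 ⟨h, up hΓ⟩))
  | eqRefl t => exact fun _ _ => .refl _
  | @eqSubst n Γ t u φ _ _ ih ih₁ =>
    intro v hv hΓ
    rw [sem_inst]
    refine (sem_congr hP φ (Fin.cases (htm_val hP hv t) hv) ?_).1 ((sem_inst _ _ _).1 (ih₁ hv hΓ))
    exact Fin.cases (ih hv hΓ) fun i => .refl _

end Model

/-! ### Return from models to provability in PRA*. -/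

theorem provable_interp {C : ConVoc} {D : DataSystem C} {P : List ℕ} {n : ℕ} {φ : Fm D P n}
    (h : ITProvable D φ) :
    PRAProvable (PF.imps (htms C n) (PF.imps (progForms C P) φ.interp)) := by
  refine provable_of_sat fun M => ?_
  -- In a model the two lists of premises say that the variables denote hyper-terms and that `Rep`
  -- holds: exactly the hypotheses of soundness.
  rw [Model.sat_imps, Model.sat_imps, htms, List.forall_mem_ofFn_iff]
  intro hv hP
  rw [Model.sat_interp]
  exact Model.sem_of_der (Model.rep_of_sat _ _ hP) h (fun i => (Model.sat_htm _ _ _).1 (hv i))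
    (by simp)

end IntrinsicTheory

open IntrinsicTheory in
theorem theorem6p6 (C : ConVoc) (D : DataSystem C) :
    -- the domain of the interpretation is non-empty and closed under the constructors
    PRAProvable (.exF 1 (htm C (.var 1 0))) ∧
    (∀ c : Fin C.num,
      PRAProvable (PF.imps (htms C (C.arity c)) (htm C (conT C c fun j => .var 1 j)))) ∧
    -- closed formulas over the vocabulary of the data-system
    (∀ φ : Fm D [] 0, ITProvable D φ → PRAProvable φ.interp) ∧
    -- formulas with free variables, and possibly with program-functions
    (∀ (P : List ℕ) (n : ℕ) (φ : Fm D P n), ITProvable D φ →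
      PRAProvable (PF.imps (htms C n) (PF.imps (progForms C P) φ.interp))) := by
  refine ⟨provable_of_sat fun M => ?_, fun c => provable_of_sat fun M => ?_,
    fun φ h => ?_, fun P n φ => provable_interp⟩
  · obtain ⟨x, hx⟩ := Model.exists_htm (M := M) C
    refine ⟨x, (Model.sat_htm _ _ _).2 ?_⟩
    simpa [Struct.evF, Struct.pushF] using hx
  · rw [Model.sat_imps, htms, List.forall_mem_ofFn_iff, Model.sat_htm, Model.evF_conT]
    exact fun h => Model.htm_con c fun j => (Model.sat_htm _ _ _).1 (h j)
  -- Without free variables and program-functions both lists of premises are empty.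
  · simpa [htms, progForms, PF.imps] using provable_interp h
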